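/- Let $d_1,d_2\in\mathbb N_0$, $T>0$, $x\in\mathbb R^{d_1}$, $y_0\in\mathbb R^{d_2}$, let $g:\mathbb R^{d_1}\times\mathbb R^{d_2}\to\mathbb R^{d_1}$, and for every $x\in\mathbb R^{d_1}$ let $\rho_x(y,dz)$ be a transition probability kernel on $\mathbb R^{d_2}$ with $i$-step kernels $\rho_x^{(i)}$. Assume: 1. $g$ is measurable, and $x\mapsto g(x,z)$ is Lipschitz for every $z$. 2. $\rho_x(y,dz)=\eta_x(y,z)\,\lambda(dz)$ for a probability measure $\lambda$ on $\mathbb R^{d_2}$ and $\eta_x(y,z)\in[0,\infty)$, where $x\mapsto\eta_x(y,z)$ is continuous, uniformly in $(y,z)$, and $(y,z)\mapsto\eta_x(y,z)$ is continuous for every $x$. 3. $\Lambda(x,\alpha,y)=\log\int e^{\langle\alpha,g(x,z)\rangle}\rho_x(y,dz)$ is continuous in $(x,\alpha)\in\mathbb R^{d_1}\times\mathbb R^{d_1}$, uniformly in $y$. 4. For every compact $K\subset\mathbb R^{d_1}$ there is $C(K)<\infty$ with $\eta_x(y,z)\le C(K)\,\eta_w(y,z)$ for all $x,w\in K$ and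 all $y,z$. 5. For every $x$ there are positive integers $l_0,n_0$ such that $\sum_{i\ge l_0}2^{-i}\rho_x^{(i)}(y,\cdot)\ll\sum_{j\ge n_0}2^{-j}\rho_x^{(j)}(w,\cdot)$ for all $y,w$. 6. $\sup_{x,y}\int e^{\langle\alpha,g(x,z)\rangle}\rho_x(y,dz)<\infty$ for every $\alpha\in\mathbb R^{d_1}$, and $\sup_{x,y}\int e^{\langle\alpha,z\rangle}\rho_x(y,dz)<\infty$ for every $\alpha\in\mathbb R^{d_2}$. 7. $(\varepsilon_k)_{k\ge0}$ are positive step sizes with $\varepsilon_k\to0$ and $\sum_k\varepsilon_k=\infty$. Put $t_n=\sum_{k=0}^{n-1}\varepsilon_k$, $\mathbf m(s)=\max\{n:t_n\le s\}$ and $\beta_n=\mathbf m(t_n+T)-n$, and suppose that $\beta_n\ge1$ for all $n$. The functions $h^n(t)=\beta_n\varepsilon_i$ for $t\in[t_i-t_n,t_{i+1}-t_n)$, $n\le i<n+\beta_n$, converge to some $h:[0,T]\to\mathbb R$ uniformly, in the sense that the supremum of $|h^n-h|$ over $[0,t_{n+\beta_n}-t_n)$ tends to $0$. For every $n\ge0$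 let, on some probability space, $\tilde Y^n_i$ $(n\le i<n+\beta_n)$ be $\mathbb R^{d_2}$-valued random variables and $\tilde\nu^n_i$ random probability measures on $\mathbb R^{d_2}$ such that $\tilde\nu^n_i$ is $\sigma(\tilde Y^n_n,\dots,\tilde Y^n_{i-1})$-measurable and is the conditional distribution of $\tilde Y^n_i$ given this $\sigma$-algebra. Put $\tilde Y^n_{n-1}=y_0$, $\tilde X^n_n=x$ and $\tilde X^n_{i+1}=\tilde X^n_i+\varepsilon_i\,g(\tilde X^n_i,\tilde Y^n_i)$. Let $\tilde X^n\in C([0,T]:\mathbb R^{d_1})$ be the piecewise linear interpolation with $\tilde X^n(t_i-t_n)=\tilde X^n_i$ for $n\le i\le n+\beta_n$, constant on $[t_{n+\beta_n}-t_n,T]$, and let $\tilde\nu^n$ be the random probability measure on $\mathbb R^{d_2}\times[0,T]$ given by $$\tilde\nu^n(A\times B)=\sum_{i=n}^{n+\beta_n-1}\int_{B\cap[t_i-t_n,\,t_{i+1}-t_n)}\frac{1}{h^n(t)}\,\tilde\nu^n_i(A)\,dt .$$ Suppose that, with $R(\cdot\|\cdot)$ the relative entropy, $$\sup_n E\Big[\frac1{\beta_n}\sum_{i=n}^{n+\beta_n-1}R\big(\tilde\nu^n_i\,\big\|\,\rho_{\tilde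 X^n_i}(\tilde Y^n_{i-1},\cdot)\big)\Big]<\infty .$$ Then the pairs $(\tilde\nu^n,\tilde X^n)$ are random elements of $\mathcal P(\mathbb R^{d_2}\times[0,T])\times C([0,T]:\mathbb R^{d_1})$ (weak topology times uniform topology, Borel $\sigma$-algebra) and form a tight sequence, and every subsequence has a further subsequence that converges weakly (in distribution). Moreover, whenever a subsequence converges weakly to $(\tilde\nu,\tilde X)$, there is a stochastic kernel $\tilde\nu(dy|t)$ on $\mathbb R^{d_2}$ (a jointly measurable function of $t\in[0,T]$ and of $(\tilde\nu,\tilde X)$) such that almost surely $$\tilde\nu(A\times B)=\int_B\tilde\nu(A|t)\,\frac1{h(t)}\,dt\qquad\text{for all Borel }A\subset\mathbb R^{d_2},\ B\subset[0,T],$$ $\int_0^T\!\int\|g(\tilde X(s),y)\|\,\tilde\nu(dy|s)\,ds<\infty$, and $$\tilde X(t)=x+\int_0^t\int_{\mathbb R^{d_2}}g(\tilde X(s),y)\,\tilde\nu(dy|s)\,ds\qquad\text{for all }t\in[0,T].$$ -/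

import Mathlib

open MeasureTheory ProbabilityTheory Filter Set
open scoped ENNReal NNReal Topology

noncomputable section

namespace StochApprox

/-- Euclidean space `ℝ^d`. -/
abbrev E (d : ℕ) : Type := EuclideanSpace ℝ (Fin d)

/-- The compact time interval `[0,T]`. -/
abbrev I (T : ℝ) : Type := ↥(Set.Icc (0 : ℝ) T)

/-- Lebesgue measure `dt` on `[0,T]`. -/
def leb (T : ℝ) : Measure (I T) := (volume : Measure ℝ).comap Subtype.val

instance (T : ℝ) : IsFiniteMeasure (leb T) := by
  refine ⟨?_⟩
  rw [leb, comap_subtype_coe_apply measurableSet_Icc, Set.image_univ, Subtype.range_coe]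
  exact measure_Icc_lt_top

/-! ### Step sizes and the time scale -/

/-- `t_n = ε_0 + ⋯ + ε_{n-1}`, the time at which step number `n` (of length `ε_n`) starts. -/
def time (ε : ℕ → ℝ) (n : ℕ) : ℝ := ∑ k ∈ Finset.range n, ε k

/-- `m(s) = max {n : t_n ≤ s}`. -/
def maxStep (ε : ℕ → ℝ) (s : ℝ) : ℕ := sSup {n | time ε n ≤ s}

/-- `β_n = m(t_n + T) - n`, the number of complete steps in the window `[t_n, t_n + T]`. -/
def beta (ε : ℕ → ℝ) (T : ℝ) (n : ℕ) : ℕ := maxStep ε (time ε n + T) - n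

/-- Admissible step sizes for the time horizon `T`: positive, tending to zero, with divergent
sum; the last field says that every window `[t_n, t_n + T]` contains at least one complete step,
so that `1 / β_n` and the profile `h^n` make sense and are positive. -/
structure StepSizes (T : ℝ) where
  ε : ℕ → ℝ
  pos : ∀ k, 0 < ε k
  tendsto_zero : Tendsto ε atTop (𝓝 0)
  tendsto_time : Tendsto (time ε) atTop atTop
  beta_pos : ∀ n, 0 < beta ε T n

namespace StepSizes

variable {T : ℝ} (S : StepSizes T)

/-- `t_n`. -/
def t (n : ℕ) : ℝ := time S.ε n

/-- `β_n`. -/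
def β (n : ℕ) : ℕ := beta S.ε T n

/-- `t_{n+k} - t_n`, the `k`-th breakpoint of the window that starts at `t_n`. -/
def τ (n k : ℕ) : ℝ := S.t (n + k) - S.t n

/-- The `k`-th cell `[t_{n+k} - t_n, t_{n+k+1} - t_n)` of the window, as a subset of `[0,T]`. -/
def cell (n k : ℕ) : Set (I T) := {s | (s : ℝ) ∈ Set.Ico (S.τ n k) (S.τ n (k + 1))}

/-- The value `β_n ε_{n+k}` of the profile `h^n` on the `k`-th cell, `0 ≤ k < β_n`. -/
def hval (n k : ℕ) : ℝ := S.β n * S.ε (n + k)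

/-- The profiles `h^n`, with `h^n = β_n ε_{n+k}` on the `k`-th cell for `0 ≤ k < β_n`, converge
to `h` uniformly (over all points at which `h^n` is given). -/
def ProfileTendsto (h : I T → ℝ) : Prop :=
  ∀ δ : ℝ, 0 < δ → ∀ᶠ n in atTop, ∀ k, k < S.β n → ∀ s ∈ S.cell n k, |S.hval n k - h s| < δ

lemma τ_zero (n : ℕ) : S.τ n 0 = 0 := by simp [τ]

lemma τ_succ (n k : ℕ) : S.τ n (k + 1) = S.τ n k + S.ε (n + k) := by
  simp only [τ, t, time, ← add_assoc, Finset.sum_range_succ]; ring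

lemma τ_mono (n : ℕ) : Monotone (S.τ n) :=
  monotone_nat_of_le_succ fun k => by rw [τ_succ]; linarith [S.pos (n + k)]

lemma τ_nonneg (n k : ℕ) : 0 ≤ S.τ n k := by
  simpa [τ_zero] using S.τ_mono n (Nat.zero_le k)

lemma τ_β_le (n : ℕ) : S.τ n (S.β n) ≤ T := by
  have hpos : 0 < beta S.ε T n := S.beta_pos n
  have hne : {k | time S.ε k ≤ time S.ε n + T}.Nonempty := by
    by_contra hcon
    rw [Set.not_nonempty_iff_eq_empty] at hcon
    rw [beta, maxStep, hcon] at hpos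
    simp at hpos
  have hbdd : BddAbove {k | time S.ε k ≤ time S.ε n + T} := by
    obtain ⟨N, hN⟩ := (S.tendsto_time.eventually_gt_atTop (time S.ε n + T)).exists_forall_of_atTop
    refine ⟨N, fun k hk => ?_⟩
    by_contra hlt
    exact absurd (hN k (by omega)) (not_lt.mpr hk)
  have hmem : time S.ε (maxStep S.ε (time S.ε n + T)) ≤ time S.ε n + T := Nat.sSup_mem hne hbdd
  have hidx : n + S.β n = maxStep S.ε (time S.ε n + T) := by
    unfold β; unfold beta at hpos ⊢; omega
  unfold τ t
  rw [hidx]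
  linarith

lemma measurableSet_cell (n k : ℕ) : MeasurableSet (S.cell n k) :=
  measurable_subtype_coe measurableSet_Ico

/-- A cell with number `k < β_n` lies in `[0,T]` and has length `ε_{n+k}`. -/
lemma volume_cell (n k : ℕ) (hk : k < S.β n) :
    leb T (S.cell n k) = ENNReal.ofReal (S.ε (n + k)) := by
  have himg : (Subtype.val : I T → ℝ) '' S.cell n k = Set.Ico (S.τ n k) (S.τ n (k + 1)) := by
    ext s
    constructor
    · rintro ⟨s', hs', rfl⟩; exact hs'
    · intro hs
      refine ⟨⟨s, (S.τ_nonneg n k).trans hs.1, ?_⟩, hs, rfl⟩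
      exact hs.2.le.trans ((S.τ_mono n (Nat.succ_le_of_lt hk)).trans (S.τ_β_le n))
  rw [leb, comap_subtype_coe_apply measurableSet_Icc, himg, Real.volume_Ico, τ_succ]
  congr 1; ring

end StepSizes

/-! ### Standing assumptions on the update function and the noise kernel -/

/-- `Λ(x, α, y) = log ∫ exp⟨α, g(x,z)⟩ ρ_x(y,dz)`. -/
def logMGF {d₁ d₂ : ℕ} (g : E d₁ → E d₂ → E d₁) (ρ : E d₁ → Kernel (E d₂) (E d₂))
    (x α : E d₁) (y : E d₂) : ℝ :=
  Real.log (∫ z, Real.exp (inner ℝ α (g x z)) ∂(ρ x y))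

/-- The assumptions on the update function `g` and on the transition kernels
`ρ_x(y,dz) = η_x(y,z) lam(dz)`. -/
structure Assumptions {d₁ d₂ : ℕ} (g : E d₁ → E d₂ → E d₁) (ρ : E d₁ → Kernel (E d₂) (E d₂))
    (lam : Measure (E d₂)) (η : E d₁ → E d₂ → E d₂ → ℝ≥0) : Prop where
  /-- `g` is measurable -/
  measurable_g : Measurable (Function.uncurry g)
  /-- `x ↦ g(x,z)` is Lipschitz for every `z` -/
  lipschitz_g : ∀ z, ∃ K : ℝ≥0, LipschitzWith K fun x => g x z
  /-- the reference measure is a probability measure -/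
  isProbabilityMeasure_lam : IsProbabilityMeasure lam
  /-- each `ρ_x(y,·)` is a probability measure -/
  isMarkovKernel : ∀ x, IsMarkovKernel (ρ x)
  /-- `ρ_x(y,dz) = η_x(y,z) lam(dz)` -/
  density : ∀ x y, ρ x y = lam.withDensity fun z => (η x y z : ℝ≥0∞)
  /-- `x ↦ η_x(y,z)` is continuous, uniformly in `(y,z)` -/
  density_continuous_state : ∀ x₀ : E d₁,
    TendstoUniformly (fun x (p : E d₂ × E d₂) => η x p.1 p.2) (fun p => η x₀ p.1 p.2) (𝓝 x₀)
  /-- `(y,z) ↦ η_x(y,z)` is continuous for every `x` -/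
  density_continuous_noise : ∀ x, Continuous fun p : E d₂ × E d₂ => η x p.1 p.2
  /-- `Λ` is continuous in `(x,α)`, uniformly in `y` -/
  logMGF_continuous : ∀ p₀ : E d₁ × E d₁,
    TendstoUniformly (fun p y => logMGF g ρ p.1 p.2 y) (logMGF g ρ p₀.1 p₀.2) (𝓝 p₀)
  /-- the ratios `η_x(y,z) / η_w(y,z)` are bounded, locally uniformly in `x, w`, uniformly
  in `y, z` -/
  density_ratio : ∀ K : Set (E d₁), IsCompact K → ∃ C : ℝ≥0, ∀ x ∈ K, ∀ w ∈ K, ∀ y z,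
    η x y z ≤ C * η w y z
  /-- transitivity: `∑_{i ≥ l₀} 2^{-i} ρ_x^{(i)}(y,·) ≪ ∑_{j ≥ n₀} 2^{-j} ρ_x^{(j)}(w,·)` -/
  transitivity : ∀ x, ∃ l₀ n₀ : ℕ, 0 < l₀ ∧ 0 < n₀ ∧ ∀ y w,
    Measure.sum (fun i : ℕ => ((2 : ℝ≥0∞)⁻¹ ^ (l₀ + i)) • ((ρ x) ^ (l₀ + i)) y) ≪
      Measure.sum (fun j : ℕ => ((2 : ℝ≥0∞)⁻¹ ^ (n₀ + j)) • ((ρ x) ^ (n₀ + j)) w)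
  /-- the exponential moments of the updates are bounded uniformly in the state and the noise -/
  expMoment_update : ∀ α : E d₁, ∃ C : ℝ≥0, ∀ x y,
    ∫⁻ z, ENNReal.ofReal (Real.exp (inner ℝ α (g x z))) ∂(ρ x y) ≤ C
  /-- the exponential moments of the noise are bounded uniformly in the state and the noise -/
  expMoment_noise : ∀ α : E d₂, ∃ C : ℝ≥0, ∀ x y,
    ∫⁻ z, ENNReal.ofReal (Real.exp (inner ℝ α z)) ∂(ρ x y) ≤ C

/-! ### The controlled process

For the run that starts at step `n`, the state, noise and control with absolute index `n + k` are
indexed by `k`: `y k` stands for `Y^n_{n+k}`, `path k` for `X^n_{n+k}`. -/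

section Path

variable {d₁ d₂ : ℕ} {T : ℝ} (S : StepSizes T) (g : E d₁ → E d₂ → E d₁) (x : E d₁)

/-- `X^n_n = x`, `X^n_{i+1} = X^n_i + ε_i g(X^n_i, Y^n_i)`. -/
def path (n : ℕ) (y : ℕ → E d₂) : ℕ → E d₁
  | 0 => x
  | k + 1 => path n y k + S.ε (n + k) • g (path n y k) (y k)

/-- The noise preceding `Y^n_{n+k}`, where the initial noise state is `y₀`. -/
def prevNoise (y₀ : E d₂) (y : ℕ → E d₂) : ℕ → E d₂
  | 0 => y₀
  | k + 1 => y k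

/-- The fraction of the `k`-th step that is completed at time `s`: it is `0` before
`t_{n+k} - t_n`, `1` after `t_{n+k+1} - t_n`, and affine in between. -/
def frac (n k : ℕ) (s : ℝ) : ℝ := min (max (s - S.τ n k) 0) (S.ε (n + k)) / S.ε (n + k)

/-- The continuous piecewise linear interpolation on `[0,T]` with value `X^n_{n+k}` at
`t_{n+k} - t_n`, `0 ≤ k ≤ β_n`; it is constant after the last breakpoint. -/
def interp (n : ℕ) (y : ℕ → E d₂) : C(I T, E d₁) where
  toFun s := x + ∑ k ∈ Finset.range (S.β n),
    frac S n k s • (path S g x n y (k + 1) - path S g x n y k)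
  continuous_toFun := by unfold frac; fun_prop

lemma frac_of_le {n k : ℕ} {s : ℝ} (hs : s ≤ S.τ n k) : frac S n k s = 0 := by
  simp [frac, max_eq_right (sub_nonpos.mpr hs), (S.pos (n + k)).le]

lemma frac_of_ge {n k : ℕ} {s : ℝ} (hs : S.τ n (k + 1) ≤ s) : frac S n k s = 1 := by
  rw [S.τ_succ] at hs
  have hε := S.pos (n + k)
  rw [frac, max_eq_left (by linarith), min_eq_right (by linarith), div_self hε.ne']

lemma path_eq_sum (n : ℕ) (y : ℕ → E d₂) (j : ℕ) :
    path S g x n y j =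
      x + ∑ k ∈ Finset.range j, (path S g x n y (k + 1) - path S g x n y k) := by
  rw [Finset.sum_range_sub, path]; abel

/-- On the `j`-th cell, `interp` is the linear interpolation between `X^n_{n+j}` and
`X^n_{n+j+1}`. -/
lemma interp_of_mem (n : ℕ) (y : ℕ → E d₂) {j : ℕ} (hj : j < S.β n) {s : I T}
    (hs : (s : ℝ) ∈ Set.Icc (S.τ n j) (S.τ n (j + 1))) :
    interp S g x n y s = path S g x n y j +
      (((s : ℝ) - S.τ n j) / S.ε (n + j)) • (path S g x n y (j + 1) - path S g x n y j) := by
  obtain ⟨r, hr⟩ : ∃ r, S.β n = (j + 1) + r := ⟨S.β n - (j + 1), by omega⟩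
  change x + ∑ k ∈ Finset.range (S.β n),
    frac S n k s • (path S g x n y (k + 1) - path S g x n y k) = _
  rw [hr, Finset.sum_range_add, Finset.sum_range_succ, path_eq_sum S g x n y j]
  have h1 : ∀ k ∈ Finset.range j, frac S n k s • (path S g x n y (k + 1) - path S g x n y k) =
      path S g x n y (k + 1) - path S g x n y k := fun k hk => by
    rw [frac_of_ge S ((S.τ_mono n (Finset.mem_range.mp hk)).trans hs.1), one_smul]
  have h2 : ∀ k ∈ Finset.range r, frac S n (j + 1 + k) s •
      (path S g x n y (j + 1 + k + 1) - path S g x n y (j + 1 + k)) = 0 := fun k _ => by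
    rw [frac_of_le S (hs.2.trans (S.τ_mono n (by omega))), zero_smul]
  have h3 : frac S n j s = ((s : ℝ) - S.τ n j) / S.ε (n + j) := by
    have h4 := hs.2
    rw [S.τ_succ] at h4
    rw [frac, max_eq_left (by linarith [hs.1]), min_eq_left (by linarith)]
  rw [Finset.sum_congr rfl h1, Finset.sum_eq_zero h2, h3, ← path_eq_sum S g x n y j,
    path_eq_sum S g x n y j, add_zero, add_assoc]

/-- After the last breakpoint `interp` stays at `X^n_{n+β_n}`. -/
lemma interp_of_ge (n : ℕ) (y : ℕ → E d₂) {s : I T} (hs : S.τ n (S.β n) ≤ (s : ℝ)) :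
    interp S g x n y s = path S g x n y (S.β n) := by
  change x + ∑ k ∈ Finset.range (S.β n),
    frac S n k s • (path S g x n y (k + 1) - path S g x n y k) = _
  rw [path_eq_sum S g x n y (S.β n)]
  congr 1
  refine Finset.sum_congr rfl fun k hk => ?_
  rw [frac_of_ge S ((S.τ_mono n (Finset.mem_range.mp hk)).trans hs), one_smul]

end Path

section Occupation

variable {d₂ : ℕ} {T : ℝ} (S : StepSizes T)

/-- The control measure `ν^n(A × B) = ∫_B ν^n(A|t) / h^n(t) dt` built from controls
`m k = ν^n_{n+k}`, where `ν^n(·|t) = m k` and `h^n(t) = β_n ε_{n+k}` for `t` in the `k`-th cell,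
`0 ≤ k < β_n`. -/
def occMeasure (n : ℕ) (m : ℕ → Measure (E d₂)) : Measure (E d₂ × I T) :=
  ∑ k ∈ Finset.range (S.β n),
    ENNReal.ofReal (1 / S.hval n k) • (m k).prod ((leb T).restrict (S.cell n k))

lemma isProbabilityMeasure_occMeasure (n : ℕ) (m : ℕ → Measure (E d₂))
    [∀ k, IsProbabilityMeasure (m k)] : IsProbabilityMeasure (occMeasure S n m) := by
  have hβ : (0 : ℝ) < S.β n := Nat.cast_pos.mpr (S.beta_pos n)
  have hcell : ∀ k ∈ Finset.range (S.β n),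
      (ENNReal.ofReal (1 / S.hval n k) • (m k).prod
        ((leb T).restrict (S.cell n k))) Set.univ =
      ENNReal.ofReal (1 / S.β n) := fun k hk => by
    have hε := S.pos (n + k)
    rw [Measure.smul_apply, ← Set.univ_prod_univ, Measure.prod_prod, measure_univ, one_mul,
      Measure.restrict_apply_univ, S.volume_cell n k (Finset.mem_range.mp hk), smul_eq_mul,
      ← ENNReal.ofReal_mul (by unfold StepSizes.hval; positivity)]
    congr 1
    unfold StepSizes.hval
    field_simp
  refine ⟨?_⟩
  rw [occMeasure, Measure.finsetSum_apply, Finset.sum_congr rfl hcell, Finset.sum_const,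
    Finset.card_range, nsmul_eq_mul, ← ENNReal.ofReal_natCast (S.β n),
    ← ENNReal.ofReal_mul hβ.le, mul_one_div_cancel hβ.ne', ENNReal.ofReal_one]

end Occupation

/-! ### The space of pairs (control measure, trajectory) -/

/-- `P(ℝ^{d₂} × [0,T]) × C([0,T] : ℝ^{d₁})`, with the product of the weak topology and the
topology of uniform convergence, and with its Borel `σ`-algebra. -/
def PairSpace (T : ℝ) (d₁ d₂ : ℕ) : Type :=
  ProbabilityMeasure (E d₂ × I T) × C(I T, E d₁)

instance (T : ℝ) (d₁ d₂ : ℕ) : TopologicalSpace (PairSpace T d₁ d₂) :=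
  inferInstanceAs (TopologicalSpace (ProbabilityMeasure (E d₂ × I T) × C(I T, E d₁)))

instance (T : ℝ) (d₁ d₂ : ℕ) : MeasurableSpace (PairSpace T d₁ d₂) := borel _

instance (T : ℝ) (d₁ d₂ : ℕ) : BorelSpace (PairSpace T d₁ d₂) := ⟨rfl⟩

/-- The control measure of a pair, as a measure on `ℝ^{d₂} × [0,T]`. -/
def PairSpace.ctrl {T : ℝ} {d₁ d₂ : ℕ} (z : PairSpace T d₁ d₂) : Measure (E d₂ × I T) :=
  (Prod.fst z : ProbabilityMeasure (E d₂ × I T))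

/-- The trajectory of a pair. -/
def PairSpace.traj {T : ℝ} {d₁ d₂ : ℕ} (z : PairSpace T d₁ d₂) : C(I T, E d₁) := Prod.snd z

/-- The random pair `(ν^n, X^n)`. -/
def ctrlPair {d₁ d₂ : ℕ} {T : ℝ} (S : StepSizes T) (g : E d₁ → E d₂ → E d₁) (x : E d₁) (n : ℕ)
    {Ω : Type*} [MeasurableSpace Ω] (ν : ℕ → Kernel Ω (E d₂)) [∀ k, IsMarkovKernel (ν k)]
    (Y : ℕ → Ω → E d₂) (ω : Ω) : PairSpace T d₁ d₂ :=
  (⟨occMeasure S n fun k => ν k ω, isProbabilityMeasure_occMeasure S n fun k => ν k ω⟩,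
    interp S g x n fun k => Y k ω)

/-! ### Controls and their cost -/

/-- `σ(Y_0, …, Y_{k-1})`. -/
abbrev pastSigma {d₂ : ℕ} {Ω : Type*} (Y : ℕ → Ω → E d₂) (k : ℕ) : MeasurableSpace Ω :=
  ⨆ j ∈ Finset.range k, MeasurableSpace.comap (Y j) inferInstance

/-- The first `N` random measures `ν_k` are controls for the noise `Y` under `P`: `ν_k` is
`σ(Y_0, …, Y_{k-1})`-measurable and is the conditional distribution of `Y_k` given this
`σ`-algebra. -/
structure IsControl {d₂ : ℕ} {Ω : Type*} [MeasurableSpace Ω] (P : Measure Ω) (N : ℕ)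
    (ν : ℕ → Kernel Ω (E d₂)) (Y : ℕ → Ω → E d₂) : Prop where
  measurable_noise : ∀ k < N, Measurable (Y k)
  adapted : ∀ k < N, ∀ A : Set (E d₂), MeasurableSet A → Measurable[pastSigma Y k] fun ω => ν k ω A
  condDistr : ∀ k < N, ∀ A : Set (E d₂), MeasurableSet A → ∀ B : Set Ω,
    MeasurableSet[pastSigma Y k] B → P (B ∩ Y k ⁻¹' A) = ∫⁻ ω in B, ν k ω A ∂P

/-- The expected running cost
`E[(1/β_n) ∑_{i=n}^{n+β_n-1} R(ν^n_i ‖ ρ_{X^n_i}(Y^n_{i-1}, ·))]`, where `R` is the relative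
entropy. -/
def runningCost {d₁ d₂ : ℕ} {T : ℝ} (S : StepSizes T) (g : E d₁ → E d₂ → E d₁)
    (ρ : E d₁ → Kernel (E d₂) (E d₂)) (x : E d₁) (y₀ : E d₂) (n : ℕ)
    {Ω : Type*} [MeasurableSpace Ω] (P : Measure Ω) (ν : ℕ → Kernel Ω (E d₂))
    (Y : ℕ → Ω → E d₂) : ℝ≥0∞ :=
  ∫⁻ ω, (S.β n : ℝ≥0∞)⁻¹ * ∑ k ∈ Finset.range (S.β n),
    InformationTheory.klDiv (ν k ω)
      (ρ (path S g x n (fun j => Y j ω) k) (prevNoise y₀ (fun j => Y j ω) k)) ∂P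

end StochApprox

end

/-!
*Uniform estimates.* Young's inequality for `r log r` and `exp` bounds integrals against a control by
its relative entropy plus an exponential integral under the kernel (`lintegral_le_klDiv_add`). With
the exponential moments and the bound on the cost, this yields three properties of the expected
control measures, uniformly over all windows, which are collected in `UniformlyControlled`: the
updates `g` are uniformly integrable, the noise has bounded first moments, and sets that are small
for `lam ⊗ dt` are small for the control measures. The last property holds because the densities
`η` are locally bounded, and it is what allows `g` to be discontinuous in the noise. The profiles
enter here only through bounds `0 < c ≤ h^n ≤ M` (`StepSizes.exists_bounds`). These bounds are a
consequence of uniform convergence on all windows: overlapping windows share their steps, so a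
profile that became unbounded or degenerate somewhere would spoil the profiles of the windows
nearby.

*Tightness.* The interpolated path is Lipschitz with constant `K` up to the total excess
`∑ ε_i (‖g(X_i, Y_i)‖ - K)⁺`, whose expectation is small for large `K` by uniform integrability
(`lintegral_excess_le`). The theorems of Arzelà–Ascoli and Prokhorov then give tightness
(`UniformlyControlled.isTightMeasureSet`) and convergent subsequences. The pairs are measurable
because the Borel `σ`-algebra of the space of pairs is generated by the values `ν(A)` and `X(s)`
(`measurable_pairSpace`).

*The limit.* Replacing `g(X_i, Y_i)`, truncated, by its conditional mean given the past costs a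
martingale with orthogonal increments of size `O(ε_i)`, which vanishes in `L²`
(`integral_fluctuation_sq_le`). So the integral equation holds approximately for the pairs
themselves (`UniformlyControlled.eventually_drift_le`). The functionals in this equation are not
continuous on the space of pairs. However, a bounded function of state and noise that is continuous
in the state is close, outside a set that is small for `lam ⊗ dt`, to a jointly continuous one
(`exists_uniform_approx`, in the manner of Scorza Dragoni), and the error is controlled before the
limit and in the limit alike. This transfers the equation to every weak limit
(`UniformlyControlled.lintegral_le_of_eventually`), and uniform integrability removes the truncation.
The time marginals of the control measures are deterministic and converge to `dt / h(t)`
(`ae_map_snd_ctrl_eq`). Hence disintegrating the limit control measure with respect to time, jointly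
measurably in the pair, gives the required kernel (`limitKernel`).
-/

noncomputable section

namespace StochApprox

/-! ### The space of pairs -/

/-- Pushing forward along an inducing map is inducing for the weak topologies. By the portmanteau
theorem it suffices to consider open sets, and these are preimages of open sets. -/
lemma isInducing_probabilityMeasure_map {X Y : Type*} [TopologicalSpace X] [MeasurableSpace X]
    [BorelSpace X] [TopologicalSpace.PseudoMetrizableSpace X] [TopologicalSpace.SeparableSpace X]
    [TopologicalSpace Y] [MeasurableSpace Y] [BorelSpace Y]
    [TopologicalSpace.PseudoMetrizableSpace Y] [TopologicalSpace.SeparableSpace Y] {f : X → Y}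
    (hf : Topology.IsInducing f) :
    Topology.IsInducing fun μ : ProbabilityMeasure X =>
      μ.map hf.continuous.measurable.aemeasurable := by
  rw [Topology.isInducing_iff_nhds]
  intro μ
  have hcont : Continuous fun μ : ProbabilityMeasure X =>
      μ.map hf.continuous.measurable.aemeasurable :=
    ProbabilityMeasure.continuous_map hf.continuous
  refine le_antisymm hcont.continuousAt.tendsto.le_comap ?_
  set L := comap (fun μ : ProbabilityMeasure X => μ.map hf.continuous.measurable.aemeasurable)
    (𝓝 (μ.map hf.continuous.measurable.aemeasurable)) with hL
  change Tendsto id L (𝓝 μ)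
  refine tendsto_of_forall_isOpen_le_liminf' fun G hG => ?_
  obtain ⟨G', hG', rfl⟩ := hf.isOpen_iff.mp hG
  have h := ProbabilityMeasure.le_liminf_measure_open_of_tendsto
    (tendsto_comap (f := fun μ : ProbabilityMeasure X =>
      μ.map hf.continuous.measurable.aemeasurable)
      (x := 𝓝 (μ.map hf.continuous.measurable.aemeasurable))) hG'
  simpa [ProbabilityMeasure.toMeasure_map, Measure.map_apply hf.continuous.measurable
    hG'.measurableSet] using h

/-- `ℝ^d` embeds into the closed unit ball, so `ℝ^d × [0,T]` embeds into a compact metric space. -/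
def ballEmbedding (d : ℕ) (T : ℝ) (p : E d × I T) : Metric.closedBall (0 : E d) 1 × I T :=
  (⟨(Homeomorph.unitBall p.1 : E d), Metric.ball_subset_closedBall (Homeomorph.unitBall p.1).2⟩,
    p.2)

lemma isInducing_ballEmbedding (d : ℕ) (T : ℝ) : Topology.IsInducing (ballEmbedding d T) := by
  have h1 : Topology.IsInducing fun y : E d =>
      (⟨(Homeomorph.unitBall y : E d), Metric.ball_subset_closedBall (Homeomorph.unitBall y).2⟩ :
        Metric.closedBall (0 : E d) 1) := by
    have h2 : Topology.IsInducing fun y : E d => ((Homeomorph.unitBall y : E d)) :=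
      Topology.IsInducing.subtypeVal.comp Homeomorph.unitBall.isInducing
    exact Topology.IsInducing.of_comp
      (by
        refine Continuous.subtype_mk ?_ _
        exact continuous_subtype_val.comp Homeomorph.unitBall.continuous)
      continuous_subtype_val h2
  exact h1.prodMap Topology.IsInducing.id

/-- Probability measures on a compact metric space form a compact metrizable, hence second
countable space; the embedding `ballEmbedding` reduces the claim to that case. -/
instance secondCountableTopology_probabilityMeasure (d : ℕ) (T : ℝ) :
    SecondCountableTopology (ProbabilityMeasure (E d × I T)) := by
  have : CompactSpace (Metric.closedBall (0 : E d) 1) :=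
    isCompact_iff_compactSpace.mp (isCompact_closedBall 0 1)
  let : MetricSpace (ProbabilityMeasure (Metric.closedBall (0 : E d) 1 × I T)) :=
    TopologicalSpace.metrizableSpaceMetric _
  exact (isInducing_probabilityMeasure_map
    (isInducing_ballEmbedding d T)).secondCountableTopology

/-- When the weak topology is second countable, its Borel `σ`-algebra is the one generated by the
evaluations `μ ↦ μ A`. -/
lemma borelSpace_probabilityMeasure {X : Type*} [TopologicalSpace X] [MeasurableSpace X]
    [BorelSpace X] [HasOuterApproxClosed X]
    [SecondCountableTopology (ProbabilityMeasure X)] : BorelSpace (ProbabilityMeasure X) := by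
  refine ⟨le_antisymm ?_ ?_⟩
  · have h : @Measurable _ _ (borel (ProbabilityMeasure X)) _
        (fun μ : ProbabilityMeasure X => (μ : Measure X)) := by
      let : MeasurableSpace (ProbabilityMeasure X) := borel _
      have : BorelSpace (ProbabilityMeasure X) := ⟨rfl⟩
      refine Measurable.measure_of_isPiSystem_of_isProbabilityMeasure
        (BorelSpace.measurable_eq.trans borel_eq_generateFrom_isClosed) isPiSystem_isClosed
        fun F hF => ?_
      refine measurable_of_tendsto_metrizable (f := fun n (μ : ProbabilityMeasure X) =>
        ∫⁻ x, (IsClosed.apprSeq hF n x : ℝ≥0∞) ∂(μ : Measure X)) (fun n => ?_) ?_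
      · exact (ProbabilityMeasure.continuous_lintegral_boundedContinuousFunction
          (hF.apprSeq n)).measurable
      · rw [tendsto_pi_nhds]
        exact fun μ => HasOuterApproxClosed.tendsto_lintegral_apprSeq hF μ
    exact h.comap_le
  · let F : (BoundedContinuousFunction X ℝ≥0) → ProbabilityMeasure X → ℝ≥0∞ :=
      fun f μ => ∫⁻ x, f x ∂(μ : Measure X)
    have htop : (inferInstance : TopologicalSpace (ProbabilityMeasure X)) =
        ⨅ f, TopologicalSpace.induced (F f) inferInstance := by
      refine TopologicalSpace.ext_nhds fun μ => ?_
      have hinf : @nhds _ (⨅ f, TopologicalSpace.induced (F f) inferInstance) μ =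
          ⨅ f, comap (F f) (𝓝 (F f μ)) := by
        rw [nhds_iInf]
        simp_rw [nhds_induced]
      rw [hinf]
      refine le_antisymm ?_ ?_
      · refine le_iInf fun f => ?_
        exact (ProbabilityMeasure.continuous_lintegral_boundedContinuousFunction
          f).continuousAt.tendsto.le_comap
      · refine ProbabilityMeasure.tendsto_iff_forall_lintegral_tendsto (μs := id).mpr fun f => ?_
        exact tendsto_comap.mono_left (iInf_le _ f)
    rw [← generateFrom_iUnion_isOpen] at htop
    rw [borel_eq_generateFrom_of_subbasis htop]
    refine MeasurableSpace.generateFrom_le fun s hs => ?_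
    obtain ⟨f, hs⟩ := mem_iUnion.mp hs
    obtain ⟨U, hU, rfl⟩ := isOpen_induced_iff.mp hs
    exact ((Measure.measurable_lintegral (by fun_prop)).comp measurable_subtype_coe)
      hU.measurableSet

instance (d : ℕ) (T : ℝ) : BorelSpace (ProbabilityMeasure (E d × I T)) :=
  borelSpace_probabilityMeasure

instance (T : ℝ) (d₁ d₂ : ℕ) : TopologicalSpace.MetrizableSpace (PairSpace T d₁ d₂) :=
  inferInstanceAs (TopologicalSpace.MetrizableSpace
    (ProbabilityMeasure (E d₂ × I T) × C(I T, E d₁)))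

instance (T : ℝ) (d₁ d₂ : ℕ) : SecondCountableTopology (PairSpace T d₁ d₂) :=
  inferInstanceAs (SecondCountableTopology (ProbabilityMeasure (E d₂ × I T) × C(I T, E d₁)))

/-- A map into a space of continuous functions on a compact space is measurable as soon as its
evaluations are. -/
lemma measurable_continuousMap_of_eval {α K F : Type*} [MeasurableSpace α] [TopologicalSpace K]
    [CompactSpace K] [TopologicalSpace.SeparableSpace K] [NormedAddCommGroup F]
    [MeasurableSpace F] [BorelSpace F] [SecondCountableTopology F]
    [SecondCountableTopology C(K, F)] [MeasurableSpace C(K, F)] [BorelSpace C(K, F)]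
    {G : α → C(K, F)} (hG : ∀ k, Measurable fun a => G a k) : Measurable G := by
  have hball : ∀ (f : C(K, F)) (r : ℝ), 0 ≤ r → MeasurableSet (G ⁻¹' Metric.closedBall f r) := by
    intro f r hr
    obtain ⟨D, hDc, hD⟩ := TopologicalSpace.exists_countable_dense K
    have heq : G ⁻¹' Metric.closedBall f r = ⋂ k ∈ D, {a | dist (G a k) (f k) ≤ r} := by
      ext a
      simp only [mem_preimage, Metric.mem_closedBall, ContinuousMap.dist_le hr, mem_iInter,
        mem_ofPred_eq]
      refine ⟨fun h k _ => h k, fun h k => ?_⟩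
      have hcl : IsClosed {k | dist (G a k) (f k) ≤ r} :=
        isClosed_le (by fun_prop) continuous_const
      exact hcl.closure_subset_iff.mpr (fun k hk => h k hk) (hD k)
    rw [heq]
    exact MeasurableSet.biInter hDc fun k _ =>
      measurableSet_le ((hG k).dist measurable_const) measurable_const
  refine measurable_of_isOpen fun U hU => ?_
  have hr : ∀ f : U, ∃ r, 0 < r ∧ Metric.closedBall (f : C(K, F)) r ⊆ U := fun f =>
    Metric.nhds_basis_closedBall.mem_iff.mp (hU.mem_nhds f.2)
  choose r hr0 hr using hr
  obtain ⟨S, hSc, hS⟩ := TopologicalSpace.isOpen_iUnion_countable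
    (fun f : U => Metric.ball (f : C(K, F)) (r f)) fun f => Metric.isOpen_ball
  have hU' : U = ⋃ f ∈ S, Metric.closedBall (f : C(K, F)) (r f) := by
    refine Subset.antisymm (fun f hf => ?_) (iUnion₂_subset fun f _ => hr f)
    have h1 : f ∈ ⋃ f : U, Metric.ball (f : C(K, F)) (r f) :=
      mem_iUnion.mpr ⟨⟨f, hf⟩, Metric.mem_ball_self (hr0 _)⟩
    rw [← hS] at h1
    obtain ⟨f', hf', h2⟩ := mem_iUnion₂.mp h1
    exact mem_iUnion₂.mpr ⟨f', hf', Metric.ball_subset_closedBall h2⟩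
  rw [hU', preimage_iUnion₂]
  exact MeasurableSet.biUnion hSc fun f _ => hball f _ (hr0 f).le

/-- A map into the space of pairs is measurable as soon as its first component is a measurable
family of measures and the values of its second component are measurable. -/
lemma measurable_pairSpace {α : Type*} [MeasurableSpace α] {T : ℝ} {d₁ d₂ : ℕ}
    {f : α → PairSpace T d₁ d₂} (h1 : Measurable fun a => (f a).ctrl)
    (h2 : ∀ s, Measurable fun a => (f a).traj s) : Measurable f := by
  let : MeasurableSpace C(I T, E d₁) := borel _
  have : BorelSpace C(I T, E d₁) := ⟨rfl⟩
  have hb : instMeasurableSpacePairSpace T d₁ d₂ =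
      (inferInstance : MeasurableSpace (ProbabilityMeasure (E d₂ × I T) × C(I T, E d₁))) :=
    (BorelSpace.measurable_eq (α := ProbabilityMeasure (E d₂ × I T) × C(I T, E d₁))).symm
  have h3 : Measurable fun a => ((f a).1, (f a).2) :=
    Measurable.prodMk (Measurable.subtype_mk h1) (measurable_continuousMap_of_eval h2)
  rw [measurable_iff_comap_le] at h3 ⊢
  rw [hb]
  exact h3

lemma continuous_fst_pairSpace {T : ℝ} {d₁ d₂ : ℕ} :
    Continuous fun z : PairSpace T d₁ d₂ => (z.1 : ProbabilityMeasure (E d₂ × I T)) :=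
  continuous_fst (X := ProbabilityMeasure (E d₂ × I T)) (Y := C(I T, E d₁))

lemma PairSpace.continuous_traj {T : ℝ} {d₁ d₂ : ℕ} :
    Continuous (PairSpace.traj : PairSpace T d₁ d₂ → C(I T, E d₁)) :=
  continuous_snd (X := ProbabilityMeasure (E d₂ × I T)) (Y := C(I T, E d₁))

lemma PairSpace.measurable_ctrl {T : ℝ} {d₁ d₂ : ℕ} :
    Measurable (PairSpace.ctrl : PairSpace T d₁ d₂ → Measure (E d₂ × I T)) :=
  measurable_subtype_coe.comp continuous_fst_pairSpace.measurable

instance {T : ℝ} {d₁ d₂ : ℕ} (z : PairSpace T d₁ d₂) : IsProbabilityMeasure z.ctrl :=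
  inferInstanceAs (IsProbabilityMeasure (ProbabilityMeasure.toMeasure z.1))

lemma PairSpace.continuous_eval {T : ℝ} {d₁ d₂ : ℕ} :
    Continuous fun q : PairSpace T d₁ d₂ × I T => q.1.traj q.2 :=
  (PairSpace.continuous_traj.comp continuous_fst).eval continuous_snd

lemma PairSpace.continuous_integral_ctrl {T : ℝ} {d₁ d₂ : ℕ}
    (f : BoundedContinuousFunction (E d₂ × I T) ℝ) :
    Continuous fun z : PairSpace T d₁ d₂ => ∫ p, f p ∂z.ctrl :=
  (ProbabilityMeasure.continuous_integral_boundedContinuousFunction f).comp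
    continuous_fst_pairSpace

/-! ### Step sizes, cells and profiles -/

namespace StepSizes

variable {T : ℝ} (S : StepSizes T)

lemma t_succ (n : ℕ) : S.t (n + 1) = S.t n + S.ε n := by
  simp [t, time, Finset.sum_range_succ]

lemma t_mono : Monotone S.t := monotone_nat_of_le_succ fun n => by
  rw [t_succ]; linarith [S.pos n]

lemma t_le_t_iff {a b : ℕ} : S.t a ≤ S.t b ↔ a ≤ b := by
  have h : StrictMono S.t := strictMono_nat_of_lt_succ fun n => by
    rw [t_succ]; linarith [S.pos n]
  exact h.le_iff_le

lemma beta_ne_zero (n : ℕ) : S.β n ≠ 0 := (S.beta_pos n).ne'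

lemma beta_cast_pos (n : ℕ) : (0 : ℝ) < S.β n := Nat.cast_pos.mpr (S.beta_pos n)

lemma sum_eps_eq (n m : ℕ) : ∑ k ∈ Finset.range m, S.ε (n + k) = S.τ n m := by
  induction m with
  | zero => simp [S.τ_zero]
  | succ m ih => rw [Finset.sum_range_succ, ih, S.τ_succ]

lemma hval_pos (n k : ℕ) : 0 < S.hval n k := mul_pos (S.beta_cast_pos n) (S.pos _)

lemma lt_tau_beta_succ (n : ℕ) : T < S.τ n (S.β n + 1) := by
  by_contra hcon
  have hbdd : BddAbove {k | time S.ε k ≤ time S.ε n + T} := by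
    obtain ⟨N, hN⟩ := (S.tendsto_time.eventually_gt_atTop (time S.ε n + T)).exists_forall_of_atTop
    refine ⟨N, fun k hk => ?_⟩
    by_contra hlt
    exact absurd (hN k (by omega)) (not_lt.mpr hk)
  have h1 : n + (S.β n + 1) ∈ {k | time S.ε k ≤ time S.ε n + T} := by
    have h2 := not_lt.mp hcon
    unfold τ t at h2
    simp only [mem_ofPred_eq]
    linarith
  have h3 : n + (S.β n + 1) ≤ maxStep S.ε (time S.ε n + T) := le_csSup hbdd h1
  have hpos : 0 < beta S.ε T n := S.beta_pos n
  unfold β at h3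
  unfold beta at h3 hpos
  omega

lemma lt_add_beta {n i : ℕ} (hi : S.t (i + 1) ≤ S.t n + T) : i < n + S.β n := by
  by_contra hcon
  have h1 := S.lt_tau_beta_succ n
  have h2 : S.t (n + (S.β n + 1)) ≤ S.t (i + 1) := S.t_mono (by omega)
  unfold τ at h1
  linarith

lemma t_add_beta_le (n : ℕ) : S.t (n + S.β n) ≤ S.t n + T := by
  have h := S.τ_β_le n
  unfold τ at h
  linarith

lemma exists_step_at {u : ℝ} (m : ℕ) (hu : S.t m ≤ u) :
    ∃ n, m ≤ n ∧ S.t n ≤ u ∧ u < S.t (n + 1) := by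
  classical
  have hex : ∃ n, u < S.t (n + 1) := by
    obtain ⟨N, hN⟩ := (S.tendsto_time.eventually_gt_atTop u).exists_forall_of_atTop
    exact ⟨N, hN (N + 1) (by omega)⟩
  refine ⟨Nat.find hex, ?_, ?_, Nat.find_spec hex⟩
  · have h1 : S.t m < S.t (Nat.find hex + 1) := hu.trans_lt (Nat.find_spec hex)
    have h2 := lt_of_not_ge fun h => h1.not_ge (S.t_mono h)
    omega
  · rcases Nat.eq_zero_or_pos (Nat.find hex) with h0 | h0
    · rw [h0]; exact (S.t_mono (Nat.zero_le m)).trans hu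
    · have h1 := Nat.find_min hex (Nat.sub_lt h0 one_pos)
      rw [Nat.sub_add_cancel (show 1 ≤ Nat.find hex from h0)] at h1
      exact not_lt.mp h1

/-- A point before the last breakpoint of a window lies in one of its cells. -/
lemma exists_mem_cell {n : ℕ} {u : ℝ} (h0 : 0 ≤ u) (hu : u < S.τ n (S.β n)) :
    ∃ k, k < S.β n ∧ u ∈ Ico (S.τ n k) (S.τ n (k + 1)) := by
  obtain ⟨m, hm, h1, h2⟩ := S.exists_step_at (u := S.t n + u) n (by linarith)
  obtain ⟨k, rfl⟩ := Nat.exists_eq_add_of_le hm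
  refine ⟨k, ?_, ?_, ?_⟩
  · by_contra hk
    have := S.τ_mono n (not_lt.mp hk)
    unfold τ at this hu
    linarith
  · unfold τ; linarith
  · unfold τ; rw [← add_assoc]; linarith

lemma disjoint_cell {n j k : ℕ} (hjk : j ≠ k) : Disjoint (S.cell n j) (S.cell n k) := by
  rw [Set.disjoint_left]
  intro s hj hk
  rcases lt_or_gt_of_ne hjk with h | h
  · have := S.τ_mono n (Nat.succ_le_of_lt h)
    exact absurd hk.1 (not_le.mpr (hj.2.trans_le this))
  · have := S.τ_mono n (Nat.succ_le_of_lt h)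
    exact absurd hj.1 (not_le.mpr (hk.2.trans_le this))

/-- If all steps `ε_i`, `a ≤ i < b`, are at most `m` and belong to the window of `n`, then the
window has at least `(t_b - t_a) / m` steps. -/
lemma sub_le_beta_mul {n a b : ℕ} {m : ℝ} (hm : 0 ≤ m) (hab : a ≤ b) (hna : n ≤ a)
    (hb : b ≤ n + S.β n) (h : ∀ i, a ≤ i → i < b → S.ε i ≤ m) :
    S.t b - S.t a ≤ S.β n * m := by
  have h1 : ∀ j, (∀ i, a ≤ i → i < a + j → S.ε i ≤ m) → S.t (a + j) - S.t a ≤ j * m := by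
    intro j
    induction j with
    | zero => simp
    | succ j ih =>
      intro hj
      rw [← add_assoc, t_succ]
      have := ih fun i h1 h2 => hj i h1 (by omega)
      have := hj (a + j) (by omega) (by omega)
      push_cast
      linarith
  obtain ⟨j, rfl⟩ := Nat.exists_eq_add_of_le hab
  refine (h1 j h).trans (mul_le_mul_of_nonneg_right ?_ hm)
  exact_mod_cast (by omega : j ≤ S.β n)

lemma eventually_small {δ : ℝ} (hδ : 0 < δ) : ∃ N, ∀ i, N ≤ i → S.ε i < δ :=
  (S.tendsto_zero.eventually (gt_mem_nhds hδ)).exists_forall_of_atTop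

/-- The last breakpoint of a late window is close to `T`. -/
lemma lt_tau_beta {δ : ℝ} {n : ℕ} (h : ∀ i, n ≤ i → S.ε i < δ) : T - δ < S.τ n (S.β n) := by
  have h1 := S.lt_tau_beta_succ n
  rw [τ_succ] at h1
  linarith [h (n + S.β n) (by omega)]

lemma τ_sub {n i : ℕ} (h : n ≤ i) : S.τ n (i - n) = S.t i - S.t n := by
  unfold τ; rw [Nat.add_sub_cancel' h]

lemma hval_sub {n i : ℕ} (h : n ≤ i) : S.hval n (i - n) = S.β n * S.ε i := by
  unfold hval; rw [Nat.add_sub_cancel' h]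

lemma ProfileTendsto.exists_forall {S : StepSizes T} {h : I T → ℝ} (hh : S.ProfileTendsto h)
    {δ : ℝ} (hδ : 0 < δ) :
    ∃ N, ∀ n, N ≤ n → ∀ k, k < S.β n → ∀ s ∈ S.cell n k, |S.hval n k - h s| < δ :=
  (hh δ hδ).exists_forall_of_atTop

/-- The profiles are eventually bounded on the first three quarters of `[0,T]`, since there they
stay close to one fixed profile. -/
lemma exists_bound_early (hT : 0 < T) {h : I T → ℝ} (hh : S.ProfileTendsto h) :
    ∃ N, ∃ M : ℝ, 0 < M ∧ ∀ n, N ≤ n → ∀ i, n ≤ i → i < n + S.β n →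
      S.t i - S.t n ≤ 3 * T / 4 → S.β n * S.ε i ≤ M := by
  obtain ⟨N₁, hN₁⟩ := hh.exists_forall one_pos
  obtain ⟨N₂, hN₂⟩ := S.eventually_small (δ := T / 16) (by linarith)
  set N := max N₁ N₂ with hN
  have hτ := S.lt_tau_beta (n := N) fun i hi => hN₂ i (by omega)
  refine ⟨N, ∑ k ∈ Finset.range (S.β N), S.hval N k + 2, ?_, fun n hn i hni hi ht => ?_⟩
  · have := Finset.sum_nonneg fun k (_ : k ∈ Finset.range (S.β N)) => (S.hval_pos N k).le
    linarith
  · have h0 : 0 ≤ S.t i - S.t n := sub_nonneg.mpr (S.t_mono hni)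
    obtain ⟨k, hk, hmem⟩ := S.exists_mem_cell (n := N) h0 (by linarith)
    let s : I T := ⟨S.t i - S.t n, h0, by linarith⟩
    have h1 := hN₁ N (by omega) k hk s hmem
    have h2 := hN₁ n (by omega) (i - n) (by omega) s (by
      refine ⟨(S.τ_sub hni).le, ?_⟩
      rw [τ_succ, S.τ_sub hni]
      exact lt_add_of_pos_right _ (S.pos _))
    rw [S.hval_sub hni] at h2
    have h3 := Finset.single_le_sum (f := fun k => S.hval N k)
      (fun k _ => (S.hval_pos N k).le) (Finset.mem_range.mpr hk)
    have h4 := abs_lt.mp h1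
    have h5 := abs_lt.mp h2
    linarith

/-- The profiles are eventually uniformly bounded. -/
lemma exists_bound_eventually (hT : 0 < T) {h : I T → ℝ} (hh : S.ProfileTendsto h) :
    ∃ N, ∃ M : ℝ, 0 < M ∧ ∀ n, N ≤ n → ∀ i, n ≤ i → i < n + S.β n → S.β n * S.ε i ≤ M := by
  obtain ⟨N₁, M, hM, hN₁⟩ := S.exists_bound_early hT hh
  obtain ⟨N₂, hN₂⟩ := S.eventually_small (δ := T / 16) (by linarith)
  refine ⟨max N₁ N₂, max M (8 * M / T * M), lt_max_of_lt_left hM, fun n hn i hni hi => ?_⟩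
  by_cases ht : S.t i - S.t n ≤ 3 * T / 4
  · exact (hN₁ n (by omega) i hni hi ht).trans (le_max_left _ _)
  refine le_trans ?_ (le_max_right _ _)
  -- the window is shifted by a time between `T / 4` and `T / 2`
  obtain ⟨a, hna, ha1, ha2⟩ := S.exists_step_at (u := S.t n + T / 2) n (by linarith)
  obtain ⟨b, hab, hb1, hb2⟩ := S.exists_step_at (u := S.t n + 3 * T / 4) a (by linarith)
  rw [t_succ] at ha2 hb2
  have hεa := hN₂ a (by omega)
  have hεb := hN₂ b (by omega)
  have hβn := S.beta_cast_pos n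
  have hβa := S.beta_cast_pos a
  have hb : b < n + S.β n := S.lt_add_beta (by rw [t_succ]; linarith)
  have hb' : b < a + S.β a := S.lt_add_beta (by rw [t_succ]; linarith)
  have h1 := S.sub_le_beta_mul (n := a) (m := M / S.β n) (by positivity) hab le_rfl hb'.le
    fun i hi1 hi2 => by
      rw [le_div_iff₀ hβn, mul_comm]
      refine hN₁ n (by omega) i (by omega) (by omega) ?_
      have := S.t_mono hi2.le
      linarith
  have h2 : T / 8 ≤ S.β a * (M / S.β n) := by linarith
  have h3 : (S.β n : ℝ) ≤ 8 * M / T * S.β a := by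
    rw [← mul_div_assoc, le_div_iff₀ hβn] at h2
    rw [div_mul_eq_mul_div, le_div_iff₀ hT]
    linarith
  have hai : a ≤ i := S.t_le_t_iff.mp (by linarith)
  have hti : S.t i ≤ S.t n + T := (S.t_mono hi.le).trans (S.t_add_beta_le n)
  have hti1 : S.t (i + 1) ≤ S.t n + T := (S.t_mono (by omega)).trans (S.t_add_beta_le n)
  have h4 := hN₁ a (by omega) i hai (S.lt_add_beta (by linarith)) (by linarith)
  calc S.β n * S.ε i ≤ 8 * M / T * S.β a * S.ε i :=
        mul_le_mul_of_nonneg_right h3 (S.pos i).le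
    _ = 8 * M / T * (S.β a * S.ε i) := by ring
    _ ≤ 8 * M / T * M := mul_le_mul_of_nonneg_left h4 (by positivity)

/-- Late windows that overlap in at least a quarter of their length have comparable numbers of
steps, because each step of either is `O(1/β)` and fits into both. -/
lemma beta_le_of_near {N : ℕ} {M : ℝ} (hM : 0 < M) (hT : 0 < T)
    (hN : ∀ n, N ≤ n → ∀ i, n ≤ i → i < n + S.β n → S.β n * S.ε i ≤ M)
    (hε : ∀ i, N ≤ i → S.ε i < T / 16) {n m : ℕ} (hn : N ≤ n) (hnm : n ≤ m)
    (ht : S.t m - S.t n ≤ 5 * T / 8) :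
    (S.β n : ℝ) ≤ 4 * M / T * S.β m ∧ (S.β m : ℝ) ≤ 4 * M / T * S.β n := by
  have hβn := S.beta_cast_pos n
  have hβm := S.beta_cast_pos m
  have h0 := S.lt_tau_beta (n := n) fun i hi => hε i (by omega)
  unfold τ at h0
  have hm : m ≤ n + S.β n := S.t_le_t_iff.mp (by linarith)
  have hb : n + S.β n ≤ m + S.β m := by
    have h2 : n + S.β n - 1 < m + S.β m := S.lt_add_beta (by
      have h3 := S.beta_pos n
      change 0 < S.β n at h3
      rw [Nat.sub_add_cancel (by omega)]
      linarith [S.t_add_beta_le n, S.t_mono hnm])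
    omega
  have key : ∀ a b : ℕ, (0 : ℝ) < S.β b → T / 4 ≤ S.β a * (M / S.β b) →
      (S.β b : ℝ) ≤ 4 * M / T * S.β a := by
    intro a b hb h2
    rw [← mul_div_assoc, le_div_iff₀ hb] at h2
    rw [div_mul_eq_mul_div, le_div_iff₀ hT]
    linarith
  constructor
  · refine key m n hβn ?_
    have h1 := S.sub_le_beta_mul (n := m) (m := M / S.β n) (by positivity) hm le_rfl hb
      fun i hi1 hi2 => by
        rw [le_div_iff₀ hβn, mul_comm]
        exact hN n hn i (by omega) hi2
    linarith
  · refine key n m hβm ?_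
    have h1 := S.sub_le_beta_mul (n := n) (m := M / S.β m) (by positivity) hm hnm le_rfl
      fun i hi1 hi2 => by
        rw [le_div_iff₀ hβm, mul_comm]
        exact hN m (by omega) i hi1 (by omega)
    linarith

/-- Two applications of `beta_le_of_near`, with an intermediate window half way. -/
lemma beta_le_of_le {N : ℕ} {M : ℝ} (hM : 0 < M) (hT : 0 < T)
    (hN : ∀ n, N ≤ n → ∀ i, n ≤ i → i < n + S.β n → S.β n * S.ε i ≤ M)
    (hε : ∀ i, N ≤ i → S.ε i < T / 16) {n m : ℕ} (hn : N ≤ n) (hnm : n ≤ m)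
    (ht : S.t m - S.t n ≤ T) :
    (S.β n : ℝ) ≤ (4 * M / T) ^ 2 * S.β m ∧ (S.β m : ℝ) ≤ (4 * M / T) ^ 2 * S.β n := by
  have hC : 0 < 4 * M / T := by positivity
  obtain ⟨a, hna, ha1, ha2⟩ := S.exists_step_at (u := (S.t n + S.t m) / 2) n
    (by linarith [S.t_mono hnm])
  rw [t_succ] at ha2
  have ham : a ≤ m := S.t_le_t_iff.mp (by linarith [S.t_mono hnm])
  have hεa := hε a (by omega)
  obtain ⟨h1, h2⟩ := S.beta_le_of_near hM hT hN hε hn hna (by linarith)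
  obtain ⟨h3, h4⟩ := S.beta_le_of_near hM hT hN hε (by omega) ham (by linarith)
  constructor
  · calc (S.β n : ℝ) ≤ 4 * M / T * S.β a := h1
      _ ≤ 4 * M / T * (4 * M / T * S.β m) := mul_le_mul_of_nonneg_left h3 hC.le
      _ = _ := by ring
  · calc (S.β m : ℝ) ≤ 4 * M / T * S.β a := h4
      _ ≤ 4 * M / T * (4 * M / T * S.β n) := mul_le_mul_of_nonneg_left h2 hC.le
      _ = _ := by ring

/-- The profiles are eventually bounded away from zero. A small value on one cell forces the limit
profile to be small on a whole interval, hence later windows to have only short steps there; as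
the window moves on, that interval sweeps over all steps, which then are too short to fill a
window. -/
lemma exists_lower_bound_eventually (hT : 0 < T) {h : I T → ℝ} (hh : S.ProfileTendsto h) :
    ∃ N, ∃ c : ℝ, 0 < c ∧ ∀ n, N ≤ n → ∀ k, k < S.β n → c ≤ S.hval n k := by
  obtain ⟨N₁, M, hM, hN₁⟩ := S.exists_bound_eventually hT hh
  obtain ⟨N₂, hN₂⟩ := S.eventually_small (δ := T / 16) (by linarith)
  set C := (4 * M / T) ^ 2 with hC
  have hC0 : 0 < C := by positivity
  set δ := T / (4 * C) with hδ
  have hδ0 : 0 < δ := by positivity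
  obtain ⟨N₃, hN₃⟩ := hh.exists_forall hδ0
  refine ⟨N₃, δ, hδ0, fun n₀ hn₀ k₀ hk₀ => ?_⟩
  by_contra hcon
  rw [not_le] at hcon
  set a := S.τ n₀ k₀ with ha
  set b := S.τ n₀ (k₀ + 1) with hb
  have hab : a < b := by rw [ha, hb, τ_succ]; linarith [S.pos (n₀ + k₀)]
  have ha0 : 0 ≤ a := S.τ_nonneg _ _
  have hbT : b ≤ T := (S.τ_mono n₀ (Nat.succ_le_of_lt hk₀)).trans (S.τ_β_le n₀)
  obtain ⟨N₄, hN₄⟩ := S.eventually_small (δ := (b - a) / 2) (by linarith)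
  set N := max (max N₁ N₂) (max N₃ N₄) with hNdef
  obtain ⟨m, hm, hm1, hm2⟩ := S.exists_step_at (u := S.t N + T + T) N (by linarith)
  rw [t_succ] at hm2
  have hεm := hN₂ m (by omega)
  have hβm := S.beta_cast_pos m
  have hτ := S.lt_tau_beta (n := m) fun i hi => hN₂ i (by omega)
  have h1 := S.sub_le_beta_mul (n := m) (a := m) (b := m + S.β m) (m := 3 * δ * C / S.β m)
    (by positivity) (by omega) le_rfl le_rfl fun i hi1 hi2 => by
      have hti := S.t_mono hi1
      have hti2 : S.t i ≤ S.t m + T := (S.t_mono hi2.le).trans (S.t_add_beta_le m)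
      have hεi := hN₄ i (by omega)
      obtain ⟨r, hNr, hr1, hr2⟩ := S.exists_step_at (u := S.t i - a) N (by linarith)
      rw [t_succ] at hr2
      have hεr := hN₄ r (by omega)
      have hri : r ≤ i := S.t_le_t_iff.mp (by linarith)
      have hir : i < r + S.β r := S.lt_add_beta (by rw [t_succ]; linarith)
      let s : I T := ⟨S.t i - S.t r, by linarith, by linarith⟩
      have h2 := hN₃ n₀ hn₀ k₀ hk₀ s (by
        change S.t i - S.t r ∈ Ico a b
        constructor <;> linarith)
      have h3 := hN₃ r (by omega) (i - r) (by omega) s (by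
        refine ⟨(S.τ_sub hri).le, ?_⟩
        rw [τ_succ, S.τ_sub hri]
        exact lt_add_of_pos_right _ (S.pos _))
      rw [S.hval_sub hri] at h3
      have h4 := abs_lt.mp h2
      have h5 := abs_lt.mp h3
      have h6 : S.β r * S.ε i ≤ 3 * δ := by linarith
      have h7 : (S.β m : ℝ) ≤ C * S.β r := by
        rcases le_total r m with h | h
        · exact (S.beta_le_of_le hM hT (fun n hn => hN₁ n (le_trans (by omega) hn))
            (fun i hi => hN₂ i (le_trans (by omega) hi)) hNr h (by linarith)).2
        · exact (S.beta_le_of_le hM hT (fun n hn => hN₁ n (le_trans (by omega) hn))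
            (fun i hi => hN₂ i (le_trans (by omega) hi)) hm h (by linarith)).1
      rw [le_div_iff₀ hβm]
      calc S.ε i * S.β m ≤ S.ε i * (C * S.β r) := mul_le_mul_of_nonneg_left h7 (S.pos i).le
        _ = C * (S.β r * S.ε i) := by ring
        _ ≤ C * (3 * δ) := mul_le_mul_of_nonneg_left h6 hC0.le
        _ = 3 * δ * C := by ring
  rw [mul_div_cancel₀ _ hβm.ne'] at h1
  have h2 : δ * C = T / 4 := by rw [hδ]; field_simp
  unfold τ at hτ
  linarith

/-- All profiles take values in one compact interval of `(0,∞)`. -/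
lemma exists_bounds (hT : 0 < T) {h : I T → ℝ} (hh : S.ProfileTendsto h) :
    ∃ c M : ℝ, 0 < c ∧ c ≤ M ∧ ∀ n k, k < S.β n → c ≤ S.hval n k ∧ S.hval n k ≤ M := by
  obtain ⟨N₁, M, hM, hN₁⟩ := S.exists_bound_eventually hT hh
  obtain ⟨N₂, c, hc, hN₂⟩ := S.exists_lower_bound_eventually hT hh
  have hfin : (⋃ n ∈ Iio (max N₁ N₂), ⋃ k ∈ Iio (S.β n),
      {S.hval n k + 1 / S.hval n k}).Finite :=
    (finite_Iio _).biUnion fun n _ => (finite_Iio _).biUnion fun k _ => finite_singleton _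
  obtain ⟨D, hD⟩ := hfin.bddAbove
  have hDle : ∀ n < max N₁ N₂, ∀ k < S.β n, S.hval n k + 1 / S.hval n k ≤ D := fun n hn k hk =>
    hD (mem_biUnion (x := n) hn (mem_biUnion (x := k) hk rfl))
  have key : ∀ n k, k < S.β n →
      min c (1 / max D 1) ≤ S.hval n k ∧ S.hval n k ≤ max M D := by
    intro n k hk
    have hp := S.hval_pos n k
    have hp' : 0 < 1 / S.hval n k := by positivity
    rcases lt_or_ge n (max N₁ N₂) with hn | hn
    · have h1 := hDle n hn k hk
      refine ⟨min_le_of_right_le ?_, le_max_of_le_right (by linarith)⟩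
      rw [one_div_le (by positivity) hp]
      exact le_max_of_le_left (by linarith)
    · refine ⟨min_le_of_left_le (hN₂ n (by omega) k hk), le_max_of_le_left ?_⟩
      have := hN₁ n (by omega) (n + k) (by omega) (by omega)
      exact this
  refine ⟨min c (1 / max D 1), max M D, lt_min hc (by positivity), ?_, key⟩
  have := key 0 0 (S.beta_pos 0)
  exact this.1.trans this.2

/-- The profile `h^n` as a function on `[0,T]`, zero after the last breakpoint. -/
def profile (n : ℕ) (s : I T) : ℝ :=
  ∑ k ∈ Finset.range (S.β n), (S.cell n k).indicator (fun _ => S.hval n k) s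

lemma sum_indicator_cell {F : Type*} [AddCommMonoid F] {n k : ℕ} (hk : k < S.β n) {s : I T}
    (hs : s ∈ S.cell n k) (f : ℕ → F) :
    ∑ j ∈ Finset.range (S.β n), (S.cell n j).indicator (fun _ => f j) s = f k := by
  rw [Finset.sum_eq_single k, indicator_of_mem hs]
  · intro j _ hj
    exact indicator_of_notMem (Set.disjoint_right.mp (S.disjoint_cell hj) hs) _
  · intro h; exact absurd (Finset.mem_range.mpr hk) h

/-- Every point of `[0,T)` lies in a cell of every late window. -/
lemma eventually_exists_mem_cell {s : I T} (hs : (s : ℝ) < T) :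
    ∀ᶠ n in atTop, ∃ k, k < S.β n ∧ s ∈ S.cell n k := by
  obtain ⟨N, hN⟩ := S.eventually_small (δ := T - s) (by linarith)
  filter_upwards [eventually_ge_atTop N] with n hn
  have := S.lt_tau_beta (n := n) fun i hi => hN i (by omega)
  exact S.exists_mem_cell s.2.1 (by linarith)

lemma tendsto_profile {h : I T → ℝ} (hh : S.ProfileTendsto h) {s : I T}
    (hs : ∀ᶠ n in atTop, ∃ k, k < S.β n ∧ s ∈ S.cell n k) :
    Tendsto (fun n => S.profile n s) atTop (𝓝 (h s)) := by
  rw [Metric.tendsto_nhds]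
  intro δ hδ
  filter_upwards [hh δ hδ, hs] with n hn ⟨k, hk, hmem⟩
  rw [Real.dist_eq, profile, S.sum_indicator_cell hk hmem]
  exact hn k hk s hmem

lemma coe_lt_of_mem_cell {n k : ℕ} (hk : k < S.β n) {s : I T} (hs : s ∈ S.cell n k) :
    (s : ℝ) < T :=
  hs.2.trans_le ((S.τ_mono n (Nat.succ_le_of_lt hk)).trans (S.τ_β_le n))

/-- The limit profile may be replaced by a measurable one with values in a compact interval of
`(0,∞)`: no cell contains `T`, so its value at `T` is immaterial, and elsewhere it is the pointwise
limit of the profiles. -/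
lemma exists_nice_profile {h : I T → ℝ} (hh : S.ProfileTendsto h) {c M : ℝ}
    (hcM : c ≤ M) (hb : ∀ n k, k < S.β n → c ≤ S.hval n k ∧ S.hval n k ≤ M) :
    ∃ h₀ : I T → ℝ, Measurable h₀ ∧ (∀ s, c ≤ h₀ s ∧ h₀ s ≤ M) ∧ S.ProfileTendsto h₀ ∧
      ∀ s : I T, (s : ℝ) < T → h₀ s = h s := by
  classical
  have hlim : ∀ s : I T, (s : ℝ) < T → Tendsto (fun n => S.profile n s) atTop (𝓝 (h s)) :=
    fun s hs => S.tendsto_profile hh (S.eventually_exists_mem_cell hs)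
  have hmeasT : MeasurableSet {s : I T | (s : ℝ) < T} :=
    measurableSet_lt measurable_subtype_coe measurable_const
  refine ⟨fun s => if (s : ℝ) < T then h s else c, ?_, fun s => ?_, ?_, fun s hs => if_pos hs⟩
  · refine measurable_of_tendsto_metrizable
      (f := fun n (s : I T) => if (s : ℝ) < T then S.profile n s else c) (fun n => ?_) ?_
    · refine Measurable.ite hmeasT ?_ measurable_const
      exact Finset.measurable_fun_sum _ fun k _ =>
        measurable_const.indicator (S.measurableSet_cell n k)
    · rw [tendsto_pi_nhds]
      intro s
      by_cases hs : (s : ℝ) < T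
      · simpa [hs] using hlim s hs
      · simp [hs]
  · by_cases hs : (s : ℝ) < T
    · simp only [hs, if_true]
      have hev : ∀ᶠ n in atTop, c ≤ S.profile n s ∧ S.profile n s ≤ M := by
        filter_upwards [S.eventually_exists_mem_cell hs] with n ⟨k, hk, hmem⟩
        rw [profile, S.sum_indicator_cell hk hmem]
        exact hb n k hk
      exact ⟨ge_of_tendsto (hlim s hs) (hev.mono fun n hn => hn.1),
        le_of_tendsto (hlim s hs) (hev.mono fun n hn => hn.2)⟩
    · simp [hs, hcM]
  · intro δ hδ
    filter_upwards [hh δ hδ] with n hn k hk s hs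
    rw [if_pos (S.coe_lt_of_mem_cell hk hs)]
    exact hn k hk s hs

end StepSizes

/-! ### Entropy bounds and the piecewise constant path -/

open InformationTheory in
lemma mul_le_klFun_add {r : ℝ} (hr : 0 ≤ r) (a : ℝ) : r * a ≤ klFun r + (Real.exp a - 1) := by
  rcases hr.eq_or_lt with rfl | hr
  · rw [klFun_zero]; linarith [Real.exp_pos a]
  · have h1 := Real.add_one_le_exp (a - Real.log r)
    rw [Real.exp_sub, Real.exp_log hr, le_div_iff₀ hr] at h1
    rw [klFun_apply]
    linarith

/-- A form of the Donsker–Varadhan inequality: Young's inequality for `r log r` and `exp`, integrated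
against `ρ`. -/
lemma lintegral_le_klDiv_add {α : Type*} [MeasurableSpace α] (μ ρ : Measure α)
    [IsFiniteMeasure μ] [IsFiniteMeasure ρ] {φ : α → ℝ} (hφ : Measurable φ) (h0 : ∀ a, 0 ≤ φ a) :
    ∫⁻ a, ENNReal.ofReal (φ a) ∂μ ≤
      InformationTheory.klDiv μ ρ + ∫⁻ a, ENNReal.ofReal (Real.exp (φ a) - 1) ∂ρ := by
  by_cases hac : μ ≪ ρ
  swap
  · simp [InformationTheory.klDiv_of_not_ac hac]
  rw [InformationTheory.klDiv_eq_lintegral_klFun_of_ac hac, ← lintegral_add_right _ (by fun_prop),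
    ← lintegral_rnDeriv_mul hac (by fun_prop)]
  refine lintegral_mono_ae ?_
  filter_upwards [Measure.rnDeriv_lt_top μ ρ] with a ha
  have h1 := mul_le_klFun_add (ENNReal.toReal_nonneg (a := μ.rnDeriv ρ a)) (φ a)
  rw [← ENNReal.ofReal_add (InformationTheory.klFun_nonneg ENNReal.toReal_nonneg)
    (by linarith [Real.add_one_le_exp (φ a), h0 a])]
  conv_lhs => rw [← ENNReal.ofReal_toReal ha.ne, ← ENNReal.ofReal_mul ENNReal.toReal_nonneg]
  exact ENNReal.ofReal_le_ofReal h1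

/-- Exponential moments of all linear functionals control those of the norm. -/
lemma exists_exp_norm_bound {α ι : Type*} [MeasurableSpace α] {d : ℕ} (μ : ι → Measure α)
    [∀ i, IsProbabilityMeasure (μ i)] (f : ι → α → E d) (hf : ∀ i, Measurable (f i))
    (h : ∀ v : E d, ∃ C : ℝ≥0, ∀ i, ∫⁻ a, ENNReal.ofReal (Real.exp (inner ℝ v (f i a))) ∂(μ i) ≤ C)
    (c : ℝ) (hc : 0 ≤ c) :
    ∃ C : ℝ≥0, ∀ i, ∫⁻ a, ENNReal.ofReal (Real.exp (c * ‖f i a‖)) ∂(μ i) ≤ C := by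
  choose C hC using h
  let e : Fin d → E d := fun j => EuclideanSpace.single j (c * d)
  have he : ∀ (j : Fin d) (v : E d), inner ℝ (e j) v = c * d * v j := fun j v => by
    simp [e, EuclideanSpace.inner_single_left]
  have hexp : ∀ v : E d, Real.exp (c * ‖v‖) ≤
      1 + ∑ j, (Real.exp (inner ℝ (e j) v) + Real.exp (inner ℝ (-e j) v)) := by
    intro v
    rcases Nat.eq_zero_or_pos d with rfl | hd
    · have : v = 0 := Subsingleton.elim _ _
      simp [this]
    · have : Nonempty (Fin d) := ⟨⟨0, hd⟩⟩
      obtain ⟨j, hj⟩ := Finite.exists_max fun j => |v j|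
      have h1 : ‖v‖ ≤ d * |v j| := by
        calc ‖v‖ = ‖∑ i, EuclideanSpace.single i (v i)‖ := by
              congr 1; ext k; simp [Finset.sum_apply, Pi.single_apply]
          _ ≤ ∑ i, ‖EuclideanSpace.single i (v i)‖ := norm_sum_le _ _
          _ = ∑ i, |v i| := by simp
          _ ≤ ∑ _i : Fin d, |v j| := Finset.sum_le_sum fun i _ => hj i
          _ = d * |v j| := by simp
      have h2 : Real.exp (c * ‖v‖) ≤ Real.exp (inner ℝ (e j) v) + Real.exp (inner ℝ (-e j) v) := by
        rw [inner_neg_left, he]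
        have h3 : c * ‖v‖ ≤ |c * d * v j| := by
          rw [abs_mul, abs_of_nonneg (by positivity : 0 ≤ c * (d : ℝ))]
          calc c * ‖v‖ ≤ c * (d * |v j|) := mul_le_mul_of_nonneg_left h1 hc
            _ = _ := by ring
        refine (Real.exp_le_exp.mpr h3).trans (Real.exp_abs_le _)
      refine h2.trans ?_
      have h4 := Finset.single_le_sum
        (f := fun j => Real.exp (inner ℝ (e j) v) + Real.exp (inner ℝ (-e j) v))
        (fun i _ => by positivity) (Finset.mem_univ j)
      linarith
  refine ⟨1 + ∑ j, (C (e j) + C (-e j)), fun i => ?_⟩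
  have hfi := hf i
  calc ∫⁻ a, ENNReal.ofReal (Real.exp (c * ‖f i a‖)) ∂(μ i)
      ≤ ∫⁻ a, (1 + ∑ j, (ENNReal.ofReal (Real.exp (inner ℝ (e j) (f i a))) +
          ENNReal.ofReal (Real.exp (inner ℝ (-e j) (f i a))))) ∂(μ i) := by
        refine lintegral_mono fun a => (ENNReal.ofReal_le_ofReal (hexp _)).trans ?_
        rw [ENNReal.ofReal_add zero_le_one (Finset.sum_nonneg fun _ _ => by positivity),
          ENNReal.ofReal_one, ENNReal.ofReal_sum_of_nonneg fun _ _ => by positivity]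
        gcongr
        exact ENNReal.ofReal_add_le
    _ = 1 + ∑ j, (∫⁻ a, ENNReal.ofReal (Real.exp (inner ℝ (e j) (f i a))) ∂(μ i) +
          ∫⁻ a, ENNReal.ofReal (Real.exp (inner ℝ (-e j) (f i a))) ∂(μ i)) := by
        rw [lintegral_add_left measurable_const, lintegral_const, measure_univ, mul_one,
          lintegral_finsetSum _ fun j _ => by fun_prop]
        congr 1
        exact Finset.sum_congr rfl fun j _ => lintegral_add_left (by fun_prop) _
    _ ≤ _ := by
        push_cast
        gcongr with j
        · exact hC _ i
        · exact hC _ i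

section Path

variable {d₁ d₂ : ℕ} {T : ℝ} (S : StepSizes T) (g : E d₁ → E d₂ → E d₁) (x : E d₁)

lemma measurable_path {Ω : Type*} {m : MeasurableSpace Ω} {g : E d₁ → E d₂ → E d₁}
    (hg : Measurable (Function.uncurry g)) (n : ℕ) {Y : ℕ → Ω → E d₂} {k : ℕ}
    (hY : ∀ j < k, Measurable (Y j)) :
    Measurable fun ω => path S g x n (fun j => Y j ω) k := by
  induction k with
  | zero => exact measurable_const
  | succ k ih =>
    have h1 := ih fun j hj => hY j (by omega)
    have h2 : Measurable fun ω => g (path S g x n (fun j => Y j ω) k) (Y k ω) :=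
      hg.comp (h1.prodMk (hY k (by omega)))
    exact h1.add (h2.const_smul (S.ε (n + k)))

/-- The piecewise constant interpolation with value `X^n_{n+k}` on the `k`-th cell (and value `0`
after the last cell). -/
def stepPath (n : ℕ) (y : ℕ → E d₂) (s : I T) : E d₁ :=
  ∑ k ∈ Finset.range (S.β n), (S.cell n k).indicator (fun _ => path S g x n y k) s

lemma stepPath_of_mem {n k : ℕ} (y : ℕ → E d₂) (hk : k < S.β n) {s : I T} (hs : s ∈ S.cell n k) :
    stepPath S g x n y s = path S g x n y k :=
  S.sum_indicator_cell hk hs _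

lemma measurable_stepPath (n : ℕ) (y : ℕ → E d₂) : Measurable (stepPath S g x n y) :=
  Finset.measurable_fun_sum _ fun k _ => measurable_const.indicator (S.measurableSet_cell n k)

/-- The total excess of the updates over the level `K` along a window,
`∑ ε_i (‖g(X_i, Y_i)‖ - K)⁺`. -/
def excess (K : ℝ) (n : ℕ) (y : ℕ → E d₂) : ℝ :=
  ∑ k ∈ Finset.range (S.β n),
    S.ε (n + k) * max (‖g (path S g x n y k) (y k)‖ - K) 0

lemma measurable_update {Ω : Type*} {m : MeasurableSpace Ω} {g : E d₁ → E d₂ → E d₁}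
    (hg : Measurable (Function.uncurry g)) (n : ℕ) {Y : ℕ → Ω → E d₂} {k : ℕ}
    (hY : ∀ j ≤ k, Measurable (Y j)) :
    Measurable fun ω => g (path S g x n (fun j => Y j ω) k) (Y k ω) :=
  hg.comp ((measurable_path S x hg n fun j hj => hY j hj.le).prodMk (hY k le_rfl))

lemma measurable_excess {Ω : Type*} {m : MeasurableSpace Ω} {g : E d₁ → E d₂ → E d₁}
    (hg : Measurable (Function.uncurry g)) (K : ℝ) (n : ℕ) {Y : ℕ → Ω → E d₂}
    (hY : ∀ j < S.β n, Measurable (Y j)) :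
    Measurable fun ω => excess S g x K n fun j => Y j ω := by
  refine Finset.measurable_fun_sum _ fun k hk => ?_
  have := (measurable_update S x hg n (k := k) fun j hj =>
    hY j (hj.trans_lt (Finset.mem_range.mp hk))).norm
  fun_prop

lemma path_succ_sub (n : ℕ) (y : ℕ → E d₂) (k : ℕ) :
    path S g x n y (k + 1) - path S g x n y k =
      S.ε (n + k) • g (path S g x n y k) (y k) := by
  rw [path]; abel

lemma frac_nonneg (n k : ℕ) (s : ℝ) : 0 ≤ frac S n k s :=
  div_nonneg (le_min (le_max_right _ _) (S.pos _).le) (S.pos _).le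

lemma frac_le_one (n k : ℕ) (s : ℝ) : frac S n k s ≤ 1 :=
  (div_le_one (S.pos _)).mpr (min_le_right _ _)

/-- The time spent in the `k`-th cell before time `s`. -/
lemma frac_mul_eps (n k : ℕ) (s : ℝ) :
    frac S n k s * S.ε (n + k) = min s (S.τ n (k + 1)) - min s (S.τ n k) := by
  have := S.pos (n + k)
  rw [frac, div_mul_cancel₀ _ (S.pos _).ne', S.τ_succ]
  simp only [min_def, max_def]
  split_ifs <;> linarith

lemma sum_abs_frac_sub_le (n : ℕ) (s t : ℝ) :
    ∑ k ∈ Finset.range (S.β n), |frac S n k s - frac S n k t| * S.ε (n + k) ≤ |s - t| := by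
  wlog hst : t ≤ s generalizing s t
  · rw [abs_sub_comm s t]
    refine le_trans (le_of_eq ?_) (this t s (le_of_not_ge hst))
    exact Finset.sum_congr rfl fun k _ => by rw [abs_sub_comm]
  have h1 : ∀ k ∈ Finset.range (S.β n), |frac S n k s - frac S n k t| * S.ε (n + k) =
      (min s (S.τ n (k + 1)) - min t (S.τ n (k + 1))) -
        (min s (S.τ n k) - min t (S.τ n k)) := by
    intro k _
    have h2 : 0 ≤ frac S n k s - frac S n k t := by
      rw [sub_nonneg]
      unfold frac
      have := S.pos (n + k)
      gcongr
    rw [abs_of_nonneg h2, sub_mul, frac_mul_eps, frac_mul_eps]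
    ring
  rw [Finset.sum_congr rfl h1,
    Finset.sum_range_sub fun k => min s (S.τ n k) - min t (S.τ n k)]
  rw [abs_of_nonneg (sub_nonneg.mpr hst)]
  simp only [min_def]
  split_ifs <;> linarith

lemma interp_apply (n : ℕ) (y : ℕ → E d₂) (s : I T) :
    interp S g x n y s = x + ∑ k ∈ Finset.range (S.β n),
      (frac S n k s * S.ε (n + k)) • g (path S g x n y k) (y k) := by
  change x + ∑ k ∈ Finset.range (S.β n),
    frac S n k s • (path S g x n y (k + 1) - path S g x n y k) = _
  simp_rw [path_succ_sub, smul_smul]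

lemma le_add_max (a K : ℝ) : a ≤ K + max (a - K) 0 := by
  linarith [le_max_left (a - K) 0]

/-- The interpolated path is Lipschitz up to the excess. -/
lemma norm_interp_sub_le {K : ℝ} (hK : 0 ≤ K) (n : ℕ) (y : ℕ → E d₂) (s t : I T) :
    ‖interp S g x n y s - interp S g x n y t‖ ≤ K * |(s : ℝ) - t| + excess S g x K n y := by
  rw [interp_apply, interp_apply, add_sub_add_left_eq_sub, ← Finset.sum_sub_distrib]
  refine (norm_sum_le _ _).trans ?_
  have h1 : ∀ k ∈ Finset.range (S.β n),
      ‖(frac S n k s * S.ε (n + k)) • g (path S g x n y k) (y k) -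
        (frac S n k t * S.ε (n + k)) • g (path S g x n y k) (y k)‖ ≤
      K * (|frac S n k s - frac S n k t| * S.ε (n + k)) +
        S.ε (n + k) * max (‖g (path S g x n y k) (y k)‖ - K) 0 := by
    intro k _
    have hε := S.pos (n + k)
    have hfr : |frac S n k s - frac S n k t| ≤ 1 := by
      rw [abs_le]
      constructor <;> linarith [frac_nonneg S n k s, frac_nonneg S n k t, frac_le_one S n k s,
        frac_le_one S n k t]
    rw [← sub_smul, ← sub_mul, norm_smul, Real.norm_eq_abs, abs_mul, abs_of_pos hε]
    set q := |frac S n k s - frac S n k t| with hq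
    set w := max (‖g (path S g x n y k) (y k)‖ - K) 0 with hw
    have hw0 : 0 ≤ w := le_max_right _ _
    have hq0 : 0 ≤ q := abs_nonneg _
    calc q * S.ε (n + k) * ‖g (path S g x n y k) (y k)‖
        ≤ q * S.ε (n + k) * (K + w) :=
          mul_le_mul_of_nonneg_left (le_add_max _ _) (by positivity)
      _ = K * (q * S.ε (n + k)) + q * (S.ε (n + k) * w) := by ring
      _ ≤ K * (q * S.ε (n + k)) + 1 * (S.ε (n + k) * w) := by gcongr
      _ = _ := by ring
  refine (Finset.sum_le_sum h1).trans ?_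
  rw [Finset.sum_add_distrib, ← Finset.mul_sum]
  exact add_le_add (mul_le_mul_of_nonneg_left (sum_abs_frac_sub_le S n s t) hK) le_rfl

lemma interp_zero (hT : 0 ≤ T) (n : ℕ) (y : ℕ → E d₂) :
    interp S g x n y ⟨0, le_rfl, hT⟩ = x := by
  rw [interp_apply]
  simp only [add_eq_left]
  refine Finset.sum_eq_zero fun k _ => ?_
  rw [frac_of_le S (S.τ_nonneg n k), zero_mul, zero_smul]

lemma norm_interp_le (n : ℕ) (y : ℕ → E d₂) (s : I T) :
    ‖interp S g x n y s‖ ≤ ‖x‖ + excess S g x 0 n y := by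
  rw [interp_apply]
  refine (norm_add_le _ _).trans (add_le_add le_rfl ((norm_sum_le _ _).trans ?_))
  refine Finset.sum_le_sum fun k _ => ?_
  have hε := S.pos (n + k)
  have h0 := frac_nonneg S n k s
  have h1 := frac_le_one S n k s
  rw [norm_smul, Real.norm_of_nonneg (by positivity), sub_zero,
    max_eq_left (norm_nonneg _)]
  have : frac S n k s * S.ε (n + k) ≤ 1 * S.ε (n + k) := by gcongr
  gcongr
  linarith

lemma interp_breakpoint (n : ℕ) (y : ℕ → E d₂) {k : ℕ} (hk : k < S.β n) {s : I T}
    (hs : (s : ℝ) = S.τ n k) : interp S g x n y s = path S g x n y k := by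
  rw [interp_of_mem S g x n y hk (s := s)
    ⟨hs.ge, hs.le.trans (S.τ_mono n (Nat.le_succ k))⟩, hs]
  simp

lemma τ_le_T {n k : ℕ} (hk : k ≤ S.β n) : S.τ n k ≤ T :=
  (S.τ_mono n hk).trans (S.τ_β_le n)

lemma norm_path_le (n : ℕ) (y : ℕ → E d₂) {k : ℕ} (hk : k < S.β n) :
    ‖path S g x n y k‖ ≤ ‖x‖ + excess S g x 0 n y := by
  rw [← interp_breakpoint S g x n y hk (s := ⟨S.τ n k, S.τ_nonneg n k, τ_le_T S hk.le⟩) rfl]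
  exact norm_interp_le S g x n y _

lemma norm_interp_sub_path_le {K : ℝ} (hK : 0 ≤ K) (n : ℕ) (y : ℕ → E d₂) {k : ℕ}
    (hk : k < S.β n) {s : I T} (hs : s ∈ S.cell n k) :
    ‖interp S g x n y s - path S g x n y k‖ ≤ K * S.ε (n + k) + excess S g x K n y := by
  rw [← interp_breakpoint S g x n y hk (s := ⟨S.τ n k, S.τ_nonneg n k, τ_le_T S hk.le⟩) rfl]
  refine (norm_interp_sub_le S g x hK n y _ _).trans (add_le_add ?_ le_rfl)
  have h1 := hs.1
  have h2 := hs.2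
  rw [S.τ_succ] at h2
  refine mul_le_mul_of_nonneg_left ?_ hK
  rw [abs_of_nonneg (by simpa using h1)]
  simp only
  linarith

end Path

section Occupation

variable {d₁ d₂ : ℕ} {T : ℝ} (S : StepSizes T) (g : E d₁ → E d₂ → E d₁) (x : E d₁)

lemma ofReal_mul_leb_cell {n k : ℕ} (hk : k < S.β n) :
    ENNReal.ofReal (1 / S.hval n k) * leb T (S.cell n k) = (S.β n : ℝ≥0∞)⁻¹ := by
  have hε := S.pos (n + k)
  have hβ := S.beta_cast_pos n
  rw [S.volume_cell n k hk, ← ENNReal.ofReal_mul (by unfold StepSizes.hval; positivity),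
    ← ENNReal.ofReal_natCast (S.β n), ← ENNReal.ofReal_inv_of_pos hβ]
  congr 1
  unfold StepSizes.hval
  field_simp

lemma beta_inv_mul_sum_const (n : ℕ) (b : ℝ≥0∞) :
    (S.β n : ℝ≥0∞)⁻¹ * ∑ _k ∈ Finset.range (S.β n), b = b := by
  rw [Finset.sum_const, Finset.card_range, nsmul_eq_mul, ← mul_assoc, ENNReal.inv_mul_cancel
    (by exact_mod_cast S.beta_ne_zero n) (ENNReal.natCast_ne_top _), one_mul]

lemma lintegral_occMeasure (n : ℕ) (m : ℕ → Measure (E d₂)) [∀ k, IsProbabilityMeasure (m k)]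
    {F : E d₂ × I T → ℝ≥0∞} (hF : Measurable F) :
    ∫⁻ p, F p ∂occMeasure S n m = ∑ k ∈ Finset.range (S.β n), ENNReal.ofReal (1 / S.hval n k) *
      ∫⁻ s in S.cell n k, ∫⁻ z, F (z, s) ∂m k ∂leb T := by
  rw [occMeasure, lintegral_finsetSum_measure]
  refine Finset.sum_congr rfl fun k _ => ?_
  rw [lintegral_smul_measure, lintegral_prod_symm' _ hF, smul_eq_mul]

/-- Integrals of functions of the state and the noise against the control measure. -/
lemma lintegral_occMeasure_stepPath (n : ℕ) (m : ℕ → Measure (E d₂))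
    [∀ k, IsProbabilityMeasure (m k)] (y : ℕ → E d₂) {Ψ : E d₁ → E d₂ → ℝ≥0∞}
    (hΨ : Measurable (Function.uncurry Ψ)) :
    ∫⁻ p, Ψ (stepPath S g x n y p.2) p.1 ∂occMeasure S n m =
      (S.β n : ℝ≥0∞)⁻¹ * ∑ k ∈ Finset.range (S.β n), ∫⁻ z, Ψ (path S g x n y k) z ∂m k := by
  have hF : Measurable fun p : E d₂ × I T => Ψ (stepPath S g x n y p.2) p.1 :=
    hΨ.comp (((measurable_stepPath S g x n y).comp measurable_snd).prodMk measurable_fst)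
  rw [lintegral_occMeasure S n m hF, Finset.mul_sum]
  refine Finset.sum_congr rfl fun k hk => ?_
  have hk' := Finset.mem_range.mp hk
  have h1 : ∫⁻ s in S.cell n k, ∫⁻ z, Ψ (stepPath S g x n y s) z ∂m k ∂leb T =
      ∫⁻ _ in S.cell n k, ∫⁻ z, Ψ (path S g x n y k) z ∂m k ∂leb T :=
    setLIntegral_congr_fun (S.measurableSet_cell n k) fun s hs => by
      simp only [stepPath_of_mem S g x y hk' hs]
  rw [h1, setLIntegral_const, ← ofReal_mul_leb_cell S hk']
  ring

/-- The control measure lives on the cells. -/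
lemma ae_occMeasure_mem_cell (n : ℕ) (m : ℕ → Measure (E d₂)) [∀ k, IsProbabilityMeasure (m k)] :
    ∀ᵐ p ∂occMeasure S n m, ∃ k, k < S.β n ∧ p.2 ∈ S.cell n k := by
  rw [ae_iff, show {p : E d₂ × I T | ¬∃ k, k < S.β n ∧ p.2 ∈ S.cell n k} =
    univ ×ˢ {s : I T | ¬∃ k, k < S.β n ∧ s ∈ S.cell n k} by ext; simp, occMeasure,
    Measure.finsetSum_apply]
  refine Finset.sum_eq_zero fun k hk => ?_
  have h0 : {s : I T | ¬∃ k, k < S.β n ∧ s ∈ S.cell n k} ∩ S.cell n k = ∅ := by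
    ext s
    simp only [mem_inter_iff, mem_ofPred_eq, mem_empty_iff_false, iff_false, not_and]
    exact fun h hs => h ⟨k, Finset.mem_range.mp hk, hs⟩
  rw [Measure.smul_apply, Measure.prod_prod, Measure.restrict_apply' (S.measurableSet_cell n k),
    h0, measure_empty, mul_zero, smul_zero]

end Occupation

section Control

lemma measurable_past {d₂ : ℕ} {Ω : Type*} {Y : ℕ → Ω → E d₂} {j k : ℕ} (hjk : j < k) :
    Measurable[pastSigma Y k] (Y j) := by
  have : MeasurableSpace.comap (Y j) inferInstance ≤ pastSigma Y k :=
    le_iSup₂_of_le j (Finset.mem_range.mpr hjk) le_rfl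
  exact (comap_measurable (Y j)).mono this le_rfl

lemma IsControl.pastSigma_le {d₂ : ℕ} {Ω : Type*} [MeasurableSpace Ω] {P : Measure Ω}
    {ν : ℕ → Kernel Ω (E d₂)} {Y : ℕ → Ω → E d₂} {N : ℕ} (hν : IsControl P N ν Y) {k : ℕ}
    (hk : k ≤ N) : pastSigma Y k ≤ (inferInstance : MeasurableSpace Ω) :=
  iSup₂_le fun j hj =>
    (hν.measurable_noise j ((Finset.mem_range.mp hj).trans_le hk)).comap_le

lemma measurable_path_past {d₁ d₂ : ℕ} {T : ℝ} {Ω : Type*} {Y : ℕ → Ω → E d₂}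
    (S : StepSizes T) {g : E d₁ → E d₂ → E d₁} (hg : Measurable (Function.uncurry g)) (x : E d₁)
    (n k : ℕ) : Measurable[pastSigma Y k] fun ω => path S g x n (fun j => Y j ω) k :=
  measurable_path (m := pastSigma Y k) S x hg n fun _ hj => measurable_past hj

variable {d₁ d₂ : ℕ} {T : ℝ} {Ω : Type*} [MeasurableSpace Ω] {P : Measure Ω}
  {ν : ℕ → Kernel Ω (E d₂)} [∀ k, IsMarkovKernel (ν k)] {Y : ℕ → Ω → E d₂}

/-- The random control measure `ν^n`. -/
abbrev occ (S : StepSizes T) (n : ℕ) (ν : ℕ → Kernel Ω (E d₂)) (ω : Ω) :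
    Measure (E d₂ × I T) := occMeasure S n fun k => ν k ω

instance (S : StepSizes T) (n : ℕ) (ω : Ω) : IsProbabilityMeasure (occ S n ν ω) :=
  isProbabilityMeasure_occMeasure S n fun k => ν k ω

lemma measurable_occ (S : StepSizes T) (n : ℕ) : Measurable (occ S n ν) := by
  refine Measure.measurable_of_measurable_coe _ fun A hA => ?_
  simp only [occ, occMeasure, Measure.finsetSum_apply, Measure.smul_apply, smul_eq_mul]
  refine Finset.measurable_fun_sum _ fun k _ => Measurable.const_mul ?_ _
  have h : Measurable fun ω => (ν k ×ₖ Kernel.const Ω ((leb T).restrict (S.cell n k))) ω A :=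
    Kernel.measurable_coe _ hA
  simpa only [Kernel.prod_apply, Kernel.const_apply] using h

variable [IsProbabilityMeasure P] {N : ℕ}

/-- Conditioning on the past: if `U` is determined by the noise before step `k`, then, jointly with
`U`, the noise in step `k` has the conditional distribution `ν_k`. -/
lemma IsControl.map_eq (hν : IsControl P N ν Y) {k : ℕ} (hk : k < N) {V : Type*}
    [MeasurableSpace V] {U : Ω → V} (hU : Measurable[pastSigma Y k] U) :
    P.map (fun ω => (U ω, Y k ω)) =
      (P ⊗ₘ ν k).map fun p : Ω × E d₂ => (U p.1, p.2) := by
  have hU' : Measurable U := hU.mono (hν.pastSigma_le hk.le) le_rfl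
  have hY := hν.measurable_noise k hk
  have hmap : Measurable fun p : Ω × E d₂ => (U p.1, p.2) := by fun_prop
  have : IsProbabilityMeasure (P.map fun ω => (U ω, Y k ω)) :=
    Measure.isProbabilityMeasure_map (hU'.prodMk hY).aemeasurable
  refine Measure.ext_prod fun {s} {t} hs ht => ?_
  rw [Measure.map_apply (hU'.prodMk hY) (hs.prod ht), Measure.map_apply hmap (hs.prod ht)]
  have h1 : (fun ω => (U ω, Y k ω)) ⁻¹' s ×ˢ t = U ⁻¹' s ∩ Y k ⁻¹' t := rfl
  have h2 : (fun p : Ω × E d₂ => (U p.1, p.2)) ⁻¹' s ×ˢ t = (U ⁻¹' s) ×ˢ t := rfl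
  rw [h1, h2, hν.condDistr k hk t ht _ (hU hs), Measure.compProd_apply_prod (hU' hs) ht]

lemma IsControl.lintegral_comp (hν : IsControl P N ν Y) {k : ℕ} (hk : k < N) {V : Type*}
    [MeasurableSpace V] {U : Ω → V} (hU : Measurable[pastSigma Y k] U)
    {F : V → E d₂ → ℝ≥0∞} (hF : Measurable (Function.uncurry F)) :
    ∫⁻ ω, F (U ω) (Y k ω) ∂P = ∫⁻ ω, ∫⁻ z, F (U ω) z ∂ν k ω ∂P := by
  have hU' : Measurable U := hU.mono (hν.pastSigma_le hk.le) le_rfl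
  have hmap : Measurable fun p : Ω × E d₂ => (U p.1, p.2) := by fun_prop
  have h1 := congrArg (fun μ => ∫⁻ q, Function.uncurry F q ∂μ) (hν.map_eq hk hU)
  rw [lintegral_map hF (hU'.prodMk (hν.measurable_noise k hk)), lintegral_map hF hmap] at h1
  exact h1.trans (Measure.lintegral_compProd (μ := P) (κ := ν k) (hF.comp hmap))

lemma IsControl.integral_comp (hν : IsControl P N ν Y) {k : ℕ} (hk : k < N) {V : Type*}
    [MeasurableSpace V] {U : Ω → V} (hU : Measurable[pastSigma Y k] U)
    {F : V → E d₂ → ℝ} (hF : Measurable (Function.uncurry F)) {C : ℝ}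
    (hC : ∀ ω z, |F (U ω) z| ≤ C) :
    ∫ ω, F (U ω) (Y k ω) ∂P = ∫ ω, ∫ z, F (U ω) z ∂ν k ω ∂P := by
  have hU' : Measurable U := hU.mono (hν.pastSigma_le hk.le) le_rfl
  have hmap : Measurable fun p : Ω × E d₂ => (U p.1, p.2) := by fun_prop
  have h1 := congrArg (fun μ => ∫ q, Function.uncurry F q ∂μ) (hν.map_eq hk hU)
  rw [integral_map (hU'.prodMk (hν.measurable_noise k hk)).aemeasurable
    hF.aestronglyMeasurable, integral_map hmap.aemeasurable hF.aestronglyMeasurable] at h1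
  exact h1.trans (Measure.integral_compProd (μ := P) (κ := ν k)
    (Integrable.of_bound (hF.comp hmap).aestronglyMeasurable C
      (ae_of_all _ fun p => hC p.1 p.2)))

variable (S : StepSizes T) {g : E d₁ → E d₂ → E d₁} (x : E d₁) (y₀ : E d₂) {n : ℕ}
  {ρ : E d₁ → Kernel (E d₂) (E d₂)} {lam : Measure (E d₂)} {η : E d₁ → E d₂ → E d₂ → ℝ≥0}

/-- Exponential integrability under the kernels `ρ` together with the entropy bound controls
integrals against the control measures. -/
lemma lintegral_occ_le_of_exp [∀ x, IsMarkovKernel (ρ x)] {c : ℝ} (hc : 0 ≤ c)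
    {ψ : E d₁ → E d₂ → ℝ}
    (hψ : Measurable (Function.uncurry ψ)) (h0 : ∀ a z, 0 ≤ ψ a z) {b : ℝ≥0∞}
    (hb : ∀ a y, ∫⁻ z, ENNReal.ofReal (Real.exp (c * ψ a z) - 1) ∂(ρ a y) ≤ b) :
    ENNReal.ofReal c * ∫⁻ ω, ∫⁻ p, ENNReal.ofReal
      (ψ (stepPath S g x n (fun j => Y j ω) p.2) p.1) ∂occ S n ν ω ∂P ≤
      runningCost S g ρ x y₀ n P ν Y + b := by
  rw [← lintegral_const_mul' _ _ ENNReal.ofReal_ne_top]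
  calc _ ≤ ∫⁻ ω, ((S.β n : ℝ≥0∞)⁻¹ * ∑ k ∈ Finset.range (S.β n),
          InformationTheory.klDiv (ν k ω)
            (ρ (path S g x n (fun j => Y j ω) k) (prevNoise y₀ (fun j => Y j ω) k)) + b) ∂P := by
        refine lintegral_mono fun ω => ?_
        simp only
        rw [lintegral_occMeasure_stepPath S g x n (fun k => ν k ω) (fun j => Y j ω)
          (Ψ := fun a z => ENNReal.ofReal (ψ a z)) hψ.ennreal_ofReal,
          mul_left_comm, Finset.mul_sum, ← beta_inv_mul_sum_const S n b, ← mul_add,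
          ← Finset.sum_add_distrib]
        gcongr with k _
        have hψx : Measurable (ψ (path S g x n (fun j => Y j ω) k)) := hψ.of_uncurry_left
        rw [← lintegral_const_mul _ hψx.ennreal_ofReal]
        simp_rw [← ENNReal.ofReal_mul hc]
        refine (lintegral_le_klDiv_add _ (ρ (path S g x n (fun j => Y j ω) k)
          (prevNoise y₀ (fun j => Y j ω) k)) (hψx.const_mul c)
          fun z => mul_nonneg hc (h0 _ z)).trans ?_
        gcongr
        exact hb _ _
    _ = _ := by
        rw [lintegral_add_right _ measurable_const, lintegral_const, measure_univ, mul_one]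
        rfl

end Control

/-! ### Averages under the control measures -/

section Estimates

lemma IsControl.measurable_path {d₁ d₂ : ℕ} {T : ℝ} {Ω : Type*} [MeasurableSpace Ω]
    {P : Measure Ω} {ν : ℕ → Kernel Ω (E d₂)} {Y : ℕ → Ω → E d₂} (S : StepSizes T)
    {g : E d₁ → E d₂ → E d₁} (x : E d₁) {n : ℕ} (hg : Measurable (Function.uncurry g))
    (hν : IsControl P (S.β n) ν Y) {k : ℕ} (hk : k < S.β n) :
    Measurable fun ω => path S g x n (fun j => Y j ω) k :=
  (measurable_path_past S hg x n k).mono (hν.pastSigma_le hk.le) le_rfl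

lemma ite_lt_le_div {a r : ℝ} (hr : 0 < r) :
    (if r < a then 1 else 0 : ℝ≥0∞) ≤ ENNReal.ofReal a / ENNReal.ofReal r := by
  split_ifs with h
  · rw [ENNReal.le_div_iff_mul_le (Or.inl (by simpa using hr)) (Or.inl ENNReal.ofReal_ne_top),
      one_mul]
    exact ENNReal.ofReal_le_ofReal h.le
  · exact zero_le

/-- The path leaves a ball only if the total size of the updates is large. -/
lemma lintegral_path_tail_le {d₁ d₂ : ℕ} {T : ℝ} {Ω : Type*} [MeasurableSpace Ω]
    {P : Measure Ω} {Y : ℕ → Ω → E d₂} (S : StepSizes T)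
    {g : E d₁ → E d₂ → E d₁} (x : E d₁) {n : ℕ} {r : ℝ} (hr : ‖x‖ < r) :
    ∫⁻ ω, (S.β n : ℝ≥0∞)⁻¹ * ∑ k ∈ Finset.range (S.β n),
        (if r < ‖path S g x n (fun j => Y j ω) k‖ then 1 else 0) ∂P ≤
      (∫⁻ ω, ENNReal.ofReal (excess S g x 0 n fun j => Y j ω) ∂P) / ENNReal.ofReal (r - ‖x‖) := by
  rw [div_eq_mul_inv, ← lintegral_mul_const' _ _ (by simpa using hr)]
  refine lintegral_mono fun ω => ?_
  simp only
  rw [← div_eq_mul_inv]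
  refine le_trans ?_ (ite_lt_le_div (sub_pos.mpr hr))
  rw [← beta_inv_mul_sum_const S n
    (if r - ‖x‖ < excess S g x 0 n fun j => Y j ω then 1 else 0)]
  refine mul_le_mul_right (Finset.sum_le_sum fun k hk => ?_) _
  split_ifs with h1 h2 h2
  · exact le_rfl
  · have := norm_path_le S g x n (fun j => Y j ω) (Finset.mem_range.mp hk)
    exact absurd (by linarith) h2
  · exact zero_le
  · exact le_rfl

variable {d₁ d₂ : ℕ} {T : ℝ} {Ω : Type*} [MeasurableSpace Ω] {P : Measure Ω}
  {ν : ℕ → Kernel Ω (E d₂)} [∀ k, IsMarkovKernel (ν k)] {Y : ℕ → Ω → E d₂}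
  [IsProbabilityMeasure P]
  (S : StepSizes T) {g : E d₁ → E d₂ → E d₁} (x : E d₁) (y₀ : E d₂) {n : ℕ}
  {ρ : E d₁ → Kernel (E d₂) (E d₂)} {lam : Measure (E d₂)} {η : E d₁ → E d₂ → E d₂ → ℝ≥0}

/-- Conditioning on the past turns averages along the controlled process into integrals against
the control measure. -/
lemma IsControl.lintegral_average (hg : Measurable (Function.uncurry g))
    (hν : IsControl P (S.β n) ν Y) {Ψ : E d₁ → E d₂ → ℝ≥0∞}
    (hΨ : Measurable (Function.uncurry Ψ)) :
    ∫⁻ ω, (S.β n : ℝ≥0∞)⁻¹ * ∑ k ∈ Finset.range (S.β n),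
        Ψ (path S g x n (fun j => Y j ω) k) (Y k ω) ∂P =
      ∫⁻ ω, ∫⁻ p, Ψ (stepPath S g x n (fun j => Y j ω) p.2) p.1 ∂occ S n ν ω ∂P := by
  have hpath : ∀ k, k < S.β n → Measurable fun ω => path S g x n (fun j => Y j ω) k :=
    fun k hk => hν.measurable_path S x hg hk
  have hmeas : ∀ k, k < S.β n → Measurable fun ω =>
      Ψ (path S g x n (fun j => Y j ω) k) (Y k ω) := fun k hk =>
    hΨ.comp ((hpath k hk).prodMk (hν.measurable_noise k hk))
  have hint : ∀ k, k < S.β n → Measurable fun ω =>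
      ∫⁻ z, Ψ (path S g x n (fun j => Y j ω) k) z ∂ν k ω := fun k hk =>
    Measurable.lintegral_kernel_prod_right' (κ := ν k)
      (hΨ.comp (((hpath k hk).comp measurable_fst).prodMk measurable_snd))
  have hinv : (S.β n : ℝ≥0∞)⁻¹ ≠ ⊤ :=
    ENNReal.inv_ne_top.mpr (by exact_mod_cast S.beta_ne_zero n)
  simp_rw [occ, lintegral_occMeasure_stepPath S g x n _ _ hΨ]
  rw [lintegral_const_mul' _ _ hinv, lintegral_const_mul' _ _ hinv,
    lintegral_finsetSum _ fun k hk => hint k (Finset.mem_range.mp hk),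
    lintegral_finsetSum _ fun k hk => hmeas k (Finset.mem_range.mp hk)]
  congr 1
  exact Finset.sum_congr rfl fun k hk => hν.lintegral_comp (Finset.mem_range.mp hk)
    (measurable_path_past S hg x n k) hΨ

/-- The weights `ε_i` are at most `M / β_n`, so weighted sums along the controlled process are
bounded by `M` times the integral against the control measure. -/
lemma lintegral_sum_eps_le (hg : Measurable (Function.uncurry g))
    (hν : IsControl P (S.β n) ν Y) {M : ℝ}
    (hM : ∀ k, k < S.β n → S.hval n k ≤ M) {Ψ : E d₁ → E d₂ → ℝ≥0∞}
    (hΨ : Measurable (Function.uncurry Ψ)) :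
    ∫⁻ ω, ∑ k ∈ Finset.range (S.β n), ENNReal.ofReal (S.ε (n + k)) *
        Ψ (path S g x n (fun j => Y j ω) k) (Y k ω) ∂P ≤
      ENNReal.ofReal M * ∫⁻ ω, ∫⁻ p, Ψ (stepPath S g x n (fun j => Y j ω) p.2) p.1
        ∂occ S n ν ω ∂P := by
  rw [← hν.lintegral_average S x hg hΨ, ← lintegral_const_mul' _ _ ENNReal.ofReal_ne_top]
  refine lintegral_mono fun ω => ?_
  simp only
  rw [Finset.mul_sum, Finset.mul_sum]
  refine Finset.sum_le_sum fun k hk => ?_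
  rw [← mul_assoc]
  refine mul_le_mul_left ?_ _
  have hβ := S.beta_cast_pos n
  rw [← ENNReal.ofReal_natCast (S.β n), ← ENNReal.ofReal_inv_of_pos hβ,
    ← ENNReal.ofReal_mul' (by positivity)]
  refine ENNReal.ofReal_le_ofReal ?_
  rw [← div_eq_mul_inv, le_div_iff₀ hβ, mul_comm]
  exact hM k (Finset.mem_range.mp hk)

/-- The expected excess along a window is controlled by the excess under the control measure. -/
lemma lintegral_excess_le (hg : Measurable (Function.uncurry g))
    (hν : IsControl P (S.β n) ν Y) {M : ℝ}
    (hM : ∀ k, k < S.β n → S.hval n k ≤ M) (K : ℝ) :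
    ∫⁻ ω, ENNReal.ofReal (excess S g x K n fun j => Y j ω) ∂P ≤
      ENNReal.ofReal M * ∫⁻ ω, ∫⁻ p, ENNReal.ofReal
        (‖g (stepPath S g x n (fun j => Y j ω) p.2) p.1‖ - K) ∂occ S n ν ω ∂P := by
  refine le_trans (le_of_eq (lintegral_congr fun ω => ?_))
    (lintegral_sum_eps_le S x hg hν hM (Ψ := fun a z => ENNReal.ofReal (‖g a z‖ - K))
      (hg.norm.sub_const K).ennreal_ofReal)
  rw [excess, ENNReal.ofReal_sum_of_nonneg fun k _ =>
    mul_nonneg (S.pos _).le (le_max_right _ _)]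
  refine Finset.sum_congr rfl fun k _ => ?_
  rw [ENNReal.ofReal_mul (S.pos _).le, ENNReal.ofReal_max, ENNReal.ofReal_zero, max_eq_left]
  exact zero_le

/-- Under the kernels the sections of a set are controlled by its sections under `lam`, where state
and noise are bounded. -/
lemma kernel_section_le [∀ x, IsMarkovKernel (ρ x)] (hA : Assumptions g ρ lam η) {r : ℝ} {M : ℝ≥0}
    (hM : ∀ a y z, ‖a‖ ≤ r → ‖y‖ ≤ r → ‖z‖ ≤ r → η a y z ≤ M) {b : ℝ≥0∞}
    (hb : ∀ a y, ρ a y {z | r < ‖z‖} ≤ b) {A : Set (E d₂)} (hAm : MeasurableSet A)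
    (a : E d₁) (y : E d₂) :
    ρ a y A ≤ M * lam A + b + (if r < ‖a‖ then 1 else 0) + (if r < ‖y‖ then 1 else 0) := by
  by_cases ha : r < ‖a‖
  · rw [if_pos ha]
    exact prob_le_one.trans (le_add_right (le_add_left le_rfl))
  by_cases hy : r < ‖y‖
  · rw [if_pos hy]
    exact prob_le_one.trans (le_add_left le_rfl)
  rw [if_neg ha, if_neg hy, add_zero, add_zero]
  have hset : MeasurableSet {z : E d₂ | r < ‖z‖} :=
    measurableSet_lt measurable_const measurable_norm
  rw [← measure_sdiff_add_inter A hset]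
  refine add_le_add ?_ ((measure_mono inter_subset_right).trans (hb a y))
  rw [hA.density, withDensity_apply _ (hAm.diff hset)]
  calc ∫⁻ z in A \ {z | r < ‖z‖}, (η a y z : ℝ≥0∞) ∂lam
      ≤ ∫⁻ _ in A \ {z | r < ‖z‖}, (M : ℝ≥0∞) ∂lam :=
        setLIntegral_mono' (hAm.diff hset) fun z hz =>
          ENNReal.coe_le_coe.mpr (hM a y z (not_lt.mp ha) (not_lt.mp hy) (not_lt.mp hz.2))
    _ ≤ M * lam A := by
        rw [setLIntegral_const]
        exact mul_le_mul_right (measure_mono sdiff_subset) _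

/-- Averaging over the cells: each cell carries the weight `1 / β_n`, so that terms which do not
depend on time become plain averages over the steps. -/
lemma cell_average_le {T : ℝ} (S : StepSizes T) {n : ℕ} {Λ : I T → ℝ≥0∞} (hΛ : Measurable Λ)
    (R i j : ℕ → ℝ≥0∞) {v : ℕ → I T → ℝ≥0∞} {c : ℝ} {e b : ℝ≥0∞} {M : ℝ≥0}
    (h : ∀ k s, ENNReal.ofReal c * v k s ≤ R k + e * (M * Λ s + b + i k + j k)) :
    ENNReal.ofReal c * ∑ k ∈ Finset.range (S.β n), ENNReal.ofReal (1 / S.hval n k) *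
      ∫⁻ s in S.cell n k, v k s ∂leb T ≤
    (S.β n : ℝ≥0∞)⁻¹ * ∑ k ∈ Finset.range (S.β n), R k +
      e * (M * (∑ k ∈ Finset.range (S.β n), ENNReal.ofReal (1 / S.hval n k) *
          ∫⁻ s in S.cell n k, Λ s ∂leb T) + b +
        (S.β n : ℝ≥0∞)⁻¹ * ∑ k ∈ Finset.range (S.β n), i k +
        (S.β n : ℝ≥0∞)⁻¹ * ∑ k ∈ Finset.range (S.β n), j k) := by
  have h1 : ∀ k ∈ Finset.range (S.β n), ENNReal.ofReal c * (ENNReal.ofReal (1 / S.hval n k) *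
      ∫⁻ s in S.cell n k, v k s ∂leb T) ≤ (S.β n : ℝ≥0∞)⁻¹ * R k +
        e * (M * (ENNReal.ofReal (1 / S.hval n k) * ∫⁻ s in S.cell n k, Λ s ∂leb T) +
          (S.β n : ℝ≥0∞)⁻¹ * b + (S.β n : ℝ≥0∞)⁻¹ * i k + (S.β n : ℝ≥0∞)⁻¹ * j k) := by
    intro k hk
    rw [mul_left_comm, ← lintegral_const_mul' _ _ ENNReal.ofReal_ne_top]
    calc ENNReal.ofReal (1 / S.hval n k) *
          ∫⁻ s in S.cell n k, ENNReal.ofReal c * v k s ∂leb T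
        ≤ ENNReal.ofReal (1 / S.hval n k) *
          ∫⁻ s in S.cell n k, ((e * M) * Λ s + (R k + e * (b + i k + j k))) ∂leb T := by
          refine mul_le_mul_right (lintegral_mono fun s => (h k s).trans (le_of_eq ?_)) _
          ring
      _ = _ := by
          rw [lintegral_add_right _ measurable_const, lintegral_const_mul _ hΛ, setLIntegral_const,
            ← ofReal_mul_leb_cell S (Finset.mem_range.mp hk)]
          ring
  rw [Finset.mul_sum]
  refine (Finset.sum_le_sum h1).trans (le_of_eq ?_)
  conv_rhs => rw [← beta_inv_mul_sum_const S n b]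
  simp only [Finset.sum_add_distrib, ← Finset.mul_sum]

/-- Control of the control measure of a small set: where state and noise are bounded the densities
of the kernels are bounded, so that the entropy bound prevents mass from concentrating on sets that
are small for `lam ⊗ dt`. -/
lemma lintegral_occ_set_le [∀ x, IsMarkovKernel (ρ x)] (hA : Assumptions g ρ lam η)
    (hν : IsControl P (S.β n) ν Y) {c₀ : ℝ} (hc₀ : 0 < c₀)
    (hh : ∀ k, k < S.β n → c₀ ≤ S.hval n k) {c r : ℝ} (hc : 0 ≤ c) {M : ℝ≥0}
    (hM : ∀ a y z, ‖a‖ ≤ r → ‖y‖ ≤ r → ‖z‖ ≤ r → η a y z ≤ M) {b : ℝ≥0∞}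
    (hb : ∀ a y, ρ a y {z | r < ‖z‖} ≤ b) {A : Set (E d₂ × I T)} (hAm : MeasurableSet A) :
    ENNReal.ofReal c * ∫⁻ ω, occ S n ν ω A ∂P ≤ runningCost S g ρ x y₀ n P ν Y +
      ENNReal.ofReal (Real.exp c) * (M * (ENNReal.ofReal (1 / c₀) * (lam.prod (leb T)) A) + b +
        ∫⁻ ω, (S.β n : ℝ≥0∞)⁻¹ * ∑ k ∈ Finset.range (S.β n),
          (if r < ‖path S g x n (fun j => Y j ω) k‖ then 1 else 0) ∂P +
        ∫⁻ ω, (S.β n : ℝ≥0∞)⁻¹ * ∑ k ∈ Finset.range (S.β n),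
          (if r < ‖prevNoise y₀ (fun j => Y j ω) k‖ then 1 else 0) ∂P) := by
  have := hA.isProbabilityMeasure_lam
  set Λ : I T → ℝ≥0∞ := fun s => lam ((fun z => (z, s)) ⁻¹' A) with hΛ
  have hΛm : Measurable Λ := measurable_measure_prodMk_right hAm
  have hΛint : (lam.prod (leb T)) A = ∫⁻ s, Λ s ∂leb T := Measure.prod_apply_symm hAm
  have hsec : ∀ s : I T, MeasurableSet ((fun z : E d₂ => (z, s)) ⁻¹' A) :=
    fun s => measurable_prodMk_right hAm
  have hI : Measurable fun ω => (S.β n : ℝ≥0∞)⁻¹ * ∑ k ∈ Finset.range (S.β n),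
      (if r < ‖path S g x n (fun j => Y j ω) k‖ then 1 else 0 : ℝ≥0∞) := by
    refine Measurable.const_mul (Finset.measurable_fun_sum _ fun k hk => Measurable.ite
      (measurableSet_lt measurable_const ?_) measurable_const measurable_const) _
    exact (hν.measurable_path S x hA.measurable_g (Finset.mem_range.mp hk)).norm
  have hJ : Measurable fun ω => (S.β n : ℝ≥0∞)⁻¹ * ∑ k ∈ Finset.range (S.β n),
      (if r < ‖prevNoise y₀ (fun j => Y j ω) k‖ then 1 else 0 : ℝ≥0∞) := by
    refine Measurable.const_mul (Finset.measurable_fun_sum _ fun k hk => Measurable.ite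
      (measurableSet_lt measurable_const (Measurable.norm ?_)) measurable_const
      measurable_const) _
    cases k with
    | zero => exact measurable_const
    | succ k => exact hν.measurable_noise k (by have := Finset.mem_range.mp hk; omega)
  have hIJ : Measurable fun ω => M * (ENNReal.ofReal (1 / c₀) * (lam.prod (leb T)) A) + b +
      (S.β n : ℝ≥0∞)⁻¹ * ∑ k ∈ Finset.range (S.β n),
        (if r < ‖path S g x n (fun j => Y j ω) k‖ then 1 else 0 : ℝ≥0∞) +
      (S.β n : ℝ≥0∞)⁻¹ * ∑ k ∈ Finset.range (S.β n),
        (if r < ‖prevNoise y₀ (fun j => Y j ω) k‖ then 1 else 0 : ℝ≥0∞) :=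
    (measurable_const.add hI).add hJ
  -- the entropy inequality for the indicator function of a section
  have hstep : ∀ ω k s, ENNReal.ofReal c * ν k ω ((fun z => (z, s)) ⁻¹' A) ≤
      InformationTheory.klDiv (ν k ω)
        (ρ (path S g x n (fun j => Y j ω) k) (prevNoise y₀ (fun j => Y j ω) k)) +
      ENNReal.ofReal (Real.exp c) * (M * Λ s + b +
        (if r < ‖path S g x n (fun j => Y j ω) k‖ then 1 else 0) +
        (if r < ‖prevNoise y₀ (fun j => Y j ω) k‖ then 1 else 0)) := by
    intro ω k s
    have h1 := lintegral_le_klDiv_add (ν k ω)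
      (ρ (path S g x n (fun j => Y j ω) k) (prevNoise y₀ (fun j => Y j ω) k))
      (φ := ((fun z => (z, s)) ⁻¹' A).indicator fun _ => c) (measurable_const.indicator (hsec s))
      (fun z => indicator_nonneg (fun _ _ => hc) z)
    have h2 : ∀ z, ENNReal.ofReal (((fun z => (z, s)) ⁻¹' A).indicator (fun _ => c) z) =
        ((fun z => (z, s)) ⁻¹' A).indicator (fun _ => ENNReal.ofReal c) z := fun z => by
      by_cases hz : z ∈ (fun z => (z, s)) ⁻¹' A <;> simp [hz]
    have h3 : ∀ z, ENNReal.ofReal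
        (Real.exp (((fun z => (z, s)) ⁻¹' A).indicator (fun _ => c) z) - 1) ≤
        ((fun z => (z, s)) ⁻¹' A).indicator (fun _ => ENNReal.ofReal (Real.exp c)) z := fun z => by
      by_cases hz : z ∈ (fun z => (z, s)) ⁻¹' A
      · simp only [hz, indicator_of_mem]
        exact ENNReal.ofReal_le_ofReal (by linarith)
      · simp [hz]
    simp_rw [h2] at h1
    rw [lintegral_indicator_const (hsec s)] at h1
    refine h1.trans (add_le_add le_rfl ((lintegral_mono h3).trans ?_))
    rw [lintegral_indicator_const (hsec s)]
    exact mul_le_mul_right (kernel_section_le hA hM hb (hsec s) _ _) _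
  have hocc : ∀ ω, occ S n ν ω A = ∑ k ∈ Finset.range (S.β n), ENNReal.ofReal (1 / S.hval n k) *
      ∫⁻ s in S.cell n k, ν k ω ((fun z => (z, s)) ⁻¹' A) ∂leb T := fun ω => by
    rw [← lintegral_indicator_one hAm, lintegral_occMeasure S n _ (measurable_one.indicator hAm)]
    refine Finset.sum_congr rfl fun k _ => ?_
    congr 1
    refine lintegral_congr fun s => ?_
    rw [← lintegral_indicator_one (hsec s)]
    rfl
  have hcells : ∑ k ∈ Finset.range (S.β n), ENNReal.ofReal (1 / S.hval n k) *
      ∫⁻ s in S.cell n k, Λ s ∂leb T ≤ ENNReal.ofReal (1 / c₀) * (lam.prod (leb T)) A := by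
    calc _ ≤ ∑ k ∈ Finset.range (S.β n), ENNReal.ofReal (1 / c₀) *
          ∫⁻ s in S.cell n k, Λ s ∂leb T := by
          refine Finset.sum_le_sum fun k hk => mul_le_mul_left (ENNReal.ofReal_le_ofReal ?_) _
          exact one_div_le_one_div_of_le hc₀ (hh k (Finset.mem_range.mp hk))
      _ = ENNReal.ofReal (1 / c₀) * ∫⁻ s in ⋃ k ∈ Finset.range (S.β n), S.cell n k, Λ s ∂leb T := by
          rw [← Finset.mul_sum, lintegral_biUnion_finset
            (fun i _ j _ hij => S.disjoint_cell hij) fun k _ => S.measurableSet_cell n k]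
      _ ≤ _ := by
          rw [hΛint]
          exact mul_le_mul_right (setLIntegral_le_lintegral _ _) _
  rw [← lintegral_const_mul' _ _ ENNReal.ofReal_ne_top]
  calc ∫⁻ ω, ENNReal.ofReal c * occ S n ν ω A ∂P
      ≤ ∫⁻ ω, ((S.β n : ℝ≥0∞)⁻¹ * ∑ k ∈ Finset.range (S.β n),
          InformationTheory.klDiv (ν k ω)
            (ρ (path S g x n (fun j => Y j ω) k) (prevNoise y₀ (fun j => Y j ω) k)) +
          ENNReal.ofReal (Real.exp c) *
            (M * (ENNReal.ofReal (1 / c₀) * (lam.prod (leb T)) A) + b +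
            (S.β n : ℝ≥0∞)⁻¹ * ∑ k ∈ Finset.range (S.β n),
              (if r < ‖path S g x n (fun j => Y j ω) k‖ then 1 else 0) +
            (S.β n : ℝ≥0∞)⁻¹ * ∑ k ∈ Finset.range (S.β n),
              (if r < ‖prevNoise y₀ (fun j => Y j ω) k‖ then 1 else 0))) ∂P := by
        refine lintegral_mono fun ω => ?_
        simp only
        rw [hocc]
        refine (cell_average_le S hΛm _ _ _ fun k s => hstep ω k s).trans ?_
        gcongr
    _ = _ := by
        rw [lintegral_add_right _ (hIJ.const_mul _), lintegral_const_mul _ hIJ,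
          lintegral_add_right _ hJ, lintegral_add_right _ hI, lintegral_const, measure_univ,
          mul_one]
        rfl

/-- Markov's inequality for the preceding noise. The average over the preceding noise differs from
that over the noise itself only by the initial noise state. -/
lemma lintegral_prevNoise_tail_le (hg : Measurable (Function.uncurry g))
    (hν : IsControl P (S.β n) ν Y) {r : ℝ} (hr : 0 < r) :
    ∫⁻ ω, (S.β n : ℝ≥0∞)⁻¹ * ∑ k ∈ Finset.range (S.β n),
        (if r < ‖prevNoise y₀ (fun j => Y j ω) k‖ then 1 else 0) ∂P ≤
      (ENNReal.ofReal ‖y₀‖ + ∫⁻ ω, ∫⁻ p, ENNReal.ofReal ‖p.1‖ ∂occ S n ν ω ∂P) /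
        ENNReal.ofReal r := by
  have h1 := hν.lintegral_average S (0 : E d₁) hg (Ψ := fun _ z => ENNReal.ofReal ‖z‖)
    measurable_snd.norm.ennreal_ofReal
  have h2 : ENNReal.ofReal ‖y₀‖ = ∫⁻ _, ENNReal.ofReal ‖y₀‖ ∂P := by simp
  rw [← h1, ENNReal.div_eq_inv_mul, h2, ← lintegral_add_left measurable_const,
    ← lintegral_const_mul' _ _ (by simpa using hr)]
  refine lintegral_mono fun ω => ?_
  simp only
  have hβ : (S.β n : ℝ≥0∞)⁻¹ ≤ 1 := by
    rw [ENNReal.inv_le_one]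
    exact_mod_cast Nat.one_le_iff_ne_zero.mpr (S.beta_ne_zero n)
  calc (S.β n : ℝ≥0∞)⁻¹ * ∑ k ∈ Finset.range (S.β n),
        (if r < ‖prevNoise y₀ (fun j => Y j ω) k‖ then 1 else 0)
      ≤ (S.β n : ℝ≥0∞)⁻¹ * ∑ k ∈ Finset.range (S.β n + 1), (ENNReal.ofReal r)⁻¹ *
          ENNReal.ofReal ‖prevNoise y₀ (fun j => Y j ω) k‖ := by
        refine mul_le_mul_right ((Finset.sum_le_sum fun k _ => ?_).trans
          (Finset.sum_le_sum_of_subset (Finset.range_mono (Nat.le_succ _)))) _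
        rw [← ENNReal.div_eq_inv_mul]
        exact ite_lt_le_div hr
    _ = (S.β n : ℝ≥0∞)⁻¹ * ((ENNReal.ofReal r)⁻¹ * ENNReal.ofReal ‖y₀‖) +
        (ENNReal.ofReal r)⁻¹ * ((S.β n : ℝ≥0∞)⁻¹ * ∑ k ∈ Finset.range (S.β n),
          ENNReal.ofReal ‖Y k ω‖) := by
        rw [Finset.sum_range_succ', ← Finset.mul_sum]
        simp only [prevNoise]
        ring
    _ ≤ 1 * ((ENNReal.ofReal r)⁻¹ * ENNReal.ofReal ‖y₀‖) +
        (ENNReal.ofReal r)⁻¹ * ((S.β n : ℝ≥0∞)⁻¹ * ∑ k ∈ Finset.range (S.β n),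
          ENNReal.ofReal ‖Y k ω‖) := by gcongr
    _ = _ := by rw [one_mul, mul_add]

end Estimates

/-! ### Uniform bounds from bounded cost -/

/-- What is used of the assumptions on the kernels and on the cost: under the expected control
measures of all windows, the updates are uniformly integrable, the noise has a uniformly bounded
first moment, and sets that are small for `lam ⊗ dt` are uniformly small. -/
structure UniformlyControlled {d₁ d₂ : ℕ} {T : ℝ} (S : StepSizes T) (g : E d₁ → E d₂ → E d₁)
    (x : E d₁) (lam : Measure (E d₂)) {Ω : ℕ → Type*} [∀ n, MeasurableSpace (Ω n)]
    (P : ∀ n, Measure (Ω n)) (ν : ∀ n, ℕ → Kernel (Ω n) (E d₂)) (Y : ∀ n, ℕ → Ω n → E d₂) :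
    Prop where
  measurable_update : Measurable (Function.uncurry g)
  continuous_update : ∀ z, Continuous fun a => g a z
  isProbabilityMeasure_lam : IsProbabilityMeasure lam
  isControl : ∀ n, IsControl (P n) (S.β n) (ν n) (Y n)
  update_tail : ∀ η : ℝ≥0∞, η ≠ 0 → ∃ K : ℝ, 0 ≤ K ∧ ∀ n,
    ∫⁻ ω, ∫⁻ p, ENNReal.ofReal (‖g (stepPath S g x n (fun j => Y n j ω) p.2) p.1‖ - K)
      ∂occ S n (ν n) ω ∂P n ≤ η
  noise_moment : ∃ C : ℝ≥0, ∀ n,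
    ∫⁻ ω, ∫⁻ p, ENNReal.ofReal ‖p.1‖ ∂occ S n (ν n) ω ∂P n ≤ C
  small_set : ∀ η : ℝ≥0∞, η ≠ 0 → ∃ δ : ℝ≥0∞, δ ≠ 0 ∧ ∀ A : Set (E d₂ × I T), MeasurableSet A →
    (lam.prod (leb T)) A ≤ δ → ∀ n, ∫⁻ ω, occ S n (ν n) ω A ∂P n ≤ η

/-- A rate `c` so large that `c a ≤ C` forces `a ≤ η`. The entropy inequality gives bounds of the
form `c a ≤ C` with `C` independent of `c`. -/
lemma exists_rate (C η : ℝ≥0∞) (hC : C ≠ ⊤) (hη : η ≠ 0) :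
    ∃ c : ℝ, 0 < c ∧ ∀ a : ℝ≥0∞, ENNReal.ofReal c * a ≤ C → a ≤ η := by
  by_cases htop : η = ⊤
  · exact ⟨1, one_pos, fun a _ => by simp [htop]⟩
  have hη' : 0 < η.toReal := ENNReal.toReal_pos hη htop
  refine ⟨(C.toReal + 1) / η.toReal, by positivity, fun a ha => ?_⟩
  have hc : ENNReal.ofReal ((C.toReal + 1) / η.toReal) = (C + 1) / η := by
    rw [ENNReal.ofReal_div_of_pos hη', ENNReal.ofReal_toReal htop,
      ENNReal.ofReal_add ENNReal.toReal_nonneg zero_le_one, ENNReal.ofReal_toReal hC,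
      ENNReal.ofReal_one]
  rw [hc, mul_comm, mul_div_assoc', ENNReal.div_le_iff hη htop] at ha
  by_contra! hlt
  have hC1 : C + 1 ≠ 0 := by simp
  have hC2 : C + 1 ≠ ⊤ := by simp [hC]
  have h1 : η * (C + 1) < C * η :=
    (ENNReal.mul_lt_mul_left hC1 hC2 hlt).trans_le ha
  refine absurd h1 (not_lt.mpr ?_)
  rw [mul_comm η]
  exact mul_le_mul_left (le_add_right le_rfl) η

section

variable {d₁ d₂ : ℕ} {T : ℝ} {g : E d₁ → E d₂ → E d₁} {ρ : E d₁ → Kernel (E d₂) (E d₂)}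
  {lam : Measure (E d₂)} {η : E d₁ → E d₂ → E d₂ → ℝ≥0}

lemma Assumptions.exists_exp_update_bound (hA : Assumptions g ρ lam η) {c : ℝ} (hc : 0 ≤ c) :
    ∃ C : ℝ≥0, ∀ a y, ∫⁻ z, ENNReal.ofReal (Real.exp (c * ‖g a z‖)) ∂(ρ a y) ≤ C := by
  have := hA.isMarkovKernel
  obtain ⟨C, hC⟩ := exists_exp_norm_bound (fun i : E d₁ × E d₂ => ρ i.1 i.2) (fun i => g i.1)
    (fun i => hA.measurable_g.of_uncurry_left)
    (fun v => (hA.expMoment_update v).imp fun C hC i => hC i.1 i.2) c hc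
  exact ⟨C, fun a y => hC (a, y)⟩

lemma Assumptions.exists_exp_noise_bound (hA : Assumptions g ρ lam η) {c : ℝ} (hc : 0 ≤ c) :
    ∃ C : ℝ≥0, ∀ a y, ∫⁻ z, ENNReal.ofReal (Real.exp (c * ‖z‖)) ∂(ρ a y) ≤ C := by
  have := hA.isMarkovKernel
  obtain ⟨C, hC⟩ := exists_exp_norm_bound (fun i : E d₁ × E d₂ => ρ i.1 i.2) (fun _ z => z)
    (fun i => measurable_id)
    (fun v => (hA.expMoment_noise v).imp fun C hC i => hC i.1 i.2) c hc
  exact ⟨C, fun a y => hC (a, y)⟩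

/-- The densities are bounded on bounded sets: by continuity for one state, and then for all
states in a ball because the ratios are bounded. -/
lemma Assumptions.exists_density_bound (hA : Assumptions g ρ lam η) {r : ℝ} (hr : 0 ≤ r) :
    ∃ M : ℝ≥0, ∀ a y z, ‖a‖ ≤ r → ‖y‖ ≤ r → ‖z‖ ≤ r → η a y z ≤ M := by
  obtain ⟨C, hC⟩ := hA.density_ratio (Metric.closedBall 0 r) (isCompact_closedBall 0 r)
  obtain ⟨M, hM⟩ := (((isCompact_closedBall (0 : E d₂) r).prod
    (isCompact_closedBall (0 : E d₂) r)).image (hA.density_continuous_noise 0)).bddAbove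
  refine ⟨C * M, fun a y z ha hy hz => (hC a (by simpa using ha) 0 (by simpa using hr) y z).trans
    (mul_le_mul_right (hM ⟨(y, z), ?_, rfl⟩) C)⟩
  simp [hy, hz]

variable (S : StepSizes T) (x : E d₁) (y₀ : E d₂)
  {Ω : ℕ → Type*} [∀ n, MeasurableSpace (Ω n)] {P : ∀ n, Measure (Ω n)}
  [∀ n, IsProbabilityMeasure (P n)] {ν : ∀ n, ℕ → Kernel (Ω n) (E d₂)}
  [∀ n k, IsMarkovKernel (ν n k)] {Y : ∀ n, ℕ → Ω n → E d₂}

/-- The updates are uniformly integrable under the expected control measures: by the entropy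
inequality, the exponential moments of all orders under the kernels control the tails. -/
lemma exists_update_tail (hA : Assumptions g ρ lam η) {C : ℝ≥0∞} (hC : C ≠ ⊤)
    (hcost : ∀ n, runningCost S g ρ x y₀ n (P n) (ν n) (Y n) ≤ C) {η' : ℝ≥0∞} (hη : η' ≠ 0) :
    ∃ K : ℝ, 0 ≤ K ∧ ∀ n,
      ∫⁻ ω, ∫⁻ p, ENNReal.ofReal (‖g (stepPath S g x n (fun j => Y n j ω) p.2) p.1‖ - K)
        ∂occ S n (ν n) ω ∂P n ≤ η' := by
  have := hA.isMarkovKernel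
  obtain ⟨c, hc, hrate⟩ := exists_rate (C + 1) η' (by simp [hC]) hη
  obtain ⟨D, hD⟩ := hA.exists_exp_update_bound hc.le
  -- the level beyond which the exponential tail is below `1`
  obtain ⟨K, hK0, hK⟩ : ∃ K : ℝ, 0 ≤ K ∧ Real.exp (-(c * K)) * D ≤ 1 := by
    have h1 : Tendsto (fun K : ℝ => Real.exp (-(c * K)) * D) atTop (𝓝 (0 * D)) :=
      (Real.tendsto_exp_neg_atTop_nhds_zero.comp
        (tendsto_id.const_mul_atTop hc)).mul_const _
    rw [zero_mul] at h1
    obtain ⟨K, h2, h3⟩ := ((eventually_ge_atTop 0).and (h1.eventually (ge_mem_nhds one_pos))).exists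
    exact ⟨K, h2, h3⟩
  refine ⟨K, hK0, fun n => hrate _ ?_⟩
  have hψ : Measurable (Function.uncurry fun (a : E d₁) (z : E d₂) => max (‖g a z‖ - K) 0) :=
    (hA.measurable_g.norm.sub_const K).max measurable_const
  have hmax : ∀ u : ℝ, ENNReal.ofReal (max (u - K) 0) = ENNReal.ofReal (u - K) := fun u => by
    rw [ENNReal.ofReal_max, ENNReal.ofReal_zero, max_eq_left zero_le]
  have h1 := lintegral_occ_le_of_exp (P := P n) (ν := ν n) (Y := Y n) S x y₀ (n := n) (ρ := ρ)
    (g := g) hc.le hψ (fun _ _ => le_max_right _ _) (b := 1) fun a y => ?_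
  · simp only [hmax] at h1
    exact h1.trans (add_le_add (hcost n) le_rfl)
  · calc ∫⁻ z, ENNReal.ofReal (Real.exp (c * max (‖g a z‖ - K) 0) - 1) ∂(ρ a y)
        ≤ ∫⁻ z, ENNReal.ofReal (Real.exp (-(c * K))) *
            ENNReal.ofReal (Real.exp (c * ‖g a z‖)) ∂(ρ a y) := by
          refine lintegral_mono fun z => ?_
          rw [← ENNReal.ofReal_mul (Real.exp_pos _).le, ← Real.exp_add]
          refine ENNReal.ofReal_le_ofReal ?_
          rcases le_total (‖g a z‖ - K) 0 with h | h
          · rw [max_eq_right h]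
            simp [Real.exp_nonneg]
          · rw [max_eq_left h, show c * (‖g a z‖ - K) = -(c * K) + c * ‖g a z‖ by ring]
            linarith
      _ ≤ ENNReal.ofReal (Real.exp (-(c * K))) * D := by
          rw [lintegral_const_mul' _ _ ENNReal.ofReal_ne_top]
          exact mul_le_mul_right (hD a y) _
      _ ≤ 1 := by
          rw [← ENNReal.ofReal_coe_nnreal, ← ENNReal.ofReal_mul (Real.exp_pos _).le,
            ← ENNReal.ofReal_one]
          exact ENNReal.ofReal_le_ofReal hK

lemma exists_noise_moment (hA : Assumptions g ρ lam η) {C : ℝ≥0∞} (hC : C ≠ ⊤)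
    (hcost : ∀ n, runningCost S g ρ x y₀ n (P n) (ν n) (Y n) ≤ C) :
    ∃ C : ℝ≥0, ∀ n, ∫⁻ ω, ∫⁻ p, ENNReal.ofReal ‖p.1‖ ∂occ S n (ν n) ω ∂P n ≤ C := by
  have := hA.isMarkovKernel
  obtain ⟨D, hD⟩ := hA.exists_exp_noise_bound zero_le_one
  lift C to ℝ≥0 using hC
  refine ⟨C + D, fun n => ?_⟩
  have h1 := lintegral_occ_le_of_exp (P := P n) (ν := ν n) (Y := Y n) S x y₀ (n := n) (ρ := ρ)
    (g := g) (ψ := fun _ z => ‖z‖) zero_le_one measurable_snd.norm (fun _ _ => norm_nonneg _)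
    (b := D) fun a y => (lintegral_mono fun z => ENNReal.ofReal_le_ofReal (by linarith)).trans
      (hD a y)
  rw [ENNReal.ofReal_one, one_mul] at h1
  rw [ENNReal.coe_add]
  exact h1.trans (add_le_add (hcost n) le_rfl)

lemma tendsto_div_ofReal_sub (D : ℝ≥0∞) (hD : D ≠ ⊤) (a : ℝ) :
    Tendsto (fun r : ℝ => D / ENNReal.ofReal (r - a)) atTop (𝓝 0) := by
  have h1 : Tendsto (fun r : ℝ => ENNReal.ofReal (r - a)) atTop (𝓝 ⊤) :=
    ENNReal.tendsto_ofReal_atTop.comp (tendsto_atTop_add_const_right _ _ tendsto_id)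
  simpa using ENNReal.Tendsto.const_div h1 (Or.inr hD)

/-- Sets that are small for `lam ⊗ dt` are uniformly small for the expected control measures. The
parameters are chosen in the order rate `c`, radius `r`, density bound `M` on the ball of radius
`r`, measure of the set. -/
lemma exists_small_set (hA : Assumptions g ρ lam η) {C : ℝ≥0∞} (hC : C ≠ ⊤)
    (hcost : ∀ n, runningCost S g ρ x y₀ n (P n) (ν n) (Y n) ≤ C)
    (hν : ∀ n, IsControl (P n) (S.β n) (ν n) (Y n)) {c₀ M₀ : ℝ} (hc₀ : 0 < c₀)
    (hb : ∀ n k, k < S.β n → c₀ ≤ S.hval n k ∧ S.hval n k ≤ M₀) {η' : ℝ≥0∞} (hη : η' ≠ 0) :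
    ∃ δ : ℝ≥0∞, δ ≠ 0 ∧ ∀ A : Set (E d₂ × I T), MeasurableSet A →
      (lam.prod (leb T)) A ≤ δ → ∀ n, ∫⁻ ω, occ S n (ν n) ω A ∂P n ≤ η' := by
  have := hA.isMarkovKernel
  -- the entropy bound, and four further terms that are made at most `1` each
  obtain ⟨c, hc, hrate⟩ := exists_rate (C + 4) η' (by simp [hC]) hη
  obtain ⟨D, hD⟩ := hA.exists_exp_noise_bound zero_le_one
  obtain ⟨D₁, hD₁⟩ := exists_noise_moment S x y₀ hA hC hcost
  obtain ⟨K, hK0, hK⟩ := exists_update_tail S x y₀ hA hC hcost one_ne_zero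
  -- the expected excess is bounded
  set W : ℝ≥0∞ := ENNReal.ofReal M₀ * (ENNReal.ofReal K + 1) with hW
  have hWtop : W ≠ ⊤ := by finiteness
  have hexc : ∀ n, ∫⁻ ω, ENNReal.ofReal (excess S g x 0 n fun j => Y n j ω) ∂P n ≤ W := by
    intro n
    refine (lintegral_excess_le S x hA.measurable_g (hν n) (fun k hk => (hb n k hk).2) 0).trans
      (mul_le_mul_right ?_ _)
    calc ∫⁻ ω, ∫⁻ p, ENNReal.ofReal (‖g (stepPath S g x n (fun j => Y n j ω) p.2) p.1‖ - 0)
          ∂occ S n (ν n) ω ∂P n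
        ≤ ∫⁻ ω, (ENNReal.ofReal K + ∫⁻ p,
          ENNReal.ofReal (‖g (stepPath S g x n (fun j => Y n j ω) p.2) p.1‖ - K)
            ∂occ S n (ν n) ω) ∂P n := by
          refine lintegral_mono fun ω => ?_
          have h1 : ENNReal.ofReal K = ∫⁻ _, ENNReal.ofReal K ∂occ S n (ν n) ω := by simp
          simp only
          rw [h1, ← lintegral_add_left measurable_const]
          refine lintegral_mono fun p => ?_
          simp only
          rw [sub_zero]
          refine le_trans (le_of_eq ?_) ENNReal.ofReal_add_le
          congr 1; ring
      _ ≤ ENNReal.ofReal K + 1 := by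
          rw [lintegral_add_left measurable_const, lintegral_const, measure_univ, mul_one]
          exact add_le_add le_rfl (hK n)
  -- the tails of noise and state, multiplied with `exp c`
  have hlim : ∀ (D : ℝ≥0∞) (a : ℝ), D ≠ ⊤ → ∀ᶠ r : ℝ in atTop,
      ENNReal.ofReal (Real.exp c) * (D / ENNReal.ofReal (r - a)) ≤ 1 := fun D a hD => by
    have h1 := ENNReal.Tendsto.const_mul (a := ENNReal.ofReal (Real.exp c))
      (tendsto_div_ofReal_sub D hD a) (Or.inr ENNReal.ofReal_ne_top)
    rw [mul_zero] at h1
    exact h1.eventually (ge_mem_nhds one_pos)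
  obtain ⟨r, hr1, hr2, hr3, hr0⟩ := ((hlim D 0 ENNReal.coe_ne_top).and
    ((hlim W ‖x‖ hWtop).and ((hlim (ENNReal.ofReal ‖y₀‖ + D₁) 0 (by simp)).and
      (eventually_gt_atTop ‖x‖)))).exists
  rw [sub_zero] at hr1 hr3
  have hrpos : 0 < r := (norm_nonneg x).trans_lt hr0
  obtain ⟨M, hM⟩ := hA.exists_density_bound hrpos.le
  set B : ℝ≥0∞ := ENNReal.ofReal (Real.exp c) * (M * ENNReal.ofReal (1 / c₀)) with hB
  have hBtop : B ≠ ⊤ := by finiteness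
  refine ⟨B⁻¹, ENNReal.inv_ne_zero.mpr hBtop, fun A hAm hAδ n => hrate _ ?_⟩
  refine (lintegral_occ_set_le S x y₀ hA (hν n) hc₀ (fun k hk => (hb n k hk).1) hc.le hM
    (b := D / ENNReal.ofReal r) (fun a y => ?_) hAm).trans (add_le_add (hcost n) ?_)
  · rw [← lintegral_indicator_one (measurableSet_lt measurable_const measurable_norm)]
    calc ∫⁻ z, {z : E d₂ | r < ‖z‖}.indicator 1 z ∂ρ a y
        ≤ ∫⁻ z, ENNReal.ofReal (Real.exp (1 * ‖z‖)) / ENNReal.ofReal r ∂ρ a y := by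
          refine lintegral_mono fun z => ?_
          refine le_trans (le_of_eq ?_) ((ite_lt_le_div (a := ‖z‖) hrpos).trans
            (ENNReal.div_le_div_right (ENNReal.ofReal_le_ofReal ?_) _))
          · simp [indicator_apply]
          · rw [one_mul]; linarith [Real.add_one_le_exp ‖z‖]
      _ ≤ _ := by
          simp_rw [div_eq_mul_inv]
          rw [lintegral_mul_const' _ _ (by simpa using hrpos)]
          exact mul_le_mul_left (hD a y) _
  · rw [mul_add, mul_add, mul_add]
    have e1 : ENNReal.ofReal (Real.exp c) * (M * (ENNReal.ofReal (1 / c₀) *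
        (lam.prod (leb T)) A)) ≤ 1 := by
      calc _ = B * (lam.prod (leb T)) A := by rw [hB]; ring
        _ ≤ B * B⁻¹ := mul_le_mul_right hAδ _
        _ ≤ 1 := ENNReal.mul_inv_le_one _
    have e2 := (mul_le_mul_right ((lintegral_path_tail_le (P := P n) (Y := Y n) (n := n) (g := g)
      S x hr0).trans (ENNReal.div_le_div_right (hexc n) _)) (ENNReal.ofReal (Real.exp c))).trans hr2
    have e3 := (mul_le_mul_right ((lintegral_prevNoise_tail_le S y₀ hA.measurable_g (hν n)
      hrpos).trans (ENNReal.div_le_div_right (add_le_add le_rfl (hD₁ n)) _))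
      (ENNReal.ofReal (Real.exp c))).trans hr3
    calc _ ≤ (1 : ℝ≥0∞) + 1 + 1 + 1 := add_le_add (add_le_add (add_le_add e1 hr1) e2) e3
      _ = 4 := by norm_num

/-- The exponential moments and the bound on the relative entropies give the uniform estimates. -/
lemma uniformlyControlled (hA : Assumptions g ρ lam η)
    (hcost : ⨆ n, runningCost S g ρ x y₀ n (P n) (ν n) (Y n) < ⊤)
    (hν : ∀ n, IsControl (P n) (S.β n) (ν n) (Y n)) {c₀ M₀ : ℝ} (hc₀ : 0 < c₀)
    (hb : ∀ n k, k < S.β n → c₀ ≤ S.hval n k ∧ S.hval n k ≤ M₀) :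
    UniformlyControlled S g x lam P ν Y where
  measurable_update := hA.measurable_g
  continuous_update z := (hA.lipschitz_g z).elim fun _ h => h.continuous
  isProbabilityMeasure_lam := hA.isProbabilityMeasure_lam
  isControl := hν
  update_tail _ hη := exists_update_tail S x y₀ hA hcost.ne
    (le_iSup fun n => runningCost S g ρ x y₀ n (P n) (ν n) (Y n)) hη
  noise_moment := exists_noise_moment S x y₀ hA hcost.ne
    (le_iSup fun n => runningCost S g ρ x y₀ n (P n) (ν n) (Y n))
  small_set _ hη := exists_small_set S x y₀ hA hcost.ne
    (le_iSup fun n => runningCost S g ρ x y₀ n (P n) (ν n) (Y n)) hν hc₀ hb hη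

end

/-! ### Tightness -/

/-- An approximate modulus of continuity gives a genuine one. -/
lemma exists_delta_of_modulus {K : ℕ → ℝ} (hK : ∀ j, 0 ≤ K j) {η : ℝ} (hη : 0 < η) :
    ∃ δ > 0, ∀ {X F : Type} [PseudoMetricSpace X] [PseudoMetricSpace F] {f : X → F},
      (∀ j s t, dist (f s) (f t) ≤ K j * dist s t + 1 / ((j : ℝ) + 1)) →
      ∀ s t, dist s t < δ → dist (f s) (f t) < η := by
  obtain ⟨j, hj⟩ := exists_nat_one_div_lt (half_pos hη)
  have hKj := hK j
  refine ⟨η / (2 * (K j + 1)), by positivity, fun {X F _ _ f} hf s t hst => ?_⟩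
  have h1 : K j * dist s t ≤ (K j + 1) * (η / (2 * (K j + 1))) := by
    gcongr
    linarith
  have h2 : (K j + 1) * (η / (2 * (K j + 1))) = η / 2 := by field_simp
  linarith [hf j s t]

/-- By Arzelà–Ascoli, functions on `[0,T]` with given initial value and given modulus of continuity
form a compact set. -/
lemma isCompact_modulus {T : ℝ} (hT : 0 ≤ T) {d : ℕ} (x : E d) {K : ℕ → ℝ} (hK : ∀ j, 0 ≤ K j) :
    IsCompact {f : C(I T, E d) | f ⟨0, le_rfl, hT⟩ = x ∧
      ∀ (j : ℕ) (s t : I T), dist (f s) (f t) ≤ K j * dist s t + 1 / ((j : ℝ) + 1)} := by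
  refine ArzelaAscoli.isCompact_of_equicontinuous _ ?_ fun s₀ => ?_
  · have himg : ContinuousMap.toFun '' {f : C(I T, E d) | f ⟨0, le_rfl, hT⟩ = x ∧
        ∀ (j : ℕ) (s t : I T), dist (f s) (f t) ≤ K j * dist s t + 1 / ((j : ℝ) + 1)} =
        {f : I T → E d | f ⟨0, le_rfl, hT⟩ = x ∧
        ∀ (j : ℕ) (s t : I T), dist (f s) (f t) ≤ K j * dist s t + 1 / ((j : ℝ) + 1)} := by
      ext f
      constructor
      · rintro ⟨f, hf, rfl⟩
        exact hf
      · intro hf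
        refine ⟨⟨f, Metric.continuous_iff.mpr fun t η hη => ?_⟩, hf, rfl⟩
        obtain ⟨δ, hδ, h⟩ := exists_delta_of_modulus hK hη
        exact ⟨δ, hδ, fun s hs => h hf.2 s t hs⟩
    rw [himg]
    refine (isCompact_univ_pi fun _ : I T =>
      isCompact_closedBall x (K 0 * T + 1)).of_isClosed_subset ?_ ?_
    · have h1 : IsClosed {f : I T → E d | ∀ (j : ℕ) (s t : I T),
          dist (f s) (f t) ≤ K j * dist s t + 1 / ((j : ℝ) + 1)} := by
        simp only [ofPred_forall]
        exact isClosed_iInter fun j => isClosed_iInter fun s => isClosed_iInter fun t =>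
          isClosed_le ((continuous_apply s).dist (continuous_apply t)) continuous_const
      exact (isClosed_eq (continuous_apply _) continuous_const).inter h1
    · intro f hf s _
      rw [Metric.mem_closedBall, ← hf.1]
      refine (hf.2 0 s _).trans ?_
      have h1 : dist s (⟨0, le_rfl, hT⟩ : I T) ≤ T := by
        rw [Subtype.dist_eq, Real.dist_eq, sub_zero, abs_of_nonneg s.2.1]
        exact s.2.2
      have h2 := mul_le_mul_of_nonneg_left h1 (hK 0)
      norm_num
      exact h2
  · rw [Metric.equicontinuousAt_iff]
    intro η hη
    obtain ⟨δ, hδ, h⟩ := exists_delta_of_modulus hK hη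
    exact ⟨δ, hδ, fun t ht f => h f.2.2 s₀ t (by rwa [dist_comm])⟩

lemma isCompact_pairSpace {T : ℝ} {d₁ d₂ : ℕ} {A : Set (ProbabilityMeasure (E d₂ × I T))}
    {B : Set C(I T, E d₁)} (hA : IsCompact A) (hB : IsCompact B) :
    IsCompact {z : PairSpace T d₁ d₂ | z.1 ∈ A ∧ z.traj ∈ B} :=
  hA.prod hB

section

variable {d₁ d₂ : ℕ} {T : ℝ} {Ω : Type*} [MeasurableSpace Ω] {P : Measure Ω}
  {ν : ℕ → Kernel Ω (E d₂)} [∀ k, IsMarkovKernel (ν k)] {Y : ℕ → Ω → E d₂}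

lemma measurable_ctrlPair (S : StepSizes T) {g : E d₁ → E d₂ → E d₁}
    (hg : Measurable (Function.uncurry g)) (x : E d₁) {n : ℕ} (hν : IsControl P (S.β n) ν Y) :
    Measurable (ctrlPair S g x n ν Y) := by
  refine measurable_pairSpace (measurable_occ S n) fun s => ?_
  change Measurable fun ω => interp S g x n (fun j => Y j ω) s
  simp_rw [interp_apply]
  refine measurable_const.add (Finset.measurable_fun_sum _ fun k hk => ?_)
  have h1 := measurable_update S x hg n fun j hj =>
    hν.measurable_noise j (hj.trans_lt (Finset.mem_range.mp hk))
  exact h1.const_smul (frac S n k s * S.ε (n + k))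

end

section

variable {d₁ d₂ : ℕ} {T : ℝ} {S : StepSizes T} {g : E d₁ → E d₂ → E d₁} {x : E d₁}
  {lam : Measure (E d₂)} {Ω : ℕ → Type*} [∀ n, MeasurableSpace (Ω n)] {P : ∀ n, Measure (Ω n)}
  {ν : ∀ n, ℕ → Kernel (Ω n) (E d₂)} [∀ n k, IsMarkovKernel (ν n k)] {Y : ∀ n, ℕ → Ω n → E d₂}

/-- The control measures stay, with large probability, in a tight set. -/
lemma UniformlyControlled.exists_radius (hU : UniformlyControlled S g x lam P ν Y)
    {η : ℝ≥0∞} (hη : η ≠ 0) :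
    ∃ r : ℕ → ℝ, ∀ n, P n {ω | ∃ m : ℕ, ((1 / ((m : ℝ≥0) + 1) : ℝ≥0) : ℝ≥0∞) ≤
      occ S n (ν n) ω (Metric.closedBall 0 (r m) ×ˢ univ)ᶜ} ≤ η := by
  obtain ⟨δ, hδ, hsum⟩ := ENNReal.exists_pos_sum_of_countable' hη ℕ
  obtain ⟨C, hC⟩ := hU.noise_moment
  have hm : ∀ m : ℕ, ((1 / ((m : ℝ≥0) + 1) : ℝ≥0) : ℝ≥0∞) ≠ 0 := fun m => by
    rw [ENNReal.coe_ne_zero]; positivity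
  have hr : ∀ m : ℕ, ∃ r : ℝ, 0 < r ∧ C / ENNReal.ofReal r ≤
      δ m * ((1 / ((m : ℝ≥0) + 1) : ℝ≥0) : ℝ≥0∞) := by
    intro m
    have h1 := tendsto_div_ofReal_sub C ENNReal.coe_ne_top 0
    simp only [sub_zero] at h1
    exact ((eventually_gt_atTop 0).and (h1.eventually (ge_mem_nhds
      (pos_iff_ne_zero.mpr (mul_ne_zero (hδ m).ne' (hm m)))))).exists
  choose r hr0 hr using hr
  refine ⟨r, fun n => ?_⟩
  rw [ofPred_exists]
  refine (measure_iUnion_le _).trans ((ENNReal.tsum_le_tsum fun m => ?_).trans hsum.le)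
  have hset : MeasurableSet ((Metric.closedBall (0 : E d₂) (r m) ×ˢ (univ : Set (I T)))ᶜ) :=
    (Metric.isClosed_closedBall.measurableSet.prod MeasurableSet.univ).compl
  have hmeas : Measurable fun ω => occ S n (ν n) ω (Metric.closedBall 0 (r m) ×ˢ univ)ᶜ :=
    (Measure.measurable_coe hset).comp (measurable_occ S n)
  refine (meas_ge_le_lintegral_div (μ := P n) hmeas.aemeasurable (hm m)
    ENNReal.coe_ne_top).trans (ENNReal.div_le_of_le_mul (le_trans ?_ (hr m)))
  refine le_trans ?_ (ENNReal.div_le_div_right (hC n) _)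
  rw [div_eq_mul_inv, ← lintegral_mul_const' _ _ (by simpa using hr0 m)]
  refine lintegral_mono fun ω => ?_
  simp only
  rw [← lintegral_indicator_one hset, ← lintegral_mul_const' _ _ (by simpa using hr0 m)]
  refine lintegral_mono fun p => ?_
  simp only
  rw [← div_eq_mul_inv]
  refine le_trans (le_of_eq ?_) (ite_lt_le_div (a := ‖p.1‖) (hr0 m))
  by_cases hp : r m < ‖p.1‖
  · rw [if_pos hp, indicator_of_mem (by simp [mem_prod, hp])]; rfl
  · rw [if_neg hp, indicator_of_notMem (by simpa [mem_prod] using hp)]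

variable [∀ n, IsProbabilityMeasure (P n)]

lemma UniformlyControlled.exists_excess_le (hU : UniformlyControlled S g x lam P ν Y) {M : ℝ}
    (hM : ∀ n k, k < S.β n → S.hval n k ≤ M) {η : ℝ≥0∞} (hη : η ≠ 0) :
    ∃ K : ℝ, 0 ≤ K ∧ ∀ n, ∫⁻ ω, ENNReal.ofReal (excess S g x K n fun j => Y n j ω) ∂P n ≤ η := by
  obtain ⟨K, hK0, hK⟩ := hU.update_tail (η / (ENNReal.ofReal M + 1))
    (ENNReal.div_ne_zero.mpr ⟨hη, by finiteness⟩)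
  refine ⟨K, hK0, fun n => (lintegral_excess_le S x hU.measurable_update (hU.isControl n)
    (hM n) K).trans ?_⟩
  calc _ ≤ (ENNReal.ofReal M + 1) * (η / (ENNReal.ofReal M + 1)) :=
        mul_le_mul' (le_add_right le_rfl) (hK n)
    _ ≤ η := ENNReal.mul_div_le

/-- The trajectories stay, with large probability, in a set of functions with a common modulus of
continuity. -/
lemma UniformlyControlled.exists_modulus (hU : UniformlyControlled S g x lam P ν Y) {M : ℝ}
    (hM : ∀ n k, k < S.β n → S.hval n k ≤ M) {η : ℝ≥0∞} (hη : η ≠ 0) :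
    ∃ K : ℕ → ℝ, (∀ j, 0 ≤ K j) ∧ ∀ n, P n {ω | ∃ j : ℕ, 1 / ((j : ℝ) + 1) ≤
      excess S g x (K j) n fun i => Y n i ω} ≤ η := by
  obtain ⟨δ, hδ, hsum⟩ := ENNReal.exists_pos_sum_of_countable' hη ℕ
  have hj : ∀ j : ℕ, 0 < ENNReal.ofReal (1 / ((j : ℝ) + 1)) := fun j =>
    ENNReal.ofReal_pos.mpr (by positivity)
  choose K hK0 hK using fun j : ℕ => hU.exists_excess_le hM
    (mul_ne_zero (hδ j).ne' (hj j).ne')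
  refine ⟨K, hK0, fun n => ?_⟩
  rw [ofPred_exists]
  refine (measure_iUnion_le _).trans ((ENNReal.tsum_le_tsum fun j => ?_).trans hsum.le)
  have hmeas : Measurable fun ω => excess S g x (K j) n fun i => Y n i ω :=
    measurable_excess S x hU.measurable_update (K j) n (hU.isControl n).measurable_noise
  have h1 := meas_ge_le_lintegral_div (μ := P n) hmeas.ennreal_ofReal.aemeasurable (hj j).ne'
    ENNReal.ofReal_ne_top
  refine (measure_mono fun ω hω => ENNReal.ofReal_le_ofReal hω).trans (h1.trans ?_)
  exact ENNReal.div_le_of_le_mul (hK j n)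

/-- Tightness of the laws of the pairs. -/
lemma UniformlyControlled.isTightMeasureSet (hT : 0 ≤ T)
    (hU : UniformlyControlled S g x lam P ν Y) {M : ℝ}
    (hM : ∀ n k, k < S.β n → S.hval n k ≤ M) :
    IsTightMeasureSet (Set.range fun n => (P n).map (ctrlPair S g x n (ν n) (Y n))) := by
  rw [isTightMeasureSet_iff_exists_isCompact_measure_compl_le]
  intro η hη
  have hη2 : η / 2 ≠ 0 := (ENNReal.half_pos hη.ne').ne'
  obtain ⟨K, hK0, hK⟩ := hU.exists_modulus hM hη2
  obtain ⟨r, hr⟩ := hU.exists_radius hη2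
  have hu : Tendsto (fun m : ℕ => 1 / ((m : ℝ≥0) + 1)) atTop (𝓝 0) :=
    tendsto_one_div_add_atTop_nhds_zero_nat
  have hcpt := isCompact_pairSpace (isCompact_setOfPred_probabilityMeasure_mass_eq_compl_isCompact_le hu
    (K := fun m => Metric.closedBall (0 : E d₂) (r m) ×ˢ (univ : Set (I T)))
    (fun m => (isCompact_closedBall _ _).prod isCompact_univ) (Or.inl inferInstance))
    (isCompact_modulus hT x hK0)
  refine ⟨_, hcpt, ?_⟩
  rintro _ ⟨n, rfl⟩
  rw [Measure.map_apply (measurable_ctrlPair S hU.measurable_update x (hU.isControl n))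
    hcpt.isClosed.measurableSet.compl]
  refine le_trans (measure_mono fun ω hω => ?_) ((measure_union_le _ _).trans
    ((add_le_add (hr n) (hK n)).trans (ENNReal.add_halves η).le))
  by_contra hcon
  rw [mem_union, not_or] at hcon
  obtain ⟨h1, h2⟩ := hcon
  simp only [mem_ofPred_eq, not_exists, not_le] at h1 h2
  refine hω ⟨fun m => ?_, interp_zero S g x hT n _, fun j s t => ?_⟩
  · rw [← ENNReal.coe_le_coe, ProbabilityMeasure.ennreal_coeFn_eq_coeFn_toMeasure]
    exact (h1 m).le
  · rw [dist_eq_norm, Subtype.dist_eq, Real.dist_eq]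
    exact (norm_interp_sub_le S g x (hK0 j) n _ s t).trans (add_le_add le_rfl (h2 j).le)

end

/-- Prokhorov's theorem in terms of random variables. -/
lemma exists_subseq_tendstoInDistribution {Z : Type*} [TopologicalSpace Z]
    [TopologicalSpace.MetrizableSpace Z] [SecondCountableTopology Z] [MeasurableSpace Z]
    [BorelSpace Z] {Ω : ℕ → Type*} [∀ n, MeasurableSpace (Ω n)] {P : ∀ n, Measure (Ω n)}
    [∀ n, IsProbabilityMeasure (P n)] {X : ∀ n, Ω n → Z} (hX : ∀ n, Measurable (X n))
    (htight : IsTightMeasureSet (Set.range fun n => (P n).map (X n))) (φ : ℕ → ℕ) :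
    ∃ ψ : ℕ → ℕ, StrictMono ψ ∧ ∃ (Q : Measure Z) (_ : IsProbabilityMeasure Q),
      TendstoInDistribution (fun j => X (φ (ψ j))) atTop id (fun j => P (φ (ψ j))) Q := by
  have hprob : ∀ n, IsProbabilityMeasure ((P n).map (X n)) := fun n =>
    Measure.isProbabilityMeasure_map (hX n).aemeasurable
  let μ : ℕ → ProbabilityMeasure Z := fun n => ⟨(P n).map (X n), hprob n⟩
  have hcpt : IsCompact (closure (Set.range μ)) := by
    refine isCompact_closure_of_isTightMeasureSet (htight.subset ?_)
    rintro _ ⟨_, ⟨n, rfl⟩, rfl⟩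
    exact ⟨n, rfl⟩
  obtain ⟨Q, -, ψ, hψ, hlim⟩ := hcpt.isSeqCompact (x := fun j => μ (φ j))
    fun j => subset_closure ⟨_, rfl⟩
  refine ⟨ψ, hψ, Q, inferInstance, fun j => (hX _).aemeasurable, aemeasurable_id, ?_⟩
  have hQ : (⟨(Q : Measure Z).map id, Measure.isProbabilityMeasure_map aemeasurable_id⟩ :
      ProbabilityMeasure Z) = Q := Subtype.ext Measure.map_id
  rw [hQ]
  exact hlim

/-! ### Martingale fluctuations -/

lemma measurable_integral_measure {Ω V W : Type*} {m : MeasurableSpace Ω} [MeasurableSpace V]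
    [MeasurableSpace W] {κ : Ω → Measure W} (hκ : Measurable κ) [∀ ω, IsProbabilityMeasure (κ ω)]
    {X : Ω → V} (hX : Measurable X) {b : V → W → ℝ} (hb : Measurable (Function.uncurry b)) :
    Measurable fun ω => ∫ z, b (X ω) z ∂κ ω := by
  let k : Kernel Ω W := ⟨κ, hκ⟩
  have : IsMarkovKernel k := ⟨fun ω => inferInstanceAs (IsProbabilityMeasure (κ ω))⟩
  have h1 : StronglyMeasurable fun p : Ω × W => b (X p.1) p.2 :=
    (hb.comp ((hX.comp measurable_fst).prodMk measurable_snd)).stronglyMeasurable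
  exact (h1.integral_kernel_prod_right' (κ := k)).measurable

lemma IsControl.measurable_control {d₂ : ℕ} {Ω : Type*} [MeasurableSpace Ω] {P : Measure Ω}
    {ν : ℕ → Kernel Ω (E d₂)} {Y : ℕ → Ω → E d₂} {N : ℕ} (hν : IsControl P N ν Y) {k : ℕ}
    (hk : k < N) : Measurable[pastSigma Y k] fun ω => ν k ω :=
  Measure.measurable_of_measurable_coe _ fun A hA => hν.adapted k hk A hA

lemma pastSigma_mono {d₂ : ℕ} {Ω : Type*} (Y : ℕ → Ω → E d₂) {j k : ℕ} (hjk : j ≤ k) :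
    pastSigma Y j ≤ pastSigma Y k :=
  iSup₂_le fun i hi => le_iSup₂_of_le i
    (Finset.mem_range.mpr ((Finset.mem_range.mp hi).trans_le hjk)) le_rfl

lemma abs_integral_le_of_prob {W : Type*} [MeasurableSpace W] {μ : Measure W}
    [IsProbabilityMeasure μ] {f : W → ℝ} {K : ℝ} (hf : ∀ z, |f z| ≤ K) : |∫ z, f z ∂μ| ≤ K := by
  have := norm_integral_le_of_norm_le_const (μ := μ) (f := f) (C := K) (ae_of_all _ hf)
  simpa using this

section Martingale

variable {d₁ d₂ : ℕ} {T : ℝ} {Ω : Type*} [MeasurableSpace Ω] {P : Measure Ω}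
  {ν : ℕ → Kernel Ω (E d₂)} [∀ k, IsMarkovKernel (ν k)] {Y : ℕ → Ω → E d₂}
  (S : StepSizes T) {g : E d₁ → E d₂ → E d₁} (x : E d₁) {n : ℕ}

/-- The weighted sum of the differences between `b(X_i, Y_i)` and its conditional expectation given
the past. -/
def fluctuation (g : E d₁ → E d₂ → E d₁) (n : ℕ) (ν : ℕ → Kernel Ω (E d₂)) (Y : ℕ → Ω → E d₂)
    (b : E d₁ → E d₂ → ℝ) (c : ℕ → ℝ) (m : ℕ) (ω : Ω) : ℝ :=
  ∑ k ∈ Finset.range m, c k * (b (path S g x n (fun j => Y j ω) k) (Y k ω) -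
    ∫ z, b (path S g x n (fun j => Y j ω) k) z ∂ν k ω)

variable {b : E d₁ → E d₂ → ℝ} {K : ℝ} {c : ℕ → ℝ}

lemma measurable_mean (hg : Measurable (Function.uncurry g)) (hb : Measurable (Function.uncurry b))
    {N : ℕ} (hν : IsControl P N ν Y) {k : ℕ} (hk : k < N) :
    Measurable[pastSigma Y k] fun ω =>
      ∫ z, b (path S g x n (fun j => Y j ω) k) z ∂ν k ω :=
  measurable_integral_measure (m := pastSigma Y k) (hν.measurable_control hk)
    (measurable_path_past S hg x n k) hb

lemma measurable_fluctuation (hg : Measurable (Function.uncurry g))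
    (hb : Measurable (Function.uncurry b)) {N : ℕ} (hν : IsControl P N ν Y) {m : ℕ} (hm : m ≤ N) :
    Measurable[pastSigma Y m] (fluctuation S x g n ν Y b c m) := by
  refine Finset.measurable_fun_sum _ fun k hk => ?_
  have hk' := Finset.mem_range.mp hk
  have h1 : Measurable[pastSigma Y m] fun ω => path S g x n (fun j => Y j ω) k :=
    measurable_path (m := pastSigma Y m) S x hg n fun j hj => measurable_past (hj.trans hk')
  have h2 : Measurable[pastSigma Y m] fun ω => b (path S g x n (fun j => Y j ω) k) (Y k ω) :=
    hb.comp (h1.prodMk (measurable_past hk'))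
  have h3 : Measurable[pastSigma Y m] fun ω =>
      ∫ z, b (path S g x n (fun j => Y j ω) k) z ∂ν k ω :=
    (measurable_mean S x hg hb hν (hk'.trans_le hm)).mono (pastSigma_mono Y hk'.le) le_rfl
  exact (h2.sub h3).const_mul (c k)

lemma abs_fluctuation_le (hK : ∀ a z, |b a z| ≤ K) (m : ℕ) (ω : Ω) :
    |fluctuation S x g n ν Y b c m ω| ≤ ∑ k ∈ Finset.range m, |c k| * (2 * K) := by
  refine (Finset.abs_sum_le_sum_abs _ _).trans (Finset.sum_le_sum fun k _ => ?_)
  rw [abs_mul]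
  refine mul_le_mul_of_nonneg_left ((abs_sub _ _).trans ?_) (abs_nonneg _)
  have h1 := hK (path S g x n (fun j => Y j ω) k) (Y k ω)
  have h2 := abs_integral_le_of_prob (μ := ν k ω) (hK (path S g x n (fun j => Y j ω) k))
  linarith

variable [IsProbabilityMeasure P]

/-- The increments of the fluctuations are orthogonal in `L²`. -/
lemma integral_fluctuation_sq_le (hg : Measurable (Function.uncurry g))
    (hb : Measurable (Function.uncurry b)) (hK : ∀ a z, |b a z| ≤ K) {N : ℕ}
    (hν : IsControl P N ν Y) {m : ℕ} (hm : m ≤ N) :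
    ∫ ω, fluctuation S x g n ν Y b c m ω ^ 2 ∂P ≤ ∑ k ∈ Finset.range m, (c k * (2 * K)) ^ 2 := by
  induction m with
  | zero => simp [fluctuation]
  | succ m ih =>
    have hmN : m < N := hm
    set L := ∑ k ∈ Finset.range m, |c k| * (2 * K) with hL
    set Sm := fluctuation S x g n ν Y b c m with hSm
    have hSmP : Measurable[pastSigma Y m] Sm := measurable_fluctuation S x hg hb hν hmN.le
    have hSmM : Measurable Sm := hSmP.mono (hν.pastSigma_le hmN.le) le_rfl
    have hSmL : ∀ ω, |Sm ω| ≤ L := abs_fluctuation_le S x hK m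
    have hX : Measurable[pastSigma Y m] fun ω => path S g x n (fun j => Y j ω) m :=
      measurable_path_past S hg x n m
    have hXM := hX.mono (hν.pastSigma_le hmN.le) le_rfl
    have hB : Measurable fun ω => b (path S g x n (fun j => Y j ω) m) (Y m ω) :=
      hb.comp (hXM.prodMk (hν.measurable_noise m hmN))
    have hAv : Measurable fun ω => ∫ z, b (path S g x n (fun j => Y j ω) m) z ∂ν m ω :=
      (measurable_mean S x hg hb hν hmN).mono (hν.pastSigma_le hmN.le) le_rfl
    set B : Ω → ℝ := fun ω => b (path S g x n (fun j => Y j ω) m) (Y m ω) with hBdef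
    set Av : Ω → ℝ := fun ω => ∫ z, b (path S g x n (fun j => Y j ω) m) z ∂ν m ω with hAvdef
    have hBK : ∀ ω, |B ω| ≤ K := fun ω => hK _ _
    have hAK : ∀ ω, |Av ω| ≤ K := fun ω => abs_integral_le_of_prob (hK _)
    have hbdd : ∀ {f : Ω → ℝ} {C : ℝ}, Measurable f → (∀ ω, |f ω| ≤ C) → Integrable f P :=
      fun hf hC => Integrable.of_bound hf.aestronglyMeasurable _ (ae_of_all _ hC)
    have hSB : ∀ {u : Ω → ℝ}, (∀ ω, |u ω| ≤ K) → ∀ ω, |Sm ω * u ω| ≤ L * K := fun hu ω => by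
      rw [abs_mul]
      exact mul_le_mul (hSmL ω) (hu ω) (abs_nonneg _) ((abs_nonneg _).trans (hSmL ω))
    have horth : ∫ ω, Sm ω * B ω ∂P = ∫ ω, Sm ω * Av ω ∂P := by
      have h1 := hν.integral_comp hmN (U := fun ω => (Sm ω, path S g x n (fun j => Y j ω) m))
        (hSmP.prodMk hX) (F := fun u z => u.1 * b u.2 z)
        ((measurable_fst.comp measurable_fst).mul
          (hb.comp ((measurable_snd.comp measurable_fst).prodMk measurable_snd))) (C := L * K)
        (fun ω z => by
          rw [abs_mul]
          exact mul_le_mul (hSmL ω) (hK _ _) (abs_nonneg _) ((abs_nonneg _).trans (hSmL ω)))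
      refine h1.trans (integral_congr_ae (ae_of_all _ fun ω => ?_))
      exact integral_const_mul _ _
    have hexp : ∀ ω, fluctuation S x g n ν Y b c (m + 1) ω ^ 2 =
        Sm ω ^ 2 + 2 * c m * (Sm ω * B ω - Sm ω * Av ω) + (c m * (B ω - Av ω)) ^ 2 := by
      intro ω
      rw [fluctuation, Finset.sum_range_succ, ← fluctuation]
      simp only [hSm, hBdef, hAvdef]
      ring
    have hi1 : Integrable (fun ω => Sm ω ^ 2) P := hbdd (hSmM.pow_const 2) (C := L ^ 2) fun ω => by
      rw [abs_pow]
      exact pow_le_pow_left₀ (abs_nonneg _) (hSmL ω) 2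
    have hi2 : Integrable (fun ω => Sm ω * B ω) P := hbdd (hSmM.mul hB) (hSB hBK)
    have hi3 : Integrable (fun ω => Sm ω * Av ω) P := hbdd (hSmM.mul hAv) (hSB hAK)
    have hD : ∀ ω, (c m * (B ω - Av ω)) ^ 2 ≤ (c m * (2 * K)) ^ 2 := fun ω => by
      rw [mul_pow, mul_pow]
      refine mul_le_mul_of_nonneg_left (sq_le_sq.mpr ((abs_sub _ _).trans ?_)) (sq_nonneg _)
      have hK0 : 0 ≤ K := (abs_nonneg _).trans (hBK ω)
      rw [abs_of_nonneg (by positivity : (0 : ℝ) ≤ 2 * K)]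
      linarith [hBK ω, hAK ω]
    have hi4 : Integrable (fun ω => (c m * (B ω - Av ω)) ^ 2) P :=
      hbdd (((hB.sub hAv).const_mul (c m)).pow_const 2) fun ω => by
        rw [abs_of_nonneg (sq_nonneg _)]
        exact hD ω
    have hi5 : Integrable (fun ω => 2 * c m * (Sm ω * B ω - Sm ω * Av ω)) P :=
      (hi2.sub hi3).const_mul _
    have hi6 : Integrable (fun ω => Sm ω ^ 2 + 2 * c m * (Sm ω * B ω - Sm ω * Av ω)) P :=
      hi1.add hi5
    simp_rw [hexp]
    rw [integral_add hi6 hi4, integral_add hi1 hi5, integral_const_mul, integral_sub hi2 hi3, horth,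
      sub_self, mul_zero, add_zero, Finset.sum_range_succ]
    refine add_le_add (ih hmN.le) ?_
    have h5 := integral_mono hi4 (integrable_const ((c m * (2 * K)) ^ 2)) hD
    simpa using h5

/-- With small weights the fluctuations are small. -/
lemma lintegral_abs_fluctuation_le (hg : Measurable (Function.uncurry g))
    (hb : Measurable (Function.uncurry b)) (hK : ∀ a z, |b a z| ≤ K)
    (hν : IsControl P (S.β n) ν Y) (hc : ∀ k, |c k| ≤ S.ε (n + k)) {q : ℝ} (hq : 0 < q)
    (hε : ∀ i, n ≤ i → S.ε i ≤ q ^ 2) :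
    ∫⁻ ω, ENNReal.ofReal |fluctuation S x g n ν Y b c (S.β n) ω| ∂P ≤
      ENNReal.ofReal ((4 * K ^ 2 * T + 1) * q) := by
  set F := fluctuation S x g n ν Y b c (S.β n) with hF
  have hFM : Measurable F :=
    (measurable_fluctuation S x hg hb hν le_rfl).mono (hν.pastSigma_le le_rfl) le_rfl
  set L := ∑ k ∈ Finset.range (S.β n), |c k| * (2 * K)
  have hFL : ∀ ω, |F ω| ≤ L := abs_fluctuation_le S x hK _
  have hi1 : Integrable (fun ω => |F ω|) P :=
    Integrable.of_bound hFM.abs.aestronglyMeasurable L (ae_of_all _ fun ω => by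
      simpa using hFL ω)
  have hi2 : Integrable (fun ω => F ω ^ 2) P :=
    Integrable.of_bound (hFM.pow_const 2).aestronglyMeasurable (L ^ 2) (ae_of_all _ fun ω => by
      rw [Real.norm_eq_abs, abs_pow]
      exact pow_le_pow_left₀ (abs_nonneg _) (hFL ω) 2)
  rw [← ofReal_integral_eq_lintegral_ofReal hi1 (ae_of_all _ fun _ => abs_nonneg _)]
  refine ENNReal.ofReal_le_ofReal ?_
  have h1 : ∀ ω, |F ω| ≤ F ω ^ 2 / q + q := fun ω => by
    rw [← sq_abs, div_add' _ _ _ hq.ne', le_div_iff₀ hq]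
    nlinarith [sq_nonneg (|F ω| - q), abs_nonneg (F ω)]
  have h2 := integral_fluctuation_sq_le (c := c) (n := n) S x hg hb hK hν le_rfl
  have h3 : ∑ k ∈ Finset.range (S.β n), (c k * (2 * K)) ^ 2 ≤ q ^ 2 * (4 * K ^ 2 * T) := by
    calc ∑ k ∈ Finset.range (S.β n), (c k * (2 * K)) ^ 2
        ≤ ∑ k ∈ Finset.range (S.β n), q ^ 2 * (4 * K ^ 2) * S.ε (n + k) := by
          refine Finset.sum_le_sum fun k _ => ?_
          have h4 : c k ^ 2 ≤ q ^ 2 * S.ε (n + k) := by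
            rw [← sq_abs, sq]
            exact mul_le_mul ((hc k).trans (hε _ (Nat.le_add_right _ _))) (hc k) (abs_nonneg _)
              (sq_nonneg _)
          nlinarith [sq_nonneg K]
      _ = q ^ 2 * (4 * K ^ 2) * S.τ n (S.β n) := by
          rw [← Finset.mul_sum, S.sum_eps_eq]
      _ ≤ q ^ 2 * (4 * K ^ 2) * T := by
          gcongr
          exact S.τ_β_le n
      _ = _ := by ring
  calc ∫ ω, |F ω| ∂P ≤ ∫ ω, (F ω ^ 2 / q + q) ∂P :=
        integral_mono hi1 ((hi2.div_const q).add (integrable_const q)) h1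
    _ = (∫ ω, F ω ^ 2 ∂P) / q + q := by
        rw [integral_add (hi2.div_const q) (integrable_const q), integral_div]
        simp
    _ ≤ q ^ 2 * (4 * K ^ 2 * T) / q + q := by
        gcongr
        exact h2.trans h3
    _ = _ := by field_simp

end Martingale

/-! ### The integral equation before the limit -/

/-- The `j`-th component of the update, truncated at level `K`. -/
def truncUpdate {d₁ d₂ : ℕ} (g : E d₁ → E d₂ → E d₁) (K : ℝ) (j : Fin d₁) (a : E d₁) (z : E d₂) :
    ℝ := max (-K) (min K (g a z j))

lemma abs_truncUpdate_le {d₁ d₂ : ℕ} (g : E d₁ → E d₂ → E d₁) {K : ℝ} (hK : 0 ≤ K) (j : Fin d₁)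
    (a : E d₁) (z : E d₂) : |truncUpdate g K j a z| ≤ K :=
  abs_le.mpr ⟨le_max_left _ _, max_le (by linarith) (min_le_left _ _)⟩

lemma abs_sub_truncUpdate_le {d₁ d₂ : ℕ} (g : E d₁ → E d₂ → E d₁) {K : ℝ} (hK : 0 ≤ K)
    (j : Fin d₁) (a : E d₁) (z : E d₂) :
    |g a z j - truncUpdate g K j a z| ≤ max (‖g a z‖ - K) 0 := by
  have h1 : |g a z j| ≤ ‖g a z‖ := PiLp.norm_apply_le (g a z) j
  have h2 := abs_le.mp h1
  rw [truncUpdate, abs_le]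
  simp only [max_def, min_def]
  split_ifs <;> constructor <;> linarith

lemma measurable_truncUpdate {d₁ d₂ : ℕ} {g : E d₁ → E d₂ → E d₁}
    (hg : Measurable (Function.uncurry g)) (K : ℝ) (j : Fin d₁) :
    Measurable (Function.uncurry (truncUpdate g K j)) := by
  have h1 : Measurable fun p : E d₁ × E d₂ => Function.uncurry g p j :=
    (EuclideanSpace.proj (𝕜 := ℝ) j).continuous.measurable.comp hg
  exact measurable_const.max (measurable_const.min h1)

section

variable {d₁ d₂ : ℕ} {T : ℝ} (S : StepSizes T)

lemma integral_occMeasure (n : ℕ) (m : ℕ → Measure (E d₂)) [∀ k, IsProbabilityMeasure (m k)]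
    {F : E d₂ × I T → ℝ} (hF : Measurable F) {C : ℝ} (hC : ∀ p, |F p| ≤ C) :
    ∫ p, F p ∂occMeasure S n m = ∑ k ∈ Finset.range (S.β n), 1 / S.hval n k *
      ∫ s in S.cell n k, ∫ z, F (z, s) ∂m k ∂leb T := by
  have hint : ∀ k, Integrable F ((m k).prod ((leb T).restrict (S.cell n k))) := fun k =>
    Integrable.of_bound hF.aestronglyMeasurable C (ae_of_all _ hC)
  rw [occMeasure, integral_finsetSum_measure fun k _ => (hint k).smul_measure ENNReal.ofReal_ne_top]
  refine Finset.sum_congr rfl fun k _ => ?_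
  rw [integral_smul_measure, integral_prod_symm _ (hint k), smul_eq_mul, ENNReal.toReal_ofReal
    (one_div_nonneg.mpr (S.hval_pos n k).le)]

/-- The part of a cell before time `t` has length `ε` times the completed fraction of the step. -/
lemma leb_cell_inter_Iic {n k : ℕ} (t : I T) :
    (leb T).real (S.cell n k ∩ Iic t) = frac S n k t * S.ε (n + k) := by
  have himg : (Subtype.val : I T → ℝ) '' (S.cell n k ∩ Iic t) =
      Ico (S.τ n k) (S.τ n (k + 1)) ∩ Iic (t : ℝ) := by
    ext s
    constructor
    · rintro ⟨s', hs', rfl⟩; exact hs'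
    · intro hs
      exact ⟨⟨s, (S.τ_nonneg n k).trans hs.1.1, hs.2.trans t.2.2⟩, hs, rfl⟩
  have hvol : volume (Ico (S.τ n k) (S.τ n (k + 1)) ∩ Iic (t : ℝ)) =
      volume (Ioc (S.τ n k) (S.τ n (k + 1)) ∩ Iic (t : ℝ)) :=
    measure_congr (Ico_ae_eq_Ioc.inter (ae_eq_refl _))
  rw [Measure.real, leb, comap_subtype_coe_apply measurableSet_Icc, himg, hvol, Ioc_inter_Iic,
    Real.volume_Ioc, frac_mul_eps, ENNReal.toReal_ofReal']
  have := S.τ_mono n (Nat.le_succ k)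
  simp only [max_def, min_def]
  split_ifs <;> linarith

/-- The weight of the `k`-th cell before time `t`, computed with an approximate profile. -/
lemma abs_weight_sub_le {n k : ℕ} (hk : k < S.β n) {h₀ : I T → ℝ} (hm : Measurable h₀) {C : ℝ}
    (hC : ∀ s, |h₀ s| ≤ C) {c δ : ℝ} (hc : 0 < c) (hck : c ≤ S.hval n k)
    (hδ : ∀ s ∈ S.cell n k, |S.hval n k - h₀ s| ≤ δ) (t : I T) :
    |1 / S.hval n k * ∫ s in S.cell n k, (Iic t).indicator h₀ s ∂leb T -
      frac S n k t * S.ε (n + k)| ≤ δ / c * S.ε (n + k) := by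
  have hv := S.hval_pos n k
  have hδ0 : 0 ≤ δ := by
    have h1 : (leb T) (S.cell n k) ≠ 0 := by
      rw [S.volume_cell n k hk]; simpa using S.pos _
    obtain ⟨s, hs⟩ := nonempty_of_measure_ne_zero h1
    exact (abs_nonneg _).trans (hδ s hs)
  have hfin : ∀ f : I T → ℝ, Measurable f → (∃ D, ∀ s, |f s| ≤ D) →
      Integrable f ((leb T).restrict (S.cell n k)) := fun f hf ⟨D, hD⟩ =>
    Integrable.of_bound hf.aestronglyMeasurable D (ae_of_all _ hD)
  have h1 : frac S n k t * S.ε (n + k) =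
      1 / S.hval n k * ∫ s in S.cell n k, (Iic t).indicator (fun _ => S.hval n k) s ∂leb T := by
    rw [integral_indicator measurableSet_Iic, setIntegral_const, smul_eq_mul,
      measureReal_restrict_apply measurableSet_Iic, inter_comm, leb_cell_inter_Iic S]
    field_simp
  have hC0 : 0 ≤ C := (abs_nonneg _).trans (hC t)
  rw [h1, ← mul_sub, ← integral_sub]
  rotate_left
  · refine hfin _ (hm.indicator measurableSet_Iic) ⟨C, fun s => ?_⟩
    by_cases hs : s ∈ Iic t
    · rw [indicator_of_mem hs]; exact hC s
    · rw [indicator_of_notMem hs, abs_zero]; exact hC0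
  · refine hfin _ (measurable_const.indicator measurableSet_Iic) ⟨S.hval n k, fun s => ?_⟩
    by_cases hs : s ∈ Iic t
    · rw [indicator_of_mem hs, abs_of_pos hv]
    · rw [indicator_of_notMem hs, abs_zero]; exact hv.le
  rw [abs_mul, abs_of_pos (one_div_pos.mpr hv)]
  have h2 := norm_setIntegral_le_of_norm_le_const (μ := leb T) (s := S.cell n k)
    (f := fun s => (Iic t).indicator h₀ s - (Iic t).indicator (fun _ => S.hval n k) s) (C := δ)
    (by finiteness) fun s hs => by
      by_cases hst : s ∈ Iic t
      · rw [indicator_of_mem hst, indicator_of_mem hst, Real.norm_eq_abs, abs_sub_comm]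
        exact hδ s hs
      · rw [indicator_of_notMem hst, indicator_of_notMem hst, sub_zero, norm_zero]
        exact hδ0
  rw [Measure.real, S.volume_cell n k hk, ENNReal.toReal_ofReal (S.pos _).le,
    Real.norm_eq_abs] at h2
  have hε := S.pos (n + k)
  calc _ ≤ 1 / S.hval n k * (δ * S.ε (n + k)) :=
        mul_le_mul_of_nonneg_left h2 (one_div_nonneg.mpr hv.le)
    _ ≤ 1 / c * (δ * S.ε (n + k)) := by gcongr
    _ = _ := by ring

variable {g : E d₁ → E d₂ → E d₁} (x : E d₁)

/-- The integrand `1_{s ≤ t} h₀(s) b(X(s), z)`, whose integral against the control measure is the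
time integral of `b` up to time `t`. -/
def driftIntegrand (h₀ : I T → ℝ) (t : I T) (b : E d₁ → E d₂ → ℝ) (a : E d₁) (p : E d₂ × I T) :
    ℝ := (Iic t).indicator h₀ p.2 * b a p.1

lemma measurable_driftIntegrand {h₀ : I T → ℝ} (hm : Measurable h₀) (t : I T)
    {b : E d₁ → E d₂ → ℝ} (hb : Measurable (Function.uncurry b)) :
    Measurable (Function.uncurry (driftIntegrand h₀ t b)) :=
  ((hm.indicator measurableSet_Iic).comp (measurable_snd.comp measurable_snd)).mul
    (hb.comp (measurable_fst.prodMk (measurable_fst.comp measurable_snd)))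

lemma abs_driftIntegrand_le {h₀ : I T → ℝ} {C : ℝ} (hC : ∀ s, |h₀ s| ≤ C) (t : I T)
    {b : E d₁ → E d₂ → ℝ} {K : ℝ} (hK : ∀ a z, |b a z| ≤ K) (a : E d₁) (p : E d₂ × I T) :
    |driftIntegrand h₀ t b a p| ≤ C * K := by
  have hC0 : 0 ≤ C := (abs_nonneg _).trans (hC t)
  rw [driftIntegrand, abs_mul]
  refine mul_le_mul ?_ (hK _ _) (abs_nonneg _) hC0
  by_cases hs : p.2 ∈ Iic t
  · rw [indicator_of_mem hs]; exact hC _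
  · rw [indicator_of_notMem hs, abs_zero]; exact hC0

/-- Against the control measure, `driftIntegrand` gives a weighted sum of conditional means; the
weights approximate the parts of the steps before time `t`. -/
lemma integral_occ_drift {Ω : Type*} [MeasurableSpace Ω] {ν : ℕ → Kernel Ω (E d₂)}
    [∀ k, IsMarkovKernel (ν k)] (y : ℕ → E d₂) {n : ℕ}
    {h₀ : I T → ℝ} (hm : Measurable h₀) {C : ℝ}
    (hC : ∀ s, |h₀ s| ≤ C) (t : I T) {b : E d₁ → E d₂ → ℝ} (hb : Measurable (Function.uncurry b))
    {K : ℝ} (hK : ∀ a z, |b a z| ≤ K) (ω : Ω) :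
    ∫ p, driftIntegrand h₀ t b (stepPath S g x n y p.2) p ∂occ S n ν ω =
      ∑ k ∈ Finset.range (S.β n), (1 / S.hval n k *
        ∫ s in S.cell n k, (Iic t).indicator h₀ s ∂leb T) *
          ∫ z, b (path S g x n y k) z ∂ν k ω := by
  have hF : Measurable fun p : E d₂ × I T => driftIntegrand h₀ t b (stepPath S g x n y p.2) p :=
    (measurable_driftIntegrand hm t hb).comp
      (((measurable_stepPath S g x n y).comp measurable_snd).prodMk measurable_id)
  rw [occ, integral_occMeasure S n _ hF fun p => abs_driftIntegrand_le hC t hK _ _]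
  refine Finset.sum_congr rfl fun k hk => ?_
  rw [mul_assoc, ← integral_mul_const]
  congr 1
  refine setIntegral_congr_fun (S.measurableSet_cell n k) fun s hs => ?_
  simp only [driftIntegrand]
  rw [stepPath_of_mem S g x y (Finset.mem_range.mp hk) hs, integral_const_mul]

variable {Ω : Type*} [MeasurableSpace Ω] {P : Measure Ω} [IsProbabilityMeasure P]
  {ν : ℕ → Kernel Ω (E d₂)} [∀ k, IsMarkovKernel (ν k)] {Y : ℕ → Ω → E d₂} {n : ℕ}

/-- The increments of the trajectory agree with the drift under the control measure, up to the
excess over the truncation level, the martingale fluctuations and the error of the profile. -/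
lemma abs_interp_sub_drift_le {h₀ : I T → ℝ} (hm : Measurable h₀) {C : ℝ}
    (hC : ∀ s, |h₀ s| ≤ C) (hg : Measurable (Function.uncurry g)) {K c δ : ℝ} (hK : 0 ≤ K)
    (hc : 0 < c) (hck : ∀ k, k < S.β n → c ≤ S.hval n k)
    (hδ : ∀ k, k < S.β n → ∀ s ∈ S.cell n k, |S.hval n k - h₀ s| ≤ δ) (t : I T) (j : Fin d₁)
    (ω : Ω) :
    |interp S g x n (fun i => Y i ω) t j - x j -
      ∫ p, driftIntegrand h₀ t (truncUpdate g K j) (stepPath S g x n (fun i => Y i ω) p.2) p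
        ∂occ S n ν ω| ≤ excess S g x K n (fun i => Y i ω) +
      |fluctuation S x g n ν Y (truncUpdate g K j) (fun k => frac S n k t * S.ε (n + k))
        (S.β n) ω| + δ / c * T * K := by
  set y : ℕ → E d₂ := fun i => Y i ω with hy
  set b := truncUpdate g K j with hb
  have hbm : Measurable (Function.uncurry b) := measurable_truncUpdate hg K j
  have hbK : ∀ a z, |b a z| ≤ K := abs_truncUpdate_le g hK j
  rw [integral_occ_drift S x y hm hC t hbm hbK ω]
  set w : ℕ → ℝ := fun k => 1 / S.hval n k *
    ∫ s in S.cell n k, (Iic t).indicator h₀ s ∂leb T with hw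
  set c' : ℕ → ℝ := fun k => frac S n k t * S.ε (n + k) with hc'
  set av : ℕ → ℝ := fun k => ∫ z, b (path S g x n y k) z ∂ν k ω with hav
  have hint : interp S g x n y t j - x j =
      ∑ k ∈ Finset.range (S.β n), c' k * g (path S g x n y k) (y k) j := by
    rw [interp_apply]
    simp [hc']
  have hsplit : interp S g x n y t j - x j - ∑ k ∈ Finset.range (S.β n), w k * av k =
      ∑ k ∈ Finset.range (S.β n),
        c' k * (g (path S g x n y k) (y k) j - b (path S g x n y k) (y k)) +
      fluctuation S x g n ν Y b c' (S.β n) ω -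
      ∑ k ∈ Finset.range (S.β n), (w k - c' k) * av k := by
    rw [hint, fluctuation, ← Finset.sum_add_distrib, ← Finset.sum_sub_distrib,
      ← Finset.sum_sub_distrib]
    refine Finset.sum_congr rfl fun k _ => ?_
    simp only [hav, hy]
    ring
  rw [hsplit]
  refine (abs_sub _ _).trans (add_le_add ((abs_add_le _ _).trans (add_le_add ?_ le_rfl)) ?_)
  · refine (Finset.abs_sum_le_sum_abs _ _).trans (Finset.sum_le_sum fun k _ => ?_)
    have hε := S.pos (n + k)
    rw [abs_mul, abs_of_nonneg (mul_nonneg (frac_nonneg S n k t) hε.le)]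
    refine mul_le_mul ?_ (abs_sub_truncUpdate_le g hK j _ _) (abs_nonneg _) hε.le
    simpa using mul_le_mul_of_nonneg_right (frac_le_one S n k t) hε.le
  · calc |∑ k ∈ Finset.range (S.β n), (w k - c' k) * av k|
        ≤ ∑ k ∈ Finset.range (S.β n), δ / c * S.ε (n + k) * K := by
          refine (Finset.abs_sum_le_sum_abs _ _).trans (Finset.sum_le_sum fun k hk => ?_)
          have hk' := Finset.mem_range.mp hk
          have h1 := abs_weight_sub_le S hk' hm hC hc (hck k hk') (hδ k hk') t
          rw [abs_mul]
          exact mul_le_mul h1 (abs_integral_le_of_prob (hbK _)) (abs_nonneg _)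
            ((abs_nonneg _).trans h1)
      _ = δ / c * S.τ n (S.β n) * K := by
          rw [← Finset.sum_mul, ← Finset.mul_sum, S.sum_eps_eq]
      _ ≤ δ / c * T * K := by
          have h0 : 0 ≤ δ := by
            have h1 := S.beta_pos n
            have h2 : (leb T) (S.cell n 0) ≠ 0 := by
              rw [S.volume_cell n 0 h1]; simpa using S.pos _
            obtain ⟨s, hs⟩ := nonempty_of_measure_ne_zero h2
            exact (abs_nonneg _).trans (hδ 0 h1 s hs)
          have := S.τ_β_le n
          gcongr

end

section

variable {d₁ d₂ : ℕ} {T : ℝ} {S : StepSizes T} {g : E d₁ → E d₂ → E d₁} {x : E d₁}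
  {lam : Measure (E d₂)} {Ω : ℕ → Type*} [∀ n, MeasurableSpace (Ω n)] {P : ∀ n, Measure (Ω n)}
  [∀ n, IsProbabilityMeasure (P n)]
  {ν : ∀ n, ℕ → Kernel (Ω n) (E d₂)} [∀ n k, IsMarkovKernel (ν n k)] {Y : ∀ n, ℕ → Ω n → E d₂}

/-- The integral equation holds approximately before the limit. -/
lemma UniformlyControlled.eventually_drift_le (hT : 0 ≤ T)
    (hU : UniformlyControlled S g x lam P ν Y) {c M : ℝ} (hc : 0 < c)
    (hb : ∀ n k, k < S.β n → c ≤ S.hval n k ∧ S.hval n k ≤ M) {h₀ : I T → ℝ} (hm : Measurable h₀)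
    {C : ℝ} (hC : ∀ s, |h₀ s| ≤ C) (hh : S.ProfileTendsto h₀) {K : ℝ} (hK : 0 ≤ K) (t : I T)
    (j : Fin d₁) {η : ℝ} (hη : 0 < η) :
    ∀ᶠ n in atTop, ∫⁻ ω, ENNReal.ofReal |interp S g x n (fun i => Y n i ω) t j - x j -
      ∫ p, driftIntegrand h₀ t (truncUpdate g K j) (stepPath S g x n (fun i => Y n i ω) p.2) p
        ∂occ S n (ν n) ω| ∂P n ≤
      (∫⁻ ω, ENNReal.ofReal (excess S g x K n fun i => Y n i ω) ∂P n) + ENNReal.ofReal η := by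
  -- the size of the steps and the error of the profile
  obtain ⟨q, hq, hqη⟩ : ∃ q : ℝ, 0 < q ∧ (4 * K ^ 2 * T + 1) * q ≤ η / 2 :=
    ⟨η / 2 / (4 * K ^ 2 * T + 1), by positivity, (mul_div_cancel₀ _ (by positivity)).le⟩
  obtain ⟨δ, hδ, hδη⟩ : ∃ δ : ℝ, 0 < δ ∧ δ / c * T * K ≤ η / 2 := by
    refine ⟨η / 2 * c / (T * K + 1), by positivity, ?_⟩
    rw [show η / 2 * c / (T * K + 1) / c * T * K = η / 2 * (T * K / (T * K + 1)) by field_simp]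
    exact mul_le_of_le_one_right (by positivity) ((div_le_one (by positivity)).mpr (by linarith))
  obtain ⟨N, hN⟩ := S.eventually_small (pow_pos hq 2)
  filter_upwards [hh δ hδ, eventually_ge_atTop N] with n hn hnN
  have hε : ∀ i, n ≤ i → S.ε i ≤ q ^ 2 := fun i hi => (hN i (hnN.trans hi)).le
  have hbound := fun ω => abs_interp_sub_drift_le (ν := ν n) (Y := Y n) (n := n) S x hm hC
    hU.measurable_update hK hc (fun k hk => (hb n k hk).1) (fun k hk s hs => (hn k hk s hs).le) t j
    ω
  have hbm := measurable_truncUpdate hU.measurable_update K j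
  have hcν := hU.isControl n
  have hF : Measurable fun ω => ENNReal.ofReal |fluctuation S x g n (ν n) (Y n)
      (truncUpdate g K j) (fun k => frac S n k t * S.ε (n + k)) (S.β n) ω| :=
    ((measurable_fluctuation S x hU.measurable_update hbm hcν le_rfl).mono
      (hcν.pastSigma_le le_rfl) le_rfl).abs.ennreal_ofReal
  have hF' : Measurable fun ω => ENNReal.ofReal |fluctuation S x g n (ν n) (Y n)
      (truncUpdate g K j) (fun k => frac S n k t * S.ε (n + k)) (S.β n) ω| +
      ENNReal.ofReal (η / 2) := hF.add_const _
  calc _ ≤ ∫⁻ ω, (ENNReal.ofReal (excess S g x K n fun i => Y n i ω) +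
          (ENNReal.ofReal |fluctuation S x g n (ν n) (Y n) (truncUpdate g K j)
            (fun k => frac S n k t * S.ε (n + k)) (S.β n) ω| + ENNReal.ofReal (η / 2))) ∂P n := by
        refine lintegral_mono fun ω => (ENNReal.ofReal_le_ofReal (hbound ω)).trans ?_
        rw [add_assoc]
        refine ENNReal.ofReal_add_le.trans (add_le_add le_rfl (ENNReal.ofReal_add_le.trans
          (add_le_add le_rfl (ENNReal.ofReal_le_ofReal hδη))))
    _ ≤ (∫⁻ ω, ENNReal.ofReal (excess S g x K n fun i => Y n i ω) ∂P n) +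
          (ENNReal.ofReal (η / 2) + ENNReal.ofReal (η / 2)) := by
        rw [lintegral_add_right _ hF', lintegral_add_left hF,
          lintegral_const, measure_univ, mul_one]
        refine add_le_add le_rfl (add_le_add ?_ le_rfl)
        refine (lintegral_abs_fluctuation_le S x hU.measurable_update hbm
          (abs_truncUpdate_le g hK j) hcν (fun k => ?_) hq hε).trans (ENNReal.ofReal_le_ofReal hqη)
        rw [abs_of_nonneg (mul_nonneg (frac_nonneg S n k t) (S.pos _).le)]
        simpa using mul_le_mul_of_nonneg_right (frac_le_one S n k t) (S.pos (n + k)).le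
    _ = _ := by rw [← ENNReal.ofReal_add (by positivity) (by positivity), add_halves]

end

/-! ### Uniform approximation of Carathéodory functions -/

section Approximation

variable {d : ℕ} {r : ℝ}

/-- The coordinatewise retraction of `ℝ^d` onto the cube `[-r,r]^d`. -/
def cubeRetract (hr : 0 ≤ r) (a : E d) : Fin d → Icc (-r) r :=
  fun i => projIcc (-r) r (by linarith) (a i)

/-- The inclusion of the cube `[-r,r]^d` into `ℝ^d`. -/
def cubeIncl (u : Fin d → Icc (-r) r) : E d := WithLp.toLp 2 fun i => (u i : ℝ)

lemma continuous_cubeIncl : Continuous (cubeIncl : (Fin d → Icc (-r) r) → E d) := by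
  unfold cubeIncl
  fun_prop

lemma uniformContinuous_cubeRetract (hr : 0 ≤ r) :
    UniformContinuous (cubeRetract hr : E d → Fin d → Icc (-r) r) :=
  uniformContinuous_pi.mpr fun i => (LipschitzWith.projIcc _).uniformContinuous.comp
    (EuclideanSpace.proj (𝕜 := ℝ) i).uniformContinuous

lemma cubeIncl_cubeRetract (hr : 0 ≤ r) {a : E d} (ha : ‖a‖ ≤ r) :
    cubeIncl (cubeRetract hr a) = a := by
  ext i
  have h1 : |a i| ≤ r := (PiLp.norm_apply_le a i).trans ha
  simp only [cubeIncl, cubeRetract]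
  rw [projIcc_of_mem _ (abs_le.mp h1)]

/-- A Scorza Dragoni type approximation: a bounded function that is measurable in `p` and continuous
in `a` agrees, up to a small error, with a jointly continuous function that is equicontinuous in
`a`, for all `a` in a ball and all `p` outside a small open set. It is obtained by approximating
the map `p ↦ φ(·, p)` into a space of continuous functions in `L¹`. -/
lemma exists_uniform_approx {W : Type*} [MetricSpace W] [ProperSpace W] [SecondCountableTopology W]
    [MeasurableSpace W] [BorelSpace W] (π : Measure W) [IsFiniteMeasure π] {φ : E d → W → ℝ}
    (hφm : Measurable (Function.uncurry φ)) (hφc : ∀ p, Continuous fun a => φ a p) {B : ℝ}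
    (hB : ∀ a p, |φ a p| ≤ B) (hr : 0 ≤ r) {δ : ℝ} (hδ : 0 < δ) {ε : ℝ≥0∞} (hε : ε ≠ 0) :
    ∃ f : E d → W → ℝ, Continuous (Function.uncurry f) ∧ (∀ a p, |f a p| ≤ B) ∧
      (∀ θ > 0, ∃ κ > 0, ∀ a a' p, dist a a' < κ → |f a p - f a' p| < θ) ∧
      ∃ A : Set W, IsOpen A ∧ π A ≤ ε ∧
        ∀ p, p ∉ A → ∀ a, ‖a‖ ≤ r → |φ a p - f a p| ≤ δ := by
  rcases isEmpty_or_nonempty W with hW | ⟨⟨p₀⟩⟩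
  · exact ⟨φ, by
      rw [continuous_iff_continuousAt]
      exact fun q => isEmptyElim q.2, hB, fun θ _ => ⟨1, one_pos, fun _ _ p => isEmptyElim p⟩, ∅,
      isOpen_empty, by simp, fun p => isEmptyElim p⟩
  have hB0 : 0 ≤ B := (abs_nonneg _).trans (hB 0 p₀)
  let K := Fin d → Icc (-r) r
  let G : W → C(K, ℝ) := fun p => ⟨fun u => φ (cubeIncl u) p, (hφc p).comp continuous_cubeIncl⟩
  let : MeasurableSpace C(K, ℝ) := borel _
  have : BorelSpace C(K, ℝ) := ⟨rfl⟩
  have hGm : Measurable G := measurable_continuousMap_of_eval fun u =>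
    hφm.comp (measurable_const.prodMk measurable_id)
  have hGB : ∀ p, ‖G p‖ ≤ B := fun p =>
    (ContinuousMap.norm_le _ hB0).mpr fun u => hB _ _
  have hGi : Integrable G π :=
    Integrable.of_bound hGm.stronglyMeasurable.aestronglyMeasurable B (ae_of_all _ hGB)
  have hδ' : ENNReal.ofReal δ ≠ 0 := by simpa using hδ
  obtain ⟨ε', hε'0, hε'⟩ := exists_between (pos_iff_ne_zero.mpr hε)
  obtain ⟨H, hHs, hHint, hHc, -⟩ := hGi.exists_hasCompactSupport_lintegral_sub_le
    (mul_ne_zero hε'0.ne' hδ')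
  have hA₀ : π {p | ENNReal.ofReal δ ≤ ‖G p - H p‖ₑ} < ε := by
    refine (meas_ge_le_lintegral_div ?_ hδ' ENNReal.ofReal_ne_top).trans_lt
      ((ENNReal.div_le_of_le_mul hHint).trans_lt hε')
    exact (hGm.sub hHc.measurable).enorm.aemeasurable
  obtain ⟨A, hA₀A, hAo, hAε⟩ := Set.exists_isOpen_lt_of_lt _ _ hA₀
  let clamp : ℝ → ℝ := fun v => max (-B) (min B v)
  have hclampc : Continuous clamp := by fun_prop
  have hclampL : ∀ u v, |clamp u - clamp v| ≤ |u - v| := fun u v =>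
    (abs_max_sub_max_le_max _ _ _ _).trans (by
      rw [sub_self, abs_zero]
      refine max_le (abs_nonneg _) ((abs_min_sub_min_le_max _ _ _ _).trans ?_)
      rw [sub_self, abs_zero]
      exact max_le (abs_nonneg _) le_rfl)
  have hclampid : ∀ u, |u| ≤ B → clamp u = u := fun u hu => by
    have := abs_le.mp hu
    simp only [clamp]
    rw [min_eq_right this.2, max_eq_right this.1]
  refine ⟨fun a p => clamp (H p (cubeRetract hr a)), ?_, fun a p => ?_, fun θ hθ => ?_, A, hAo,
    hAε.le, fun p hp a ha => ?_⟩
  · exact hclampc.comp ((hHc.comp continuous_snd).eval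
      ((uniformContinuous_cubeRetract hr).continuous.comp continuous_fst))
  · exact abs_le.mpr ⟨le_max_left _ _, max_le (by linarith) (min_le_left _ _)⟩
  · -- the range of `H` is compact, so its elements are uniformly equicontinuous
    have hF : Continuous fun q : W × K => H q.1 q.2 := (hHc.comp continuous_fst).eval continuous_snd
    have hFs : HasCompactSupport fun q : W × K => H q.1 q.2 := by
      refine HasCompactSupport.intro (hHs.isCompact.prod isCompact_univ) fun q hq => ?_
      have h1 : q.1 ∉ tsupport H := fun h => hq ⟨h, mem_univ _⟩
      rw [image_eq_zero_of_notMem_tsupport h1]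
      rfl
    have hFu := hF.uniformContinuous_of_tendsto_cocompact (x := 0)
      (hFs.is_zero_at_infty)
    obtain ⟨κ₁, hκ₁, h1⟩ := Metric.uniformContinuous_iff.mp hFu θ hθ
    obtain ⟨κ₂, hκ₂, h2⟩ := Metric.uniformContinuous_iff.mp
      (uniformContinuous_cubeRetract (d := d) hr) κ₁ hκ₁
    refine ⟨κ₂, hκ₂, fun a a' p haa' => (hclampL _ _).trans_lt ?_⟩
    have h3 := @h1 (p, cubeRetract hr a) (p, cubeRetract hr a') (by
      rw [Prod.dist_eq, dist_self]
      exact max_lt hκ₁ (h2 haa'))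
    rwa [Real.dist_eq] at h3
  · have h1 : ‖G p - H p‖ₑ < ENNReal.ofReal δ := not_le.mp fun h => hp (hA₀A h)
    rw [← ofReal_norm, ENNReal.ofReal_lt_ofReal_iff hδ] at h1
    have h2 : φ a p = G p (cubeRetract hr a) := by
      change φ a p = φ (cubeIncl (cubeRetract hr a)) p
      rw [cubeIncl_cubeRetract hr ha]
    have h3 := (G p - H p).norm_coe_le_norm (cubeRetract hr a)
    rw [← hclampid (φ a p) (hB a p)]
    refine (hclampL _ _).trans ?_
    rw [h2]
    exact h3.trans h1.le

end Approximation

/-! ### Semicontinuity under convergence in distribution -/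

section Portmanteau

variable {Z : Type*} [TopologicalSpace Z] [TopologicalSpace.MetrizableSpace Z]
  [MeasurableSpace Z] [BorelSpace Z] {Ω : ℕ → Type*} [∀ j, MeasurableSpace (Ω j)]
  {P : ∀ j, Measure (Ω j)} [∀ j, IsProbabilityMeasure (P j)] {X : ∀ j, Ω j → Z} {Q : Measure Z}
  [IsProbabilityMeasure Q]

lemma measure_le_of_tendstoInDistribution (h : TendstoInDistribution X atTop id P Q) {U : Set Z}
    (hU : IsOpen U) : Q U ≤ liminf (fun j => (P j).map (X j) U) atTop := by
  have h1 := ProbabilityMeasure.le_liminf_measure_open_of_tendsto h.tendsto hU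
  simpa using h1

lemma measure_le_of_eventually (h : TendstoInDistribution X atTop id P Q) {U : Set Z}
    (hU : IsOpen U) {C : ℝ≥0∞} (hC : ∀ᶠ j in atTop, P j {ω | X j ω ∈ U} ≤ C) : Q U ≤ C := by
  refine (measure_le_of_tendstoInDistribution h hU).trans (liminf_le_of_frequently_le' ?_)
  refine Eventually.frequently (hC.mono fun j hj => ?_)
  rw [Measure.map_apply_of_aemeasurable (h.forall_aemeasurable j) hU.measurableSet]
  exact hj

/-- Expectations of nonnegative continuous functions are lower semicontinuous under convergence in
distribution. -/
lemma lintegral_le_of_eventually (h : TendstoInDistribution X atTop id P Q) {Φ : Z → ℝ}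
    (hΦ : Continuous Φ) (h0 : ∀ z, 0 ≤ Φ z) {C : ℝ≥0∞}
    (hC : ∀ᶠ j in atTop, ∫⁻ ω, ENNReal.ofReal (Φ (X j ω)) ∂P j ≤ C) :
    ∫⁻ z, ENNReal.ofReal (Φ z) ∂Q ≤ C := by
  refine (lintegral_le_liminf_lintegral_of_forall_isOpen_measure_le_liminf_measure hΦ h0
    fun U hU => measure_le_of_tendstoInDistribution h hU).trans (liminf_le_of_frequently_le' ?_)
  refine Eventually.frequently (hC.mono fun j hj => ?_)
  rw [lintegral_map' hΦ.measurable.ennreal_ofReal.aemeasurable (h.forall_aemeasurable j)]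
  exact hj

end Portmanteau

lemma ofReal_abs_integral_sub_le {W : Type*} [MeasurableSpace W] {m : Measure W}
    [IsProbabilityMeasure m] {u v : W → ℝ} (hu : Measurable u) (hv : Measurable v) {B : ℝ}
    (huB : ∀ p, |u p| ≤ B) (hvB : ∀ p, |v p| ≤ B) {A : Set W} (hA : MeasurableSet A)
    {c : ℝ} (h : ∀ᵐ p ∂m, p ∉ A → |u p - v p| ≤ c) :
    ENNReal.ofReal |∫ p, u p ∂m - ∫ p, v p ∂m| ≤
      ENNReal.ofReal c + ENNReal.ofReal (2 * B) * m A := by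
  have hint : ∀ {f : W → ℝ}, Measurable f → (∀ p, |f p| ≤ B) → Integrable f m := fun hf hfB =>
    Integrable.of_bound hf.aestronglyMeasurable B (ae_of_all _ hfB)
  rw [← integral_sub (hint hu huB) (hint hv hvB), ← Real.norm_eq_abs, ofReal_norm]
  calc ‖∫ p, (u p - v p) ∂m‖ₑ ≤ ∫⁻ p, ‖u p - v p‖ₑ ∂m := enorm_integral_le_lintegral_enorm _
    _ ≤ ∫⁻ p, (ENNReal.ofReal c + A.indicator (fun _ => ENNReal.ofReal (2 * B)) p) ∂m := by
        refine lintegral_mono_ae (h.mono fun p hp => ?_)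
        rw [← ofReal_norm, Real.norm_eq_abs]
        by_cases hpA : p ∈ A
        · rw [indicator_of_mem hpA]
          refine le_add_left (ENNReal.ofReal_le_ofReal ((abs_sub _ _).trans ?_))
          linarith [huB p, hvB p]
        · exact le_add_right (ENNReal.ofReal_le_ofReal (hp hpA))
    _ = _ := by
        rw [lintegral_add_left measurable_const, lintegral_const, measure_univ, mul_one,
          lintegral_indicator_const hA]

section

variable {d₁ d₂ : ℕ} {T : ℝ}

/-- The functional `(ν, X) ↦ ∫ f(X(s), z, s) ν(dz, ds)` is continuous if `f` is bounded and
continuous, and equicontinuous in its first argument. -/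
lemma continuous_integral_ctrl_traj {f : E d₁ → E d₂ × I T → ℝ}
    (hf : Continuous (Function.uncurry f)) {B : ℝ} (hB : ∀ a p, |f a p| ≤ B)
    (hu : ∀ θ > 0, ∃ κ > 0, ∀ a a' p, dist a a' < κ → |f a p - f a' p| < θ) :
    Continuous fun z : PairSpace T d₁ d₂ => ∫ p, f (z.traj p.2) p ∂z.ctrl := by
  have hF : ∀ z : PairSpace T d₁ d₂, Continuous fun p : E d₂ × I T => f (z.traj p.2) p := fun z =>
    hf.comp ((z.traj.continuous.comp continuous_snd).prodMk continuous_id)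
  have hint : ∀ z z' : PairSpace T d₁ d₂,
      Integrable (fun p : E d₂ × I T => f (z.traj p.2) p) z'.ctrl := fun z z' =>
    Integrable.of_bound (hF z).measurable.aestronglyMeasurable B (ae_of_all _ fun p => hB _ _)
  refine continuous_iff_continuousAt.mpr fun z₀ => ?_
  rw [ContinuousAt, Metric.tendsto_nhds]
  intro θ hθ
  obtain ⟨κ, hκ, h1⟩ := hu (θ / 2) (half_pos hθ)
  have h2 : ∀ᶠ z : PairSpace T d₁ d₂ in 𝓝 z₀, dist z.traj z₀.traj < κ :=
    Metric.tendsto_nhds.mp (PairSpace.continuous_traj.tendsto z₀) κ hκ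
  have h3 : ∀ᶠ z : PairSpace T d₁ d₂ in 𝓝 z₀,
      dist (∫ p, f (z₀.traj p.2) p ∂z.ctrl) (∫ p, f (z₀.traj p.2) p ∂z₀.ctrl) < θ / 2 :=
    Metric.tendsto_nhds.mp ((PairSpace.continuous_integral_ctrl
      (BoundedContinuousFunction.ofNormedAddCommGroup _ (hF z₀) B fun p => hB _ _)).tendsto z₀)
      (θ / 2) (half_pos hθ)
  filter_upwards [h2, h3] with z hz hz'
  refine (dist_triangle _ (∫ p, f (z₀.traj p.2) p ∂z.ctrl) _).trans_lt ?_
  have h4 : dist (∫ p, f (z.traj p.2) p ∂z.ctrl) (∫ p, f (z₀.traj p.2) p ∂z.ctrl) ≤ θ / 2 := by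
    rw [Real.dist_eq, ← integral_sub (hint z z) (hint z₀ z)]
    exact abs_integral_le_of_prob fun p =>
      (h1 _ _ p ((ContinuousMap.dist_apply_le_dist p.2).trans_lt hz)).le
  linarith

end

section

variable {d₁ d₂ : ℕ} {T : ℝ} {S : StepSizes T} {g : E d₁ → E d₂ → E d₁} {x : E d₁}
  {lam : Measure (E d₂)} {Ω : ℕ → Type*} [∀ n, MeasurableSpace (Ω n)] {P : ∀ n, Measure (Ω n)}
  [∀ n, IsProbabilityMeasure (P n)]
  {ν : ∀ n, ℕ → Kernel (Ω n) (E d₂)} [∀ n k, IsMarkovKernel (ν n k)] {Y : ∀ n, ℕ → Ω n → E d₂}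

lemma UniformlyControlled.exists_excess_prob_le (hU : UniformlyControlled S g x lam P ν Y) {M : ℝ}
    (hM : ∀ n k, k < S.β n → S.hval n k ≤ M) {κ : ℝ} (hκ : 0 < κ) {η : ℝ≥0∞} (hη : η ≠ 0) :
    ∃ K : ℝ, 0 ≤ K ∧ ∀ n, P n {ω | κ ≤ excess S g x K n fun i => Y n i ω} ≤ η := by
  have hκ' : ENNReal.ofReal κ ≠ 0 := by simpa using hκ
  obtain ⟨K, hK0, hK⟩ := hU.exists_excess_le hM (mul_ne_zero hη hκ')
  refine ⟨K, hK0, fun n => ?_⟩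
  have hmeas : Measurable fun ω => excess S g x K n fun i => Y n i ω :=
    measurable_excess S x hU.measurable_update K n (hU.isControl n).measurable_noise
  have h1 := meas_ge_le_lintegral_div (μ := P n) hmeas.ennreal_ofReal.aemeasurable hκ'
    ENNReal.ofReal_ne_top
  exact (measure_mono fun ω hω => ENNReal.ofReal_le_ofReal hω).trans
    (h1.trans (ENNReal.div_le_of_le_mul (hK n)))

lemma UniformlyControlled.exists_traj_bound (hT : 0 ≤ T)
    (hU : UniformlyControlled S g x lam P ν Y) {M : ℝ}
    (hM : ∀ n k, k < S.β n → S.hval n k ≤ M) {η : ℝ≥0∞} (hη : η ≠ 0) :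
    ∃ r : ℝ, 0 ≤ r ∧ ∀ n, P n {ω | r < ‖interp S g x n fun i => Y n i ω‖} ≤ η := by
  obtain ⟨K, hK0, hK⟩ := hU.exists_excess_prob_le hM one_pos hη
  refine ⟨‖x‖ + K * T + 1, by positivity, fun n => (measure_mono fun ω hω => ?_).trans (hK n)⟩
  simp only [mem_ofPred_eq] at hω ⊢
  by_contra! hlt
  refine absurd hω (not_lt.mpr ((ContinuousMap.norm_le _ (by positivity)).mpr fun s => ?_))
  have h1 := norm_interp_sub_le S g x hK0 n (fun i => Y n i ω) s ⟨0, le_rfl, hT⟩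
  rw [interp_zero S g x hT, sub_zero, abs_of_nonneg s.2.1] at h1
  have h2 := norm_le_norm_add_norm_sub' (interp S g x n (fun i => Y n i ω) s) x
  have h3 := mul_le_mul_of_nonneg_left s.2.2 hK0
  linarith

section Limit

variable {σ : ℕ → ℕ} {Q : Measure (PairSpace T d₁ d₂)} [IsProbabilityMeasure Q]

/-- The limit of the control measures does not charge open sets more than the control measures. -/
lemma lintegral_ctrl_le_of_eventually
    (hQ : TendstoInDistribution (fun j => ctrlPair S g x (σ j) (ν (σ j)) (Y (σ j))) atTop id
      (fun j => P (σ j)) Q) {A : Set (E d₂ × I T)} (hA : IsOpen A) {C : ℝ≥0∞}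
    (hC : ∀ᶠ j in atTop, ∫⁻ ω, occ S (σ j) (ν (σ j)) ω A ∂P (σ j) ≤ C) :
    ∫⁻ z : PairSpace T d₁ d₂, z.ctrl A ∂Q ≤ C := by
  have hF : IsClosed Aᶜ := hA.isClosed_compl
  -- continuous functions increasing to the indicator function
  let f : ℕ → BoundedContinuousFunction (E d₂ × I T) ℝ := fun m =>
    BoundedContinuousFunction.ofNormedAddCommGroup (fun p => 1 - (hF.apprSeq m p : ℝ))
      (by fun_prop) 1 fun p => by
        have h1 : ((hF.apprSeq m p : ℝ≥0) : ℝ) ≤ 1 := by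
          exact_mod_cast HasOuterApproxClosed.apprSeq_apply_le_one hF m p
        rw [Real.norm_eq_abs, abs_of_nonneg (by linarith)]
        linarith [NNReal.coe_nonneg (hF.apprSeq m p)]
  have hf0 : ∀ m p, 0 ≤ f m p := fun m p => by
    have h1 : ((hF.apprSeq m p : ℝ≥0) : ℝ) ≤ 1 := by
      exact_mod_cast HasOuterApproxClosed.apprSeq_apply_le_one hF m p
    exact sub_nonneg.mpr h1
  have hfA : ∀ m p, ENNReal.ofReal (f m p) ≤ A.indicator 1 p := fun m p => by
    by_cases hp : p ∈ A
    · rw [indicator_of_mem hp, Pi.one_apply, ← ENNReal.ofReal_one]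
      exact ENNReal.ofReal_le_ofReal (sub_le_self _ (NNReal.coe_nonneg _))
    · rw [indicator_of_notMem hp, nonpos_iff_eq_zero, ENNReal.ofReal_eq_zero]
      have h1 := HasOuterApproxClosed.apprSeq_apply_eq_one hF m (x := p) hp
      change 1 - ((hF.apprSeq m p : ℝ≥0) : ℝ) ≤ 0
      rw [h1]
      simp
  have hlim : ∀ p, Tendsto (fun m => ENNReal.ofReal (f m p)) atTop (𝓝 (A.indicator 1 p)) := by
    intro p
    have h1 := tendsto_pi_nhds.mp (HasOuterApproxClosed.tendsto_apprSeq hF) p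
    have h2 : Tendsto (fun m => ENNReal.ofReal (1 - ((hF.apprSeq m p : ℝ≥0) : ℝ))) atTop
        (𝓝 (ENNReal.ofReal (1 - ((indicator Aᶜ (fun _ => (1 : ℝ≥0)) p : ℝ≥0) : ℝ)))) :=
      ENNReal.tendsto_ofReal (((NNReal.continuous_coe.tendsto _).comp h1).const_sub 1)
    have h3 : A.indicator (1 : E d₂ × I T → ℝ≥0∞) p =
        ENNReal.ofReal (1 - ((indicator Aᶜ (fun _ => (1 : ℝ≥0)) p : ℝ≥0) : ℝ)) := by
      by_cases hp : p ∈ A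
      · rw [indicator_of_mem hp, indicator_of_notMem (by simpa using hp)]
        simp
      · rw [indicator_of_notMem hp, indicator_of_mem (by simpa using hp)]
        simp
    rw [h3]
    exact h2
  have hint : ∀ m (z : PairSpace T d₁ d₂), ENNReal.ofReal (∫ p, f m p ∂z.ctrl) =
      ∫⁻ p, ENNReal.ofReal (f m p) ∂z.ctrl := fun m z =>
    ofReal_integral_eq_lintegral_ofReal ((f m).integrable z.ctrl) (ae_of_all _ (hf0 m))
  have hstep : ∀ m, ∫⁻ z : PairSpace T d₁ d₂, ENNReal.ofReal (∫ p, f m p ∂z.ctrl) ∂Q ≤ C := by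
    intro m
    refine lintegral_le_of_eventually hQ (PairSpace.continuous_integral_ctrl (f m))
      (fun z => integral_nonneg (hf0 m)) (hC.mono fun j hj => le_trans ?_ hj)
    refine lintegral_mono fun ω => ?_
    simp only
    rw [hint]
    refine (lintegral_mono (hfA m)).trans (le_of_eq ?_)
    rw [lintegral_indicator_one hA.measurableSet]
    rfl
  calc ∫⁻ z : PairSpace T d₁ d₂, z.ctrl A ∂Q
      ≤ ∫⁻ z : PairSpace T d₁ d₂,
          liminf (fun m => ENNReal.ofReal (∫ p, f m p ∂z.ctrl)) atTop ∂Q := by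
        refine lintegral_mono fun z => ?_
        simp only [hint]
        rw [← lintegral_indicator_one hA.measurableSet]
        refine le_trans (lintegral_mono fun p => (hlim p).liminf_eq.ge)
          (lintegral_liminf_le fun m => ?_)
        exact (f m).continuous.measurable.ennreal_ofReal
    _ ≤ liminf (fun m => ∫⁻ z : PairSpace T d₁ d₂,
          ENNReal.ofReal (∫ p, f m p ∂z.ctrl) ∂Q) atTop :=
        lintegral_liminf_le fun m =>
          (PairSpace.continuous_integral_ctrl (f m)).measurable.ennreal_ofReal
    _ ≤ C := liminf_le_of_frequently_le' (Eventually.frequently (Eventually.of_forall hstep))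

end Limit

end

/-! ### Passage to the limit in functionals discontinuous in the noise -/

section Limit

variable {d₁ d₂ : ℕ} {T : ℝ} {S : StepSizes T} {g : E d₁ → E d₂ → E d₁} {x : E d₁}
  {lam : Measure (E d₂)} {Ω : ℕ → Type*} [∀ n, MeasurableSpace (Ω n)] {P : ∀ n, Measure (Ω n)}
  [∀ n, IsProbabilityMeasure (P n)]
  {ν : ∀ n, ℕ → Kernel (Ω n) (E d₂)} [∀ n k, IsMarkovKernel (ν n k)] {Y : ∀ n, ℕ → Ω n → E d₂}
  {σ : ℕ → ℕ} {Q : Measure (PairSpace T d₁ d₂)} [IsProbabilityMeasure Q]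

/-- On a window, replacing the integrand `φ` by its approximation `f` and the piecewise constant
path by the interpolated trajectory changes integrals only a little, up to an event on which the
trajectory is large or irregular. -/
lemma ofReal_abs_integral_occ_sub_le {Ω' : Type*} [MeasurableSpace Ω']
    {ν' : ℕ → Kernel Ω' (E d₂)} [∀ k, IsMarkovKernel (ν' k)] {y : ℕ → E d₂} {n : ℕ}
    {φ f : E d₁ → E d₂ × I T → ℝ} {B r δ κ K : ℝ} {A : Set (E d₂ × I T)}
    (hφm : Measurable (Function.uncurry φ)) (hφB : ∀ a p, |φ a p| ≤ B)
    (hfc : Continuous (Function.uncurry f)) (hfB : ∀ a p, |f a p| ≤ B)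
    (hfκ : ∀ a a' p, dist a a' < κ → |f a p - f a' p| < δ) (hA : IsOpen A)
    (hφf : ∀ p, p ∉ A → ∀ a, ‖a‖ ≤ r → |φ a p - f a p| ≤ δ) (hK : 0 ≤ K)
    (hε : ∀ i, n ≤ i → K * S.ε i < κ / 2) (ω : Ω') :
    ENNReal.ofReal |∫ p, φ (stepPath S g x n y p.2) p ∂occ S n ν' ω -
        ∫ p, f (interp S g x n y p.2) p ∂occ S n ν' ω| ≤
      ENNReal.ofReal (2 * δ) + ENNReal.ofReal (2 * B) *
        (occ S n ν' ω A + ((if r < ‖interp S g x n y‖ then 1 else 0) +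
          (if κ / 2 ≤ excess S g x K n y then 1 else 0))) := by
  have hm1 : Measurable fun p : E d₂ × I T => φ (stepPath S g x n y p.2) p :=
    hφm.comp (((measurable_stepPath S g x n y).comp measurable_snd).prodMk measurable_id)
  have hm2 : Measurable fun p : E d₂ × I T => f (interp S g x n y p.2) p :=
    (hfc.comp (((interp S g x n y).continuous.comp continuous_snd).prodMk
      continuous_id)).measurable
  by_cases h1 : r < ‖interp S g x n y‖ ∨ κ / 2 ≤ excess S g x K n y
  · refine (ofReal_abs_integral_sub_le hm1 hm2 (fun p => hφB _ _) (fun p => hfB _ _)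
      MeasurableSet.univ (c := 0) (by simp)).trans ?_
    rw [ENNReal.ofReal_zero, zero_add, measure_univ]
    refine le_add_left (mul_le_mul_right (le_add_left ?_) _)
    rcases h1 with h1 | h1
    · rw [if_pos h1]; exact le_add_right le_rfl
    · rw [if_pos h1]; exact le_add_left le_rfl
  · obtain ⟨h1, h2⟩ := not_or.mp h1
    rw [if_neg h1, if_neg h2, add_zero, add_zero]
    refine ofReal_abs_integral_sub_le hm1 hm2 (fun p => hφB _ _) (fun p => hfB _ _)
      hA.measurableSet ?_
    filter_upwards [ae_occMeasure_mem_cell S n fun k => ν' k ω] with p ⟨k, hk, hp⟩ hpA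
    rw [stepPath_of_mem S g x y hk hp]
    have h3 : ‖path S g x n y k‖ ≤ r := by
      rw [← interp_breakpoint S g x n y hk
        (s := ⟨S.τ n k, S.τ_nonneg n k, τ_le_T S hk.le⟩) rfl]
      exact (ContinuousMap.norm_coe_le_norm _ _).trans (not_lt.mp h1)
    have h4 : dist (path S g x n y k) (interp S g x n y p.2) < κ := by
      rw [dist_comm, dist_eq_norm]
      refine (norm_interp_sub_path_le S g x hK n y hk hp).trans_lt ?_
      linarith [hε (n + k) (Nat.le_add_right _ _), not_le.mp h2]
    have h5 := hφf p hpA _ h3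
    have h6 := hfκ _ _ p h4
    calc _ ≤ |φ (path S g x n y k) p - f (path S g x n y k) p| +
          |f (path S g x n y k) p - f (interp S g x n y p.2) p| := abs_sub_le _ _ _
      _ ≤ 2 * δ := by linarith

/-- Passage to the limit in functionals that are not continuous in the noise: an asymptotic bound
for the distance between a continuous functional and the integral of `φ` along the piecewise
constant paths carries over to the limit. -/
lemma UniformlyControlled.lintegral_le_of_eventually (hT : 0 ≤ T)
    (hU : UniformlyControlled S g x lam P ν Y) {M : ℝ}
    (hM : ∀ n k, k < S.β n → S.hval n k ≤ M) (hσ : StrictMono σ)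
    (hQ : TendstoInDistribution (fun j => ctrlPair S g x (σ j) (ν (σ j)) (Y (σ j))) atTop id
      (fun j => P (σ j)) Q) {φ : E d₁ → E d₂ × I T → ℝ}
    (hφm : Measurable (Function.uncurry φ)) (hφc : ∀ p, Continuous fun a => φ a p) {B : ℝ}
    (hφB : ∀ a p, |φ a p| ≤ B) {D : PairSpace T d₁ d₂ → ℝ} (hD : Continuous D) {C : ℝ≥0∞}
    (hC : ∀ᶠ j in atTop, ∫⁻ ω, ENNReal.ofReal
      |D (ctrlPair S g x (σ j) (ν (σ j)) (Y (σ j)) ω) -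
        ∫ p, φ (stepPath S g x (σ j) (fun i => Y (σ j) i ω) p.2) p ∂occ S (σ j) (ν (σ j)) ω|
          ∂P (σ j) ≤ C) :
    ∫⁻ z : PairSpace T d₁ d₂, ENNReal.ofReal |D z - ∫ p, φ (z.traj p.2) p ∂z.ctrl| ∂Q ≤ C := by
  have := hU.isProbabilityMeasure_lam
  refine ENNReal.le_of_forall_pos_le_add fun e he _ => ?_
  -- the parameters of the approximation
  set δ : ℝ := (e : ℝ) / 8 with hδdef
  have hδ : 0 < δ := by have : (0 : ℝ) < e := he; positivity
  obtain ⟨η, hη, hBη⟩ : ∃ η : ℝ≥0∞, η ≠ 0 ∧ ENNReal.ofReal (2 * B) * η ≤ ENNReal.ofReal δ := by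
    refine ⟨ENNReal.ofReal δ / (ENNReal.ofReal (2 * B) + 1), ENNReal.div_ne_zero.mpr
      ⟨by simpa using hδ, by finiteness⟩, ?_⟩
    exact (mul_le_mul_left (le_add_right le_rfl) _).trans ENNReal.mul_div_le
  obtain ⟨r, hr0, hr⟩ := hU.exists_traj_bound hT hM hη
  obtain ⟨δ₀, hδ₀, hsmall⟩ := hU.small_set η hη
  obtain ⟨f, hfc, hfB, hfu, A, hAo, hAπ, hφf⟩ :=
    exists_uniform_approx (lam.prod (leb T)) hφm hφc hφB hr0 hδ hδ₀
  have hoccA := hsmall A hAo.measurableSet hAπ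
  obtain ⟨κ, hκ, hfκ⟩ := hfu δ hδ
  obtain ⟨K, hK0, hK⟩ := hU.exists_excess_prob_le hM (half_pos hκ) hη
  obtain ⟨N, hN⟩ := S.eventually_small (δ := κ / 2 / (K + 1)) (by positivity)
  have hKε : ∀ i ≥ N, K * S.ε i < κ / 2 := fun i hi => by
    have h1 := hN i hi
    rw [lt_div_iff₀ (by positivity)] at h1
    nlinarith [S.pos i]
  let Ψ : PairSpace T d₁ d₂ → ℝ := fun z => ∫ p, f (z.traj p.2) p ∂z.ctrl
  have hΨ : Continuous Ψ := continuous_integral_ctrl_traj hfc hfB hfu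
  have hopen : IsOpen {z : PairSpace T d₁ d₂ | r < ‖z.traj‖} :=
    isOpen_lt continuous_const PairSpace.continuous_traj.norm
  -- the continuous functional in the limit
  have hpre : ∫⁻ z, ENNReal.ofReal |D z - Ψ z| ∂Q ≤ C + 5 * ENNReal.ofReal δ := by
    refine StochApprox.lintegral_le_of_eventually hQ (Φ := fun z => |D z - Ψ z|)
      (hD.sub hΨ).abs (fun _ => abs_nonneg _) ?_
    filter_upwards [hC, eventually_ge_atTop N] with j hj hjN
    set n := σ j with hn
    have hnN : N ≤ n := hjN.trans (hσ.le_apply)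
    have hcν := hU.isControl n
    have hmo : Measurable fun ω => occ S n (ν n) ω A :=
      (Measure.measurable_coe hAo.measurableSet).comp (measurable_occ S n)
    have hpair := measurable_ctrlPair S hU.measurable_update x hcν
    have hs1 : MeasurableSet {ω | r < ‖interp S g x n fun i => Y n i ω‖} :=
      hpair hopen.measurableSet
    have hs2 : MeasurableSet {ω | κ / 2 ≤ excess S g x K n fun i => Y n i ω} :=
      measurableSet_le measurable_const
        (measurable_excess S x hU.measurable_update K n hcν.measurable_noise)
    have hm1 : Measurable fun ω => (if r < ‖interp S g x n fun i => Y n i ω‖ then 1 else 0 : ℝ≥0∞) :=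
      Measurable.ite hs1 measurable_const measurable_const
    have hm2 : Measurable fun ω =>
        (if κ / 2 ≤ excess S g x K n fun i => Y n i ω then 1 else 0 : ℝ≥0∞) :=
      Measurable.ite hs2 measurable_const measurable_const
    have hi1 : ∫⁻ ω, (if r < ‖interp S g x n fun i => Y n i ω‖ then 1 else 0 : ℝ≥0∞) ∂P n ≤ η := by
      refine le_trans (le_of_eq ?_) (hr n)
      rw [← lintegral_indicator_one hs1]
      rfl
    have hi2 : ∫⁻ ω, (if κ / 2 ≤ excess S g x K n fun i => Y n i ω then 1 else 0 : ℝ≥0∞) ∂P n ≤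
        η := by
      refine le_trans (le_of_eq ?_) (hK n)
      rw [← lintegral_indicator_one hs2]
      rfl
    have hm12 : Measurable fun ω => occ S n (ν n) ω A +
        ((if r < ‖interp S g x n fun i => Y n i ω‖ then 1 else 0) +
          (if κ / 2 ≤ excess S g x K n fun i => Y n i ω then 1 else 0)) :=
      hmo.add (hm1.add hm2)
    have hm3 : Measurable fun ω => ENNReal.ofReal (2 * δ) + ENNReal.ofReal (2 * B) *
        (occ S n (ν n) ω A + ((if r < ‖interp S g x n fun i => Y n i ω‖ then 1 else 0) +
          (if κ / 2 ≤ excess S g x K n fun i => Y n i ω then 1 else 0))) :=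
      (hm12.const_mul _).const_add _
    calc ∫⁻ ω, ENNReal.ofReal |D (ctrlPair S g x n (ν n) (Y n) ω) -
          Ψ (ctrlPair S g x n (ν n) (Y n) ω)| ∂P n
        ≤ ∫⁻ ω, (ENNReal.ofReal |D (ctrlPair S g x n (ν n) (Y n) ω) -
            ∫ p, φ (stepPath S g x n (fun i => Y n i ω) p.2) p ∂occ S n (ν n) ω| +
          (ENNReal.ofReal (2 * δ) + ENNReal.ofReal (2 * B) *
            (occ S n (ν n) ω A + ((if r < ‖interp S g x n fun i => Y n i ω‖ then 1 else 0) +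
              (if κ / 2 ≤ excess S g x K n fun i => Y n i ω then 1 else 0))))) ∂P n := by
          refine lintegral_mono fun ω => ?_
          refine (ENNReal.ofReal_le_ofReal (abs_sub_le _ (∫ p, φ (stepPath S g x n
            (fun i => Y n i ω) p.2) p ∂occ S n (ν n) ω) _)).trans
            (ENNReal.ofReal_add_le.trans (add_le_add le_rfl ?_))
          exact ofReal_abs_integral_occ_sub_le hφm hφB hfc hfB hfκ hAo hφf hK0
            (fun i hi => hKε i (hnN.trans hi)) ω
      _ ≤ C + (ENNReal.ofReal (2 * δ) + ENNReal.ofReal (2 * B) * (η + (η + η))) := by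
          rw [lintegral_add_right _ hm3, lintegral_add_left measurable_const, lintegral_const,
            measure_univ, mul_one, lintegral_const_mul _ hm12,
            lintegral_add_left hmo, lintegral_add_left hm1]
          exact add_le_add hj (add_le_add le_rfl (mul_le_mul_right
            (add_le_add (hoccA n) (add_le_add hi1 hi2)) _))
      _ ≤ C + 5 * ENNReal.ofReal δ := by
          refine add_le_add le_rfl ?_
          rw [mul_add, mul_add]
          refine (add_le_add le_rfl (add_le_add hBη (add_le_add hBη hBη))).trans (le_of_eq ?_)
          rw [ENNReal.ofReal_mul zero_le_two, ENNReal.ofReal_ofNat]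
          ring
  -- the error of the approximation in the limit
  have hpost : ∫⁻ z, ENNReal.ofReal |Ψ z - ∫ p, φ (z.traj p.2) p ∂z.ctrl| ∂Q ≤
      3 * ENNReal.ofReal δ := by
    have hmA : Measurable fun z : PairSpace T d₁ d₂ => z.ctrl A :=
      (Measure.measurable_coe hAo.measurableSet).comp PairSpace.measurable_ctrl
    have hm1 : Measurable fun z : PairSpace T d₁ d₂ => (if r < ‖z.traj‖ then 1 else 0 : ℝ≥0∞) :=
      Measurable.ite hopen.measurableSet measurable_const measurable_const
    have hmA1 : Measurable fun z : PairSpace T d₁ d₂ =>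
        z.ctrl A + (if r < ‖z.traj‖ then 1 else 0 : ℝ≥0∞) := hmA.add hm1
    have hi1 : ∫⁻ z : PairSpace T d₁ d₂, (if r < ‖z.traj‖ then 1 else 0 : ℝ≥0∞) ∂Q ≤ η := by
      have h1 := measure_le_of_eventually hQ hopen (Eventually.of_forall fun j => hr (σ j))
      refine le_trans (le_of_eq ?_) h1
      rw [← lintegral_indicator_one hopen.measurableSet]
      rfl
    have hi2 := lintegral_ctrl_le_of_eventually hQ hAo
      (Eventually.of_forall fun j => hoccA (σ j))
    calc ∫⁻ z, ENNReal.ofReal |Ψ z - ∫ p, φ (z.traj p.2) p ∂z.ctrl| ∂Q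
        ≤ ∫⁻ z : PairSpace T d₁ d₂, (ENNReal.ofReal δ + ENNReal.ofReal (2 * B) *
            (z.ctrl A + (if r < ‖z.traj‖ then 1 else 0))) ∂Q := by
          refine lintegral_mono fun z => ?_
          have hmf : Measurable fun p : E d₂ × I T => f (z.traj p.2) p :=
            (hfc.comp ((z.traj.continuous.comp continuous_snd).prodMk continuous_id)).measurable
          have hmφ : Measurable fun p : E d₂ × I T => φ (z.traj p.2) p :=
            hφm.comp ((z.traj.continuous.measurable.comp measurable_snd).prodMk measurable_id)
          simp only
          by_cases hz : r < ‖z.traj‖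
          · refine (ofReal_abs_integral_sub_le hmf hmφ (fun p => hfB _ _) (fun p => hφB _ _)
              MeasurableSet.univ (c := 0) (by simp)).trans ?_
            rw [ENNReal.ofReal_zero, zero_add, measure_univ, if_pos hz]
            exact le_add_left (mul_le_mul_right (le_add_left le_rfl) _)
          · rw [if_neg hz, add_zero]
            refine ofReal_abs_integral_sub_le hmf hmφ (fun p => hfB _ _) (fun p => hφB _ _)
              hAo.measurableSet (ae_of_all _ fun p hp => ?_)
            rw [abs_sub_comm]
            exact hφf p hp _ ((ContinuousMap.norm_coe_le_norm _ _).trans (not_lt.mp hz))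
      _ ≤ ENNReal.ofReal δ + ENNReal.ofReal (2 * B) * (η + η) := by
          rw [lintegral_add_left measurable_const, lintegral_const, measure_univ, mul_one,
            lintegral_const_mul _ hmA1, lintegral_add_left hmA]
          exact add_le_add le_rfl (mul_le_mul_right (add_le_add hi2 hi1) _)
      _ ≤ 3 * ENNReal.ofReal δ := by
          rw [mul_add]
          refine (add_le_add le_rfl (add_le_add hBη hBη)).trans (le_of_eq ?_)
          ring
  have hmD : Measurable fun z => ENNReal.ofReal |D z - Ψ z| :=
    (hD.sub hΨ).abs.measurable.ennreal_ofReal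
  calc ∫⁻ z : PairSpace T d₁ d₂, ENNReal.ofReal |D z - ∫ p, φ (z.traj p.2) p ∂z.ctrl| ∂Q
      ≤ ∫⁻ z : PairSpace T d₁ d₂, (ENNReal.ofReal |D z - Ψ z| +
          ENNReal.ofReal |Ψ z - ∫ p, φ (z.traj p.2) p ∂z.ctrl|) ∂Q :=
        lintegral_mono fun z => (ENNReal.ofReal_le_ofReal (abs_sub_le _ (Ψ z) _)).trans
          ENNReal.ofReal_add_le
    _ ≤ (C + 5 * ENNReal.ofReal δ) + 3 * ENNReal.ofReal δ := by
        rw [lintegral_add_left hmD]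
        exact add_le_add hpre hpost
    _ = C + e := by
        have h1 : (e : ℝ≥0∞) = 8 * ENNReal.ofReal δ := by
          rw [← ENNReal.ofReal_coe_nnreal, ← ENNReal.ofReal_ofNat 8,
            ← ENNReal.ofReal_mul (by norm_num), hδdef]
          congr 1
          ring
        rw [h1]
        ring

end Limit

/-! ### The limit: time marginal, drift and integrability -/

instance nullSingletonClass_leb (T : ℝ) : NullSingletonClass (leb T) := by
  refine ⟨fun s => ?_⟩
  rw [leb, comap_subtype_coe_apply measurableSet_Icc, image_singleton]
  exact measure_singleton _

lemma ae_coe_lt (T : ℝ) : ∀ᵐ s : I T ∂leb T, (s : ℝ) < T := by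
  by_cases hT : 0 ≤ T
  · have h1 : ∀ᵐ s : I T ∂leb T, s ≠ ⟨T, hT, le_rfl⟩ := by
      simp only [ae_iff, not_not]
      exact measure_singleton (⟨T, hT, le_rfl⟩ : I T)
    filter_upwards [h1] with s hs
    exact lt_of_le_of_ne s.2.2 fun h => hs (Subtype.ext h)
  · exact ae_of_all _ fun s => absurd (s.2.1.trans s.2.2) hT

namespace StepSizes

variable {T : ℝ} (S : StepSizes T)

/-- The measure `dt / h^n(t)`, the marginal in time of every control measure. -/
def timeMeasure (n : ℕ) : Measure (I T) :=
  ∑ k ∈ Finset.range (S.β n), ENNReal.ofReal (1 / S.hval n k) • (leb T).restrict (S.cell n k)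

lemma map_snd_occMeasure {d₂ : ℕ} (n : ℕ) (m : ℕ → Measure (E d₂))
    [∀ k, IsProbabilityMeasure (m k)] : (occMeasure S n m).map Prod.snd = S.timeMeasure n := by
  ext B hB
  rw [Measure.map_apply measurable_snd hB, occMeasure, timeMeasure, Measure.finsetSum_apply,
    Measure.finsetSum_apply]
  refine Finset.sum_congr rfl fun k _ => ?_
  rw [Measure.smul_apply, Measure.smul_apply, ← univ_prod, Measure.prod_prod, measure_univ,
    one_mul]

lemma ae_eventually_mem_cell :
    ∀ᵐ s ∂leb T, ∀ᶠ n in atTop, ∃ k, k < S.β n ∧ s ∈ S.cell n k := by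
  filter_upwards [ae_coe_lt T] with s hs
  exact S.eventually_exists_mem_cell hs

lemma tendsto_integral_timeMeasure {c : ℝ} (hc : 0 < c)
    (hb : ∀ n k, k < S.β n → c ≤ S.hval n k) {h₀ : I T → ℝ} (hc₀ : ∀ s, c ≤ h₀ s)
    (hh : S.ProfileTendsto h₀) {f : I T → ℝ} (hf : Measurable f) {B : ℝ}
    (hB : ∀ s, |f s| ≤ B) :
    Tendsto (fun n => ∫ s, f s ∂S.timeMeasure n) atTop (𝓝 (∫ s, 1 / h₀ s * f s ∂leb T)) := by
  have hint : ∀ μ : Measure (I T), IsFiniteMeasure μ → Integrable f μ := fun μ _ =>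
    Integrable.of_bound hf.aestronglyMeasurable B (ae_of_all _ hB)
  have h1 : ∀ n, ∫ s, f s ∂S.timeMeasure n =
      ∫ s, ∑ k ∈ Finset.range (S.β n), (S.cell n k).indicator (fun s => 1 / S.hval n k * f s) s
        ∂leb T := by
    intro n
    rw [timeMeasure, integral_finsetSum_measure fun k _ =>
      (hint _ inferInstance).smul_measure ENNReal.ofReal_ne_top, integral_finsetSum]
    · refine Finset.sum_congr rfl fun k _ => ?_
      rw [integral_smul_measure, ENNReal.toReal_ofReal (one_div_nonneg.mpr (S.hval_pos n k).le),
        integral_indicator (S.measurableSet_cell n k), integral_const_mul, smul_eq_mul]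
    · exact fun k _ => ((hint _ inferInstance).const_mul _).indicator (S.measurableSet_cell n k)
  have h2 : ∀ n s, ∑ k ∈ Finset.range (S.β n),
      (S.cell n k).indicator (fun s => 1 / S.hval n k * f s) s =
      (∑ k ∈ Finset.range (S.β n), (S.cell n k).indicator (fun _ => 1 / S.hval n k) s) * f s := by
    intro n s
    rw [Finset.sum_mul]
    refine Finset.sum_congr rfl fun k _ => ?_
    by_cases hs : s ∈ S.cell n k
    · rw [indicator_of_mem hs, indicator_of_mem hs]
    · rw [indicator_of_notMem hs, indicator_of_notMem hs, zero_mul]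
  simp only [h1, h2]
  refine tendsto_integral_of_dominated_convergence (fun _ => 1 / c * B) (fun n => ?_)
    (integrable_const _) (fun n => ae_of_all _ fun s => ?_) ?_
  · refine Measurable.aestronglyMeasurable (Measurable.mul ?_ hf)
    exact Finset.measurable_fun_sum _ fun k _ =>
      measurable_const.indicator (S.measurableSet_cell n k)
  · have hB0 : 0 ≤ B := (abs_nonneg _).trans (hB s)
    rw [Real.norm_eq_abs, abs_mul]
    refine mul_le_mul ?_ (hB s) (abs_nonneg _) (by positivity)
    by_cases hs : ∃ k, k < S.β n ∧ s ∈ S.cell n k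
    · obtain ⟨k, hk, hs⟩ := hs
      rw [S.sum_indicator_cell hk hs, abs_of_pos (one_div_pos.mpr (S.hval_pos n k))]
      exact one_div_le_one_div_of_le hc (hb n k hk)
    · rw [Finset.sum_eq_zero fun k hk => indicator_of_notMem
        (fun hsk => hs ⟨k, Finset.mem_range.mp hk, hsk⟩) _, abs_zero]
      positivity
  · filter_upwards [S.ae_eventually_mem_cell] with s hs
    refine Tendsto.mul_const _ ?_
    refine ((tendsto_const_nhds (x := (1 : ℝ))).div (S.tendsto_profile hh hs)
      (hc.trans_le (hc₀ s)).ne').congr' ?_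
    filter_upwards [hs] with n ⟨k, hk, hsk⟩
    simp only [Pi.div_apply, profile]
    rw [S.sum_indicator_cell hk hsk, S.sum_indicator_cell hk hsk]

end StepSizes

/-- The measure `dt / h(t)` on `[0,T]`. -/
def profileMeasure {T : ℝ} (h : I T → ℝ) : Measure (I T) :=
  (leb T).withDensity fun s => ENNReal.ofReal (1 / h s)

lemma integral_profileMeasure {T : ℝ} {F : Type*} [NormedAddCommGroup F] [NormedSpace ℝ F]
    {h : I T → ℝ} (hm : Measurable h) (h0 : ∀ s, 0 < h s)
    (f : I T → F) : ∫ s, f s ∂profileMeasure h = ∫ s, (1 / h s) • f s ∂leb T := by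
  have h1 : Measurable fun s => ENNReal.ofReal (1 / h s) :=
    (measurable_const.div hm).ennreal_ofReal
  rw [profileMeasure, integral_withDensity_eq_integral_toReal_smul h1 (ae_of_all _ fun s => ENNReal.ofReal_lt_top)]
  refine integral_congr_ae (ae_of_all _ fun s => ?_)
  simp only
  rw [ENNReal.toReal_ofReal (one_div_nonneg.mpr (h0 s).le)]

lemma PairSpace.measurable_eval {T : ℝ} {d₁ d₂ : ℕ} :
    Measurable fun q : PairSpace T d₁ d₂ × I T => q.1.traj q.2 :=
  PairSpace.continuous_eval.measurable

/-- The map from a pair to its control measure, as a kernel. -/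
def ctrlKernel (T : ℝ) (d₁ d₂ : ℕ) : Kernel (PairSpace T d₁ d₂) (E d₂ × I T) where
  toFun := PairSpace.ctrl
  measurable' := PairSpace.measurable_ctrl

instance (T : ℝ) (d₁ d₂ : ℕ) : IsMarkovKernel (ctrlKernel T d₁ d₂) :=
  ⟨fun z => inferInstanceAs (IsProbabilityMeasure z.ctrl)⟩

lemma measurable_lintegral_ctrl {T : ℝ} {d₁ d₂ : ℕ} {F : E d₁ → E d₂ × I T → ℝ≥0∞}
    (hF : Measurable (Function.uncurry F)) :
    Measurable fun z : PairSpace T d₁ d₂ => ∫⁻ p, F (z.traj p.2) p ∂z.ctrl := by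
  have h1 : Measurable fun q : PairSpace T d₁ d₂ × (E d₂ × I T) => F (q.1.traj q.2.2) q.2 :=
    hF.comp ((PairSpace.measurable_eval.comp (measurable_fst.prodMk
      (measurable_snd.comp measurable_snd))).prodMk measurable_snd)
  exact h1.lintegral_kernel_prod_right' (κ := ctrlKernel T d₁ d₂)

section Limit

variable {d₁ d₂ : ℕ} {T : ℝ} {S : StepSizes T} {g : E d₁ → E d₂ → E d₁} {x : E d₁}
  {lam : Measure (E d₂)} {Ω : ℕ → Type*} [∀ n, MeasurableSpace (Ω n)] {P : ∀ n, Measure (Ω n)}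
  [∀ n, IsProbabilityMeasure (P n)]
  {ν : ∀ n, ℕ → Kernel (Ω n) (E d₂)} [∀ n k, IsMarkovKernel (ν n k)] {Y : ∀ n, ℕ → Ω n → E d₂}
  {σ : ℕ → ℕ} {Q : Measure (PairSpace T d₁ d₂)} [IsProbabilityMeasure Q]

/-- The time marginals of the control measures are deterministic and converge to `dt / h(t)`, so
this is the time marginal of every limit. -/
lemma ae_map_snd_ctrl_eq (hσ : StrictMono σ)
    (hQ : TendstoInDistribution (fun j => ctrlPair S g x (σ j) (ν (σ j)) (Y (σ j))) atTop id
      (fun j => P (σ j)) Q) {c : ℝ} (hc : 0 < c) (hb : ∀ n k, k < S.β n → c ≤ S.hval n k)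
    {h₀ : I T → ℝ} (hm : Measurable h₀) (hc₀ : ∀ s, c ≤ h₀ s) (hh : S.ProfileTendsto h₀) :
    ∀ᵐ z : PairSpace T d₁ d₂ ∂Q, z.ctrl.map Prod.snd = profileMeasure h₀ := by
  have h0 : ∀ s, 0 < h₀ s := fun s => hc.trans_le (hc₀ s)
  have hprob : ∀ n, IsProbabilityMeasure (S.timeMeasure n) := fun n => by
    have h1 := isProbabilityMeasure_occMeasure S n fun _ => Measure.dirac (0 : E d₂)
    rw [← S.map_snd_occMeasure n fun _ => Measure.dirac (0 : E d₂)]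
    exact Measure.isProbabilityMeasure_map measurable_snd.aemeasurable
  have hfin : IsFiniteMeasure (profileMeasure h₀) := by
    refine isFiniteMeasure_withDensity_ofReal ?_
    refine (Integrable.of_bound (measurable_const.div hm).aestronglyMeasurable (1 / c)
      (ae_of_all _ fun s => ?_)).2
    rw [Pi.div_apply, Real.norm_eq_abs, abs_of_pos (one_div_pos.mpr (h0 s))]
    exact one_div_le_one_div_of_le hc (hc₀ s)
  have hprob₀ : IsProbabilityMeasure (profileMeasure h₀) := by
    have h1 := S.tendsto_integral_timeMeasure hc hb hc₀ hh (f := fun _ => 1) measurable_const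
      (B := 1) (by simp)
    have h2 := integral_profileMeasure hm h0 fun _ => (1 : ℝ)
    simp only [smul_eq_mul] at h2
    rw [← h2] at h1
    simp only [integral_const, probReal_univ, smul_eq_mul, mul_one] at h1
    have h3 := tendsto_nhds_unique h1 tendsto_const_nhds
    exact ⟨by rw [← ENNReal.toReal_eq_one_iff]; exact h3⟩
  let m : ℕ → ProbabilityMeasure (I T) := fun n => ⟨S.timeMeasure n, hprob n⟩
  let m₀ : ProbabilityMeasure (I T) := ⟨profileMeasure h₀, hprob₀⟩
  have hlim : Tendsto m atTop (𝓝 m₀) := by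
    refine ProbabilityMeasure.tendsto_iff_forall_integral_tendsto.mpr fun f => ?_
    have h1 := S.tendsto_integral_timeMeasure hc hb hc₀ hh f.continuous.measurable
      (B := ‖f‖) f.norm_coe_le_norm
    have h2 := integral_profileMeasure hm h0 f
    simp only [smul_eq_mul] at h2
    rw [← h2] at h1
    exact h1
  let Θ : PairSpace T d₁ d₂ → ProbabilityMeasure (I T) := fun z =>
    (Prod.fst z).map (f := Prod.snd) measurable_snd.aemeasurable
  have hΘ : Continuous Θ :=
    (ProbabilityMeasure.continuous_map continuous_snd).comp continuous_fst_pairSpace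
  let _ : MetricSpace (ProbabilityMeasure (I T)) := TopologicalSpace.metrizableSpaceMetric _
  have hpair : ∀ n (ω : Ω n), Θ (ctrlPair S g x n (ν n) (Y n) ω) = m n := fun n ω =>
    Subtype.ext (S.map_snd_occMeasure n fun k => ν n k ω)
  have hΦ : Continuous fun z => dist (Θ z) m₀ := hΘ.dist continuous_const
  have hzero : ∫⁻ z, ENNReal.ofReal (dist (Θ z) m₀) ∂Q ≤ 0 := by
    refine ENNReal.le_of_forall_pos_le_add fun e he _ => ?_
    refine lintegral_le_of_eventually hQ hΦ (fun _ => dist_nonneg) ?_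
    have h1 := Metric.tendsto_nhds.mp (hlim.comp hσ.tendsto_atTop) e he
    filter_upwards [h1] with j hj
    simp only [hpair, lintegral_const, measure_univ, mul_one, zero_add]
    rw [← ENNReal.ofReal_coe_nnreal]
    exact ENNReal.ofReal_le_ofReal (le_of_lt hj)
  have h1 := (lintegral_eq_zero_iff hΦ.measurable.ennreal_ofReal).mp (nonpos_iff_eq_zero.mp hzero)
  filter_upwards [h1] with z hz
  have h2 : Θ z = m₀ := dist_le_zero.mp (ENNReal.ofReal_eq_zero.mp hz)
  exact congrArg (fun μ : ProbabilityMeasure (I T) => (μ : Measure (I T))) h2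

/-- The integral equation with truncated updates holds in the limit, up to the mean excess over
the truncation level. -/
lemma UniformlyControlled.lintegral_drift_le (hT : 0 ≤ T)
    (hU : UniformlyControlled S g x lam P ν Y) (hσ : StrictMono σ)
    (hQ : TendstoInDistribution (fun j => ctrlPair S g x (σ j) (ν (σ j)) (Y (σ j))) atTop id
      (fun j => P (σ j)) Q) {c M : ℝ} (hc : 0 < c)
    (hb : ∀ n k, k < S.β n → c ≤ S.hval n k ∧ S.hval n k ≤ M) {h₀ : I T → ℝ} (hm : Measurable h₀)
    {B : ℝ} (hB : ∀ s, |h₀ s| ≤ B) (hh : S.ProfileTendsto h₀) {K : ℝ} (hK : 0 ≤ K) {C : ℝ≥0∞}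
    (hC : ∀ n, ∫⁻ ω, ENNReal.ofReal (excess S g x K n fun i => Y n i ω) ∂P n ≤ C) (t : I T)
    (j : Fin d₁) :
    ∫⁻ z : PairSpace T d₁ d₂, ENNReal.ofReal |z.traj t j - x j -
      ∫ p, driftIntegrand h₀ t (truncUpdate g K j) (z.traj p.2) p ∂z.ctrl| ∂Q ≤ C := by
  refine ENNReal.le_of_forall_pos_le_add fun e he _ => ?_
  have hD : Continuous fun z : PairSpace T d₁ d₂ => z.traj t j - x j :=
    ((EuclideanSpace.proj (𝕜 := ℝ) j).continuous.comp
      (PairSpace.continuous_eval.comp (continuous_id.prodMk continuous_const))).sub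
      continuous_const
  refine hU.lintegral_le_of_eventually hT (fun n k hk => (hb n k hk).2) hσ hQ
    (D := fun z => z.traj t j - x j)
    (measurable_driftIntegrand hm t (measurable_truncUpdate hU.measurable_update K j))
    (fun p => continuous_const.mul (continuous_const.max (continuous_const.min
      ((EuclideanSpace.proj (𝕜 := ℝ) j).continuous.comp (hU.continuous_update p.1)))))
    (abs_driftIntegrand_le hB t (abs_truncUpdate_le g hK j)) hD ?_
  have h1 := hσ.tendsto_atTop.eventually
    (hU.eventually_drift_le hT hc hb hm hB hh hK t j (η := e) he)
  filter_upwards [h1] with i hi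
  refine le_trans hi (add_le_add (hC _) ?_)
  rw [ENNReal.ofReal_coe_nnreal]

/-- Uniform integrability of the updates under the control measures carries over to the limit. -/
lemma UniformlyControlled.lintegral_tail_le (hT : 0 ≤ T)
    (hU : UniformlyControlled S g x lam P ν Y) (hσ : StrictMono σ)
    (hQ : TendstoInDistribution (fun j => ctrlPair S g x (σ j) (ν (σ j)) (Y (σ j))) atTop id
      (fun j => P (σ j)) Q) {M : ℝ} (hM : ∀ n k, k < S.β n → S.hval n k ≤ M) {K : ℝ} {C : ℝ≥0∞}
    (hC : ∀ n, ∫⁻ ω, ∫⁻ p, ENNReal.ofReal (‖g (stepPath S g x n (fun j => Y n j ω) p.2) p.1‖ - K)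
      ∂occ S n (ν n) ω ∂P n ≤ C) :
    ∫⁻ z : PairSpace T d₁ d₂, ∫⁻ p, ENNReal.ofReal (‖g (z.traj p.2) p.1‖ - K) ∂z.ctrl ∂Q ≤ C := by
  obtain ⟨φ, hφ⟩ : ∃ φ : ℕ → E d₁ → E d₂ × I T → ℝ,
    ∀ L a p, φ L a p = min (max (‖g a p.1‖ - K) 0) L := ⟨_, fun _ _ _ => rfl⟩
  have hφ0 : ∀ L a p, 0 ≤ φ L a p := fun L a p => by
    rw [hφ]; exact le_min (le_max_right _ _) L.cast_nonneg
  have hφL : ∀ L a p, |φ L a p| ≤ L := fun L a p => by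
    rw [abs_of_nonneg (hφ0 L a p), hφ]; exact min_le_right _ _
  have hg : Measurable fun q : E d₁ × (E d₂ × I T) => g q.1 q.2.1 :=
    hU.measurable_update.comp (measurable_fst.prodMk (measurable_fst.comp measurable_snd))
  have hφm : ∀ L, Measurable (Function.uncurry (φ L)) := fun L => by
    have h1 : Measurable fun q : E d₁ × (E d₂ × I T) => min (max (‖g q.1 q.2.1‖ - K) 0) (L : ℝ) :=
      ((hg.norm.sub_const K).max measurable_const).min measurable_const
    have h2 : Function.uncurry (φ L) = fun q => min (max (‖g q.1 q.2.1‖ - K) 0) (L : ℝ) :=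
      funext fun q => hφ L q.1 q.2
    rwa [h2]
  have hφc : ∀ L p, Continuous fun a => φ L a p := fun L p => by
    simp only [hφ]
    exact (((hU.continuous_update p.1).norm.sub continuous_const).max continuous_const).min
      continuous_const
  have hφle : ∀ L a p, ENNReal.ofReal (φ L a p) ≤ ENNReal.ofReal (‖g a p.1‖ - K) := fun L a p => by
    rw [hφ]
    refine (ENNReal.ofReal_le_ofReal (min_le_left _ _)).trans ?_
    rw [ENNReal.ofReal_max, ENNReal.ofReal_zero, max_eq_left zero_le]
  have hint : ∀ L (m : Measure (E d₂ × I T)) (_ : IsProbabilityMeasure m) (X : I T → E d₁),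
      Measurable X → ENNReal.ofReal |0 - ∫ p, φ L (X p.2) p ∂m| =
        ∫⁻ p, ENNReal.ofReal (φ L (X p.2) p) ∂m := fun L m _ X hX => by
    have hmeas : Measurable fun p : E d₂ × I T => φ L (X p.2) p :=
      (hφm L).comp ((hX.comp measurable_snd).prodMk measurable_id)
    rw [zero_sub, abs_neg, abs_of_nonneg (integral_nonneg fun p => hφ0 L _ _),
      ofReal_integral_eq_lintegral_ofReal (Integrable.of_bound hmeas.aestronglyMeasurable L
        (ae_of_all _ fun p => hφL L _ _)) (ae_of_all _ fun p => hφ0 L _ _)]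
  have hstep : ∀ L, ∫⁻ z : PairSpace T d₁ d₂, ∫⁻ p, ENNReal.ofReal (φ L (z.traj p.2) p) ∂z.ctrl ∂Q
      ≤ C := by
    intro L
    have h1 := hU.lintegral_le_of_eventually hT hM hσ hQ (hφm L) (hφc L) (hφL L) (D := fun _ => 0) continuous_const (C := C)
      (Eventually.of_forall fun j => ?_)
    · refine le_trans (lintegral_mono fun z => ?_) h1
      exact (hint L z.ctrl inferInstance z.traj z.traj.continuous.measurable).ge
    · refine le_trans (lintegral_mono fun ω => ?_) (hC (σ j))
      have h2 := hint L (occ S (σ j) (ν (σ j)) ω) inferInstance _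
        (measurable_stepPath S g x (σ j) fun i => Y (σ j) i ω)
      exact h2.le.trans (lintegral_mono fun p => hφle L _ _)
  have hlim : ∀ a p, Tendsto (fun L => ENNReal.ofReal (φ L a p)) atTop
      (𝓝 (ENNReal.ofReal (‖g a p.1‖ - K))) := fun a p => by
    obtain ⟨L₀, hL₀⟩ := exists_nat_ge (max (‖g a p.1‖ - K) 0)
    refine tendsto_const_nhds.congr' ?_
    filter_upwards [eventually_ge_atTop L₀] with L hL
    have h1 : φ L a p = max (‖g a p.1‖ - K) 0 :=
      (hφ L a p).trans <| min_eq_left (hL₀.trans (by exact_mod_cast hL))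
    rw [h1, ENNReal.ofReal_max, ENNReal.ofReal_zero, max_eq_left zero_le]
  calc ∫⁻ z : PairSpace T d₁ d₂, ∫⁻ p, ENNReal.ofReal (‖g (z.traj p.2) p.1‖ - K) ∂z.ctrl ∂Q
      ≤ ∫⁻ z : PairSpace T d₁ d₂,
          liminf (fun L => ∫⁻ p, ENNReal.ofReal (φ L (z.traj p.2) p) ∂z.ctrl) atTop ∂Q := by
        refine lintegral_mono fun z => ?_
        refine le_trans (lintegral_mono fun p => (hlim _ p).liminf_eq.ge)
          (lintegral_liminf_le fun L => ?_)
        exact ((hφm L).comp ((z.traj.continuous.measurable.comp measurable_snd).prodMk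
          measurable_id)).ennreal_ofReal
    _ ≤ liminf (fun L => ∫⁻ z : PairSpace T d₁ d₂,
          ∫⁻ p, ENNReal.ofReal (φ L (z.traj p.2) p) ∂z.ctrl ∂Q) atTop :=
        lintegral_liminf_le fun L => measurable_lintegral_ctrl
          (F := fun a p => ENNReal.ofReal (φ L a p)) (hφm L).ennreal_ofReal
    _ ≤ C := liminf_le_of_frequently_le' (Eventually.frequently (Eventually.of_forall hstep))

end Limit

/-! ### Disintegration of the limit -/

lemma measurable_integral_ctrl {T : ℝ} {d₁ d₂ : ℕ} {F : E d₁ → E d₂ × I T → ℝ}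
    (hF : Measurable (Function.uncurry F)) :
    Measurable fun z : PairSpace T d₁ d₂ => ∫ p, F (z.traj p.2) p ∂z.ctrl := by
  have h1 : Measurable fun q : PairSpace T d₁ d₂ × (E d₂ × I T) => F (q.1.traj q.2.2) q.2 :=
    hF.comp ((PairSpace.measurable_eval.comp (measurable_fst.prodMk
      (measurable_snd.comp measurable_snd))).prodMk measurable_snd)
  exact (h1.stronglyMeasurable.integral_kernel_prod_right' (κ := ctrlKernel T d₁ d₂)).measurable

/-- The control measure of a pair disintegrated with respect to time. Disintegrating the kernel
`ctrlKernel` makes the result jointly measurable in the pair and in time. -/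
def limitKernel (T : ℝ) (d₁ d₂ : ℕ) : Kernel (PairSpace T d₁ d₂ × I T) (E d₂) :=
  ((ctrlKernel T d₁ d₂).map Prod.swap).condKernel

instance (T : ℝ) (d₁ d₂ : ℕ) : IsMarkovKernel (limitKernel T d₁ d₂) := by
  unfold limitKernel; infer_instance

lemma PairSpace.map_swap_ctrl {T : ℝ} {d₁ d₂ : ℕ} (z : PairSpace T d₁ d₂) :
    z.ctrl.map Prod.swap = z.ctrl.map Prod.snd ⊗ₘ (limitKernel T d₁ d₂).sectR z := by
  have h1 := ((ctrlKernel T d₁ d₂).map Prod.swap).disintegrate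
    ((ctrlKernel T d₁ d₂).map Prod.swap).condKernel
  have h2 := congrArg (fun k => k z) h1
  simp only [Kernel.compProd_apply_eq_compProd_sectR] at h2
  rw [Kernel.fst_apply, Kernel.map_apply _ measurable_swap,
    Measure.map_map measurable_fst measurable_swap] at h2
  exact h2.symm

section Disintegration

variable {T : ℝ} {d₁ d₂ : ℕ} {z : PairSpace T d₁ d₂} {h : I T → ℝ}

lemma isProbabilityMeasure_profileMeasure (hz : z.ctrl.map Prod.snd = profileMeasure h) :
    IsProbabilityMeasure (profileMeasure h) := by
  rw [← hz]
  exact Measure.isProbabilityMeasure_map measurable_snd.aemeasurable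

lemma map_swap_ctrl_eq (hz : z.ctrl.map Prod.snd = profileMeasure h) :
    z.ctrl.map Prod.swap = profileMeasure h ⊗ₘ (limitKernel T d₁ d₂).sectR z := by
  rw [z.map_swap_ctrl, hz]

/-- The disintegration of the control measure in terms of `dt / h(t)`. -/
lemma ctrl_prod_eq (hz : z.ctrl.map Prod.snd = profileMeasure h) (hm : Measurable h)
    {A : Set (E d₂)} {B : Set (I T)} (hA : MeasurableSet A) (hB : MeasurableSet B) :
    z.ctrl (A ×ˢ B) =
      ∫⁻ s in B, limitKernel T d₁ d₂ (z, s) A * ENNReal.ofReal (1 / h s) ∂leb T := by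
  have := isProbabilityMeasure_profileMeasure hz
  have h1 : Measurable fun s => ENNReal.ofReal (1 / h s) :=
    (measurable_const.div hm).ennreal_ofReal
  have h2 : z.ctrl (A ×ˢ B) = z.ctrl.map Prod.swap (B ×ˢ A) := by
    rw [Measure.map_apply measurable_swap (hB.prod hA), preimage_swap_prod]
  rw [h2, map_swap_ctrl_eq hz, Measure.compProd_apply_prod hB hA, profileMeasure,
    restrict_withDensity hB, lintegral_withDensity_eq_lintegral_mul _ h1
      (((limitKernel T d₁ d₂).sectR z).measurable_coe hA)]
  refine lintegral_congr fun s => ?_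
  rw [Pi.mul_apply, mul_comm, Kernel.sectR_apply]

/-- Time integrals are controlled by integrals against the control measure, since `h ≤ M`. -/
lemma lintegral_leb_le (hz : z.ctrl.map Prod.snd = profileMeasure h) (hm : Measurable h)
    (h0 : ∀ s, 0 < h s) {M : ℝ} (hM : ∀ s, h s ≤ M) {F : E d₂ × I T → ℝ≥0∞} (hF : Measurable F) :
    ∫⁻ s, ∫⁻ y, F (y, s) ∂limitKernel T d₁ d₂ (z, s) ∂leb T ≤
      ENNReal.ofReal M * ∫⁻ p, F p ∂z.ctrl := by
  have := isProbabilityMeasure_profileMeasure hz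
  have h1 : Measurable fun s => ENNReal.ofReal (1 / h s) :=
    (measurable_const.div hm).ennreal_ofReal
  have hF' : Measurable fun q : I T × E d₂ => F q.swap := hF.comp measurable_swap
  have h2 : Measurable fun s => ∫⁻ y, F (y, s) ∂limitKernel T d₁ d₂ (z, s) :=
    hF'.lintegral_kernel_prod_right' (κ := (limitKernel T d₁ d₂).sectR z)
  have h3 : ∫⁻ p, F p ∂z.ctrl =
      ∫⁻ s, ENNReal.ofReal (1 / h s) * ∫⁻ y, F (y, s) ∂limitKernel T d₁ d₂ (z, s) ∂leb T := by
    have h4 : ∫⁻ p, F p ∂z.ctrl = ∫⁻ q, F q.swap ∂z.ctrl.map Prod.swap := by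
      rw [lintegral_map hF' measurable_swap]
      simp only [Prod.swap_swap]
    rw [h4, map_swap_ctrl_eq hz, Measure.lintegral_compProd hF', profileMeasure,
      lintegral_withDensity_eq_lintegral_mul _ h1
        (hF'.lintegral_kernel_prod_right' (κ := (limitKernel T d₁ d₂).sectR z))]
    rfl
  rw [h3, ← lintegral_const_mul' _ _ ENNReal.ofReal_ne_top]
  refine lintegral_mono fun s => ?_
  simp only
  rw [← mul_assoc, ← ENNReal.ofReal_mul ((h0 s).le.trans (hM s))]
  refine le_mul_of_one_le_left zero_le ?_
  rw [← ENNReal.ofReal_one]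
  refine ENNReal.ofReal_le_ofReal ?_
  rw [mul_one_div, one_le_div (h0 s)]
  exact hM s

/-- Integrating `1_{s ≤ t} h(s) G` against the control measure gives the time integral of the means
of `G` up to `t`, because the factor `h` cancels the density of the time marginal. -/
lemma integral_ctrl_indicator_eq (hz : z.ctrl.map Prod.snd = profileMeasure h)
    (hm : Measurable h) (h0 : ∀ s, 0 < h s) {F : Type*} [NormedAddCommGroup F] [NormedSpace ℝ F]
    (t : I T) {G : E d₂ × I T → F}
    (hG : Integrable (fun p => (Iic t).indicator h p.2 • G p) z.ctrl) :
    ∫ p, (Iic t).indicator h p.2 • G p ∂z.ctrl =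
      ∫ s in Iic t, ∫ y, G (y, s) ∂limitKernel T d₁ d₂ (z, s) ∂leb T := by
  have := isProbabilityMeasure_profileMeasure hz
  have h1 : ∫ p, (Iic t).indicator h p.2 • G p ∂z.ctrl =
      ∫ q, (Iic t).indicator h q.1 • G q.swap ∂z.ctrl.map Prod.swap :=
    (integral_map_equiv MeasurableEquiv.prodComm
      fun q : I T × E d₂ => (Iic t).indicator h q.1 • G q.swap).symm
  have h2 : Integrable (fun q : I T × E d₂ => (Iic t).indicator h q.1 • G q.swap)
      (z.ctrl.map Prod.swap) :=
    (integrable_map_equiv MeasurableEquiv.prodComm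
      fun q : I T × E d₂ => (Iic t).indicator h q.1 • G q.swap).mpr hG
  rw [map_swap_ctrl_eq hz] at h1 h2
  rw [h1, Measure.integral_compProd h2, integral_profileMeasure hm h0,
    ← integral_indicator measurableSet_Iic]
  refine integral_congr_ae (ae_of_all _ fun s => ?_)
  simp only [Kernel.sectR_apply, Prod.swap_prod_mk]
  rw [integral_smul, smul_smul]
  by_cases hs : s ∈ Iic t
  · rw [indicator_of_mem hs, indicator_of_mem hs, one_div_mul_cancel (h0 s).ne', one_smul]
  · rw [indicator_of_notMem hs, indicator_of_notMem hs, mul_zero, zero_smul]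

end Disintegration

/-- The primitive of an integrable function on `[0,T]` is continuous. -/
lemma continuous_integral_Iic {T : ℝ} {F : Type*} [NormedAddCommGroup F] [NormedSpace ℝ F]
    {f : I T → F} (hf : Integrable f (leb T)) :
    Continuous fun t => ∫ s in Iic t, f s ∂leb T := by
  have h1 : (fun t => ∫ s in Iic t, f s ∂leb T) = fun t => ∫ s, (Iic t).indicator f s ∂leb T :=
    funext fun t => (integral_indicator measurableSet_Iic).symm
  rw [h1]
  refine continuous_iff_continuousAt.mpr fun t₀ => ?_
  refine continuousAt_of_dominated (bound := fun s => ‖f s‖)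
    (Eventually.of_forall fun t => hf.aestronglyMeasurable.indicator measurableSet_Iic)
    (Eventually.of_forall fun t => ae_of_all _ fun s => norm_indicator_le_norm_self _ _)
    hf.norm ?_
  have h2 : ∀ᵐ s ∂leb T, s ≠ t₀ := by
    simp only [ae_iff, not_not]
    exact measure_singleton _
  filter_upwards [h2] with s hs
  rcases lt_or_gt_of_ne hs with hs | hs
  · refine ContinuousAt.congr (f := fun _ => f s) continuousAt_const ?_
    filter_upwards [lt_mem_nhds hs] with t ht
    exact (indicator_of_mem (show s ∈ Iic t from ht.le) f).symm
  · refine ContinuousAt.congr (f := fun _ => (0 : F)) continuousAt_const ?_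
    filter_upwards [gt_mem_nhds hs] with t ht
    exact (indicator_of_notMem (show s ∉ Iic t from not_le.mpr ht) f).symm

section Limit

variable {d₁ d₂ : ℕ} {T : ℝ} {S : StepSizes T} {g : E d₁ → E d₂ → E d₁} {x : E d₁}
  {lam : Measure (E d₂)} {Ω : ℕ → Type*} [∀ n, MeasurableSpace (Ω n)] {P : ∀ n, Measure (Ω n)}
  [∀ n, IsProbabilityMeasure (P n)]
  {ν : ∀ n, ℕ → Kernel (Ω n) (E d₂)} [∀ n k, IsMarkovKernel (ν n k)] {Y : ∀ n, ℕ → Ω n → E d₂}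
  {σ : ℕ → ℕ} {Q : Measure (PairSpace T d₁ d₂)} [IsProbabilityMeasure Q]

lemma abs_indicator_le {h₀ : I T → ℝ} {B : ℝ} (hB : ∀ s, |h₀ s| ≤ B) (t s : I T) :
    |(Iic t).indicator h₀ s| ≤ B := by
  by_cases hs : s ∈ Iic t
  · rw [indicator_of_mem hs]; exact hB s
  · rw [indicator_of_notMem hs, abs_zero]; exact (abs_nonneg _).trans (hB t)

lemma integrable_indicator_smul (hg : Measurable (Function.uncurry g)) {h₀ : I T → ℝ}
    (hm : Measurable h₀) {B : ℝ} (hB : ∀ s, |h₀ s| ≤ B) {z : PairSpace T d₁ d₂}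
    (hz : ∫⁻ p, ‖g (z.traj p.2) p.1‖ₑ ∂z.ctrl < ⊤) (t : I T) :
    Integrable (fun p => (Iic t).indicator h₀ p.2 • g (z.traj p.2) p.1) z.ctrl := by
  have h1 : Measurable fun p : E d₂ × I T => g (z.traj p.2) p.1 :=
    hg.comp ((z.traj.continuous.measurable.comp measurable_snd).prodMk measurable_fst)
  have h2 : Integrable (fun p : E d₂ × I T => g (z.traj p.2) p.1) z.ctrl :=
    ⟨h1.aestronglyMeasurable, hz⟩
  exact h2.bdd_smul B ((hm.indicator measurableSet_Iic).comp
    measurable_snd).aestronglyMeasurable (ae_of_all _ fun p => abs_indicator_le hB t p.2)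

/-- In the limit the updates are integrable against the control measure. -/
lemma UniformlyControlled.ae_lintegral_lt_top (hT : 0 ≤ T)
    (hU : UniformlyControlled S g x lam P ν Y) (hσ : StrictMono σ)
    (hQ : TendstoInDistribution (fun j => ctrlPair S g x (σ j) (ν (σ j)) (Y (σ j))) atTop id
      (fun j => P (σ j)) Q) {M : ℝ} (hM : ∀ n k, k < S.β n → S.hval n k ≤ M) :
    ∀ᵐ z : PairSpace T d₁ d₂ ∂Q, ∫⁻ p, ‖g (z.traj p.2) p.1‖ₑ ∂z.ctrl < ⊤ := by
  obtain ⟨K, hK0, hK⟩ := hU.update_tail 1 one_ne_zero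
  have h1 := hU.lintegral_tail_le hT hσ hQ hM hK
  have hg : Measurable fun q : E d₁ × (E d₂ × I T) => ENNReal.ofReal (‖g q.1 q.2.1‖ - K) :=
    ((hU.measurable_update.comp (measurable_fst.prodMk
      (measurable_fst.comp measurable_snd))).norm.sub_const K).ennreal_ofReal
  have h2 := ae_lt_top (measurable_lintegral_ctrl
    (F := fun a p => ENNReal.ofReal (‖g a p.1‖ - K)) hg)
    (h1.trans_lt (by simp)).ne
  filter_upwards [h2] with z hz
  calc ∫⁻ p, ‖g (z.traj p.2) p.1‖ₑ ∂z.ctrl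
      ≤ ∫⁻ p, (ENNReal.ofReal K + ENNReal.ofReal (‖g (z.traj p.2) p.1‖ - K)) ∂z.ctrl := by
        refine lintegral_mono fun p => ?_
        rw [← ofReal_norm]
        refine le_trans (ENNReal.ofReal_le_ofReal ?_) ENNReal.ofReal_add_le
        linarith
    _ = ENNReal.ofReal K + ∫⁻ p, ENNReal.ofReal (‖g (z.traj p.2) p.1‖ - K) ∂z.ctrl := by
        rw [lintegral_add_left measurable_const, lintegral_const, measure_univ, mul_one]
    _ < ⊤ := ENNReal.add_lt_top.mpr ⟨ENNReal.ofReal_lt_top, hz⟩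

/-- The integral equation in the limit, at a fixed time and for a fixed component. -/
lemma UniformlyControlled.ae_component_eq (hT : 0 ≤ T)
    (hU : UniformlyControlled S g x lam P ν Y) (hσ : StrictMono σ)
    (hQ : TendstoInDistribution (fun j => ctrlPair S g x (σ j) (ν (σ j)) (Y (σ j))) atTop id
      (fun j => P (σ j)) Q) {c M : ℝ} (hc : 0 < c)
    (hb : ∀ n k, k < S.β n → c ≤ S.hval n k ∧ S.hval n k ≤ M) {h₀ : I T → ℝ} (hm : Measurable h₀)
    {B : ℝ} (hB : ∀ s, |h₀ s| ≤ B) (hh : S.ProfileTendsto h₀) (t : I T) (j : Fin d₁) :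
    ∀ᵐ z : PairSpace T d₁ d₂ ∂Q, z.traj t j - x j =
      ∫ p, driftIntegrand h₀ t (fun a y => g a y j) (z.traj p.2) p ∂z.ctrl := by
  have hM : ∀ n k, k < S.β n → S.hval n k ≤ M := fun n k hk => (hb n k hk).2
  have hgj : Measurable (Function.uncurry fun a y => g a y j) :=
    (EuclideanSpace.proj (𝕜 := ℝ) j).continuous.measurable.comp hU.measurable_update
  have hFm := measurable_driftIntegrand hm t hgj
  have hmeas : Measurable fun z : PairSpace T d₁ d₂ => ENNReal.ofReal |z.traj t j - x j -
      ∫ p, driftIntegrand h₀ t (fun a y => g a y j) (z.traj p.2) p ∂z.ctrl| := by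
    have h1 : Measurable fun z : PairSpace T d₁ d₂ => z.traj t j :=
      ((EuclideanSpace.proj (𝕜 := ℝ) j).continuous.comp
        (PairSpace.continuous_eval.comp (continuous_id.prodMk continuous_const))).measurable
    exact ((h1.sub_const _).sub (measurable_integral_ctrl hFm)).abs.ennreal_ofReal
  have hzero : ∫⁻ z : PairSpace T d₁ d₂, ENNReal.ofReal |z.traj t j - x j -
      ∫ p, driftIntegrand h₀ t (fun a y => g a y j) (z.traj p.2) p ∂z.ctrl| ∂Q ≤ 0 := by
    refine ENNReal.le_of_forall_pos_le_add fun e he _ => ?_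
    obtain ⟨η, hη, hle⟩ : ∃ η : ℝ≥0, η ≠ 0 ∧
        (ENNReal.ofReal M + ENNReal.ofReal B) * η ≤ (e : ℝ≥0∞) := by
      refine ⟨e / (M.toNNReal + B.toNNReal + 1), by positivity, ?_⟩
      rw [ENNReal.ofReal, ENNReal.ofReal]
      norm_cast
      rw [mul_div_left_comm]
      exact mul_le_of_le_one_right zero_le (div_le_one_of_le₀ (by simp) zero_le)
    obtain ⟨K, hK0, hK⟩ := hU.update_tail η (by exact_mod_cast hη)
    have htail := hU.lintegral_tail_le hT hσ hQ hM hK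
    have hex : ∀ n, ∫⁻ ω, ENNReal.ofReal (excess S g x K n fun i => Y n i ω) ∂P n ≤
        ENNReal.ofReal M * η := fun n =>
      (lintegral_excess_le S x hU.measurable_update (hU.isControl n) (hM n) K).trans
        (mul_le_mul_right (hK n) _)
    have hdrift := hU.lintegral_drift_le hT hσ hQ hc hb hm hB hh hK0 hex t j
    have hg : Measurable fun q : E d₁ × (E d₂ × I T) => ENNReal.ofReal (‖g q.1 q.2.1‖ - K) :=
      ((hU.measurable_update.comp (measurable_fst.prodMk
        (measurable_fst.comp measurable_snd))).norm.sub_const K).ennreal_ofReal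
    have hmt : Measurable fun z : PairSpace T d₁ d₂ =>
        ENNReal.ofReal B * ∫⁻ p, ENNReal.ofReal (‖g (z.traj p.2) p.1‖ - K) ∂z.ctrl :=
      (measurable_lintegral_ctrl (F := fun a p => ENNReal.ofReal (‖g a p.1‖ - K)) hg).const_mul _
    rw [zero_add]
    refine le_trans ?_ hle
    calc _ ≤ ∫⁻ z : PairSpace T d₁ d₂, (ENNReal.ofReal |z.traj t j - x j -
            ∫ p, driftIntegrand h₀ t (truncUpdate g K j) (z.traj p.2) p ∂z.ctrl| +
          ENNReal.ofReal B * ∫⁻ p, ENNReal.ofReal (‖g (z.traj p.2) p.1‖ - K) ∂z.ctrl) ∂Q := by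
          refine lintegral_mono_ae ?_
          filter_upwards [hU.ae_lintegral_lt_top hT hσ hQ hM] with z hz
          refine (ENNReal.ofReal_le_ofReal (abs_sub_le _ (∫ p, driftIntegrand h₀ t
            (truncUpdate g K j) (z.traj p.2) p ∂z.ctrl) _)).trans
            (ENNReal.ofReal_add_le.trans (add_le_add le_rfl ?_))
          have hz1 : Measurable fun p : E d₂ × I T => (z.traj p.2, p) :=
            (z.traj.continuous.measurable.comp measurable_snd).prodMk measurable_id
          have hint1 : Integrable
              (fun p => driftIntegrand h₀ t (truncUpdate g K j) (z.traj p.2) p) z.ctrl :=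
            Integrable.of_bound ((measurable_driftIntegrand hm t (measurable_truncUpdate
              hU.measurable_update K j)).comp hz1).aestronglyMeasurable (B * K)
              (ae_of_all _ fun p => abs_driftIntegrand_le hB t (abs_truncUpdate_le g hK0 j) _ _)
          have hint2 : Integrable
              (fun p => driftIntegrand h₀ t (fun a y => g a y j) (z.traj p.2) p) z.ctrl :=
            (EuclideanSpace.proj (𝕜 := ℝ) j).integrable_comp
              (integrable_indicator_smul hU.measurable_update hm hB hz t)
          rw [← integral_sub hint1 hint2, ← Real.norm_eq_abs, ofReal_norm,
            ← lintegral_const_mul' _ _ ENNReal.ofReal_ne_top]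
          refine (enorm_integral_le_lintegral_enorm _).trans (lintegral_mono fun p => ?_)
          simp only [driftIntegrand]
          rw [← mul_sub, enorm_mul, Real.enorm_eq_ofReal_abs, Real.enorm_eq_ofReal_abs]
          refine mul_le_mul' (ENNReal.ofReal_le_ofReal (abs_indicator_le hB t _)) ?_
          rw [abs_sub_comm]
          refine (ENNReal.ofReal_le_ofReal (abs_sub_truncUpdate_le g hK0 j _ _)).trans ?_
          rw [ENNReal.ofReal_max, ENNReal.ofReal_zero, max_eq_left zero_le]
      _ ≤ (ENNReal.ofReal M + ENNReal.ofReal B) * η := by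
          rw [lintegral_add_right _ hmt, lintegral_const_mul' _ _ ENNReal.ofReal_ne_top, add_mul]
          exact add_le_add hdrift (mul_le_mul_right htail _)
  have h1 := (lintegral_eq_zero_iff hmeas).mp (nonpos_iff_eq_zero.mp hzero)
  filter_upwards [h1] with z hz
  have h2 := abs_nonpos_iff.mp (ENNReal.ofReal_eq_zero.mp hz)
  linarith

/-- Weak limits solve the integral equation: the identities for a dense sequence of times hold
almost surely at once, and both sides are continuous in time. -/
lemma UniformlyControlled.ae_limit_form (hT : 0 < T)
    (hU : UniformlyControlled S g x lam P ν Y) (hσ : StrictMono σ)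
    (hQ : TendstoInDistribution (fun j => ctrlPair S g x (σ j) (ν (σ j)) (Y (σ j))) atTop id
      (fun j => P (σ j)) Q) {c M : ℝ} (hc : 0 < c)
    (hb : ∀ n k, k < S.β n → c ≤ S.hval n k ∧ S.hval n k ≤ M) {h₀ : I T → ℝ} (hm : Measurable h₀)
    (hcM : ∀ s, c ≤ h₀ s ∧ h₀ s ≤ M) (hh : S.ProfileTendsto h₀) :
    ∀ᵐ z : PairSpace T d₁ d₂ ∂Q,
      (∀ (A : Set (E d₂)) (B : Set (I T)), MeasurableSet A → MeasurableSet B →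
        z.ctrl (A ×ˢ B) =
          ∫⁻ s in B, limitKernel T d₁ d₂ (z, s) A * ENNReal.ofReal (1 / h₀ s) ∂leb T) ∧
      (∫⁻ s, ∫⁻ y, ‖g (z.traj s) y‖ₑ ∂(limitKernel T d₁ d₂ (z, s)) ∂leb T < ⊤) ∧
      ∀ t : I T, z.traj t = x +
        ∫ s in Set.Iic t, ∫ y, g (z.traj s) y ∂(limitKernel T d₁ d₂ (z, s)) ∂leb T := by
  have : Nonempty (I T) := ⟨⟨0, le_rfl, hT.le⟩⟩
  have h0 : ∀ s, 0 < h₀ s := fun s => hc.trans_le (hcM s).1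
  have hB : ∀ s, |h₀ s| ≤ M := fun s => by
    rw [abs_of_pos (h0 s)]; exact (hcM s).2
  have hmarg := ae_map_snd_ctrl_eq hσ hQ hc (fun n k hk => (hb n k hk).1) hm
    (fun s => (hcM s).1) hh
  have hint := hU.ae_lintegral_lt_top hT.le hσ hQ fun n k hk => (hb n k hk).2
  have hcomp : ∀ᵐ z : PairSpace T d₁ d₂ ∂Q, ∀ (m : ℕ) (j : Fin d₁),
      z.traj (TopologicalSpace.denseSeq (I T) m) j - x j =
        ∫ p, driftIntegrand h₀ (TopologicalSpace.denseSeq (I T) m) (fun a y => g a y j)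
          (z.traj p.2) p ∂z.ctrl :=
    ae_all_iff.mpr fun m => ae_all_iff.mpr fun j =>
      hU.ae_component_eq hT.le hσ hQ hc hb hm hB hh _ j
  filter_upwards [hmarg, hint, hcomp] with z hz1 hz2 hz3
  have := isProbabilityMeasure_profileMeasure hz1
  have hF : Measurable fun p : E d₂ × I T => g (z.traj p.2) p.1 := hU.measurable_update.comp
    ((z.traj.continuous.measurable.comp measurable_snd).prodMk measurable_fst)
  have hfin : ∫⁻ s, ∫⁻ y, ‖g (z.traj s) y‖ₑ ∂(limitKernel T d₁ d₂ (z, s)) ∂leb T < ⊤ :=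
    (lintegral_leb_le hz1 hm h0 (fun s => (hcM s).2) hF.enorm).trans_lt
      (ENNReal.mul_lt_top ENNReal.ofReal_lt_top hz2)
  refine ⟨fun A B hA hB => ctrl_prod_eq hz1 hm hA hB, hfin, fun t => ?_⟩
  have hint : Integrable
      (fun s => ∫ y, g (z.traj s) y ∂(limitKernel T d₁ d₂ (z, s))) (leb T) := by
    refine ⟨StronglyMeasurable.aestronglyMeasurable ?_, ?_⟩
    · exact (hF.comp measurable_swap).stronglyMeasurable.integral_kernel_prod_right'
        (κ := (limitKernel T d₁ d₂).sectR z)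
    · exact (lintegral_mono fun s => enorm_integral_le_lintegral_enorm _).trans_lt hfin
  refine congrFun ((TopologicalSpace.denseRange_denseSeq (I T)).equalizer z.traj.continuous
    (continuous_const.add (continuous_integral_Iic hint)) (funext fun m => ?_)) t
  simp only [Function.comp_apply]
  set r := TopologicalSpace.denseSeq (I T) m
  have hint' := integrable_indicator_smul hU.measurable_update hm hB hz2 r
  refine Eq.trans ?_ (congrArg (fun v => x + v)
    (integral_ctrl_indicator_eq hz1 hm h0 r (G := fun p => g (z.traj p.2) p.1) hint'))
  ext j
  have h1 := (EuclideanSpace.proj (𝕜 := ℝ) j).integral_comp_comm hint'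
  have h2 : z.traj r j - x j = _ := (hz3 m j).trans h1
  rw [PiLp.add_apply]
  exact sub_eq_iff_eq_add'.mp h2

end Limit

end StochApprox

end

theorem theorem7p4 {d₁ d₂ : ℕ} {T : ℝ} (hT : 0 < T)
    -- the model: update function, noise kernels, step sizes, limit profile, initial condition
    (g : StochApprox.E d₁ → StochApprox.E d₂ → StochApprox.E d₁)
    (ρ : StochApprox.E d₁ → Kernel (StochApprox.E d₂) (StochApprox.E d₂))
    (lam : Measure (StochApprox.E d₂))
    (η : StochApprox.E d₁ → StochApprox.E d₂ → StochApprox.E d₂ → ℝ≥0)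
    (hA : StochApprox.Assumptions g ρ lam η)
    (S : StochApprox.StepSizes T) (h : StochApprox.I T → ℝ) (hh : S.ProfileTendsto h)
    (x : StochApprox.E d₁) (y₀ : StochApprox.E d₂)
    -- the controls and the controlled noise, for every `n` on some probability space
    {Ω : ℕ → Type*} [∀ n, MeasurableSpace (Ω n)] (P : ∀ n, Measure (Ω n))
    [∀ n, IsProbabilityMeasure (P n)]
    (ν : ∀ n, ℕ → Kernel (Ω n) (StochApprox.E d₂)) [∀ n k, IsMarkovKernel (ν n k)]
    (Y : ∀ n, ℕ → Ω n → StochApprox.E d₂)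
    (hν : ∀ n, StochApprox.IsControl (P n) (S.β n) (ν n) (Y n))
    (hcost : ⨆ n, StochApprox.runningCost S g ρ x y₀ n (P n) (ν n) (Y n) < ⊤) :
    -- the pairs are random elements and their laws are tight
    (∀ n, Measurable (StochApprox.ctrlPair S g x n (ν n) (Y n))) ∧
    IsTightMeasureSet
      (Set.range fun n => (P n).map (StochApprox.ctrlPair S g x n (ν n) (Y n))) ∧
    -- every subsequence has a further subsequence that converges weakly
    (∀ φ : ℕ → ℕ, StrictMono φ → ∃ ψ : ℕ → ℕ, StrictMono ψ ∧
      ∃ (Q : Measure (StochApprox.PairSpace T d₁ d₂)) (_ : IsProbabilityMeasure Q),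
        TendstoInDistribution
          (fun j => StochApprox.ctrlPair S g x (φ (ψ j)) (ν (φ (ψ j))) (Y (φ (ψ j)))) atTop id
          (fun j => P (φ (ψ j))) Q) ∧
    -- every weak limit of a subsequence has the stated form
    (∀ φ : ℕ → ℕ, StrictMono φ →
      ∀ (Q : Measure (StochApprox.PairSpace T d₁ d₂)) [IsProbabilityMeasure Q],
        TendstoInDistribution
          (fun j => StochApprox.ctrlPair S g x (φ j) (ν (φ j)) (Y (φ j))) atTop id
          (fun j => P (φ j)) Q →
        ∃ κ : Kernel (StochApprox.PairSpace T d₁ d₂ × StochApprox.I T) (StochApprox.E d₂),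
          IsMarkovKernel κ ∧ ∀ᵐ z ∂Q,
            (∀ (A : Set (StochApprox.E d₂)) (B : Set (StochApprox.I T)),
              MeasurableSet A → MeasurableSet B →
              z.ctrl (A ×ˢ B) = ∫⁻ s in B, κ (z, s) A * ENNReal.ofReal (1 / h s) ∂StochApprox.leb T) ∧
            (∫⁻ s, ∫⁻ y, ‖g (z.traj s) y‖ₑ ∂(κ (z, s)) ∂StochApprox.leb T < ⊤) ∧
            ∀ t : StochApprox.I T,
              z.traj t = x + ∫ s in Set.Iic t, ∫ y, g (z.traj s) y ∂(κ (z, s)) ∂StochApprox.leb T) := by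
  obtain ⟨c, M, hc, hcM, hb⟩ := S.exists_bounds hT hh
  obtain ⟨h₀, hm, hcM₀, hh₀, hh₀h⟩ := S.exists_nice_profile hh hcM hb
  have hU := StochApprox.uniformlyControlled S x y₀ hA hcost hν hc hb
  have hpair : ∀ n, Measurable (StochApprox.ctrlPair S g x n (ν n) (Y n)) := fun n =>
    StochApprox.measurable_ctrlPair S hU.measurable_update x (hU.isControl n)
  have htight := hU.isTightMeasureSet hT.le fun n k hk => (hb n k hk).2
  refine ⟨hpair, htight, fun φ _ =>
    StochApprox.exists_subseq_tendstoInDistribution hpair htight φ, fun φ hφ Q _ hQ => ?_⟩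
  refine ⟨StochApprox.limitKernel T d₁ d₂, inferInstance, ?_⟩
  filter_upwards [hU.ae_limit_form hT hφ hQ hc hb hm hcM₀ hh₀] with z ⟨hz1, hz2, hz3⟩
  refine ⟨fun A B hA hB => (hz1 A B hA hB).trans ?_, hz2, hz3⟩
  -- the two profiles agree except possibly at the final time, a null set
  refine lintegral_congr_ae (ae_restrict_of_ae ?_)
  filter_upwards [StochApprox.ae_coe_lt T] with s hs
  rw [hh₀h s hs]
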